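/- Let $T=[v_1,v_2,v_3]\subset\mathbb{R}^2$ be a nondegenerate closed triangle, and put $v_4=\frac{v_1+v_2}2$, $v_5=\frac{v_2+v_3}2$, $v_6=\frac{v_1+v_3}2$, $v_7=\frac{v_4+v_6}2$, $v_8=\frac{v_4+v_5}2$, $v_9=\frac{v_5+v_6}2$, $v_{10}=\frac{v_1+v_2+v_3}3$. The segments joining $v_1,\dots,v_6$ pairwise cut $T$ into twelve triangular faces (the Powell–Sabin 12-split). Assign every point of $T$ to exactly one of the closed faces containing it, and call the set of points assigned to a face the corresponding half-open face. Let $\mathcal S^3_5$ be the space of functions that are $C^3$ on $T$ and a polynomial of degree at most $5$ on each face. For a finite multiset $K$ of points of $\{v_1,\dots,v_{10}\}$ let $[K]$ be its convex hull and $[K)$ the union of the half-open faces whose closed faces lie in $[K]$. The simplex spline $Q[K]$ is $0$ if $\mathrm{area}[K]=0$; otherwise it is $\frac{\mathrm{area}(T)}{\mathrm{area}[K]}\mathbf 1_{[K)}$ if $|K|=3$, and $Q[K](x)=\sum_j\beta_j\,Q[K\setminus v_j](x)$ if $|K|>3$, where $x=\sum_j\beta_jv_j$, $\sum_j\beta_j=1$,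 and $\beta_j=0$ for $v_j\notin K$. (The bases below use only knots $v_1,\dots,v_6$. On $T$ their members depend neither on the assignment of points to faces nor on the choice of the $\beta_j$.) Write $Q_{ijklmn}:=Q[v_1^iv_2^jv_3^kv_4^lv_5^mv_6^n]$. Let $c_1,c_2,c_3$ be indeterminates and let $c_4,\dots,c_{10}$ be formed from them as $v_4,\dots,v_{10}$ are formed from $v_1,v_2,v_3$. The following list gives a label, a simplex spline, and a weight times a dual polynomial: - a: $Q_{600101}$, $\frac14c_1^5$; b: $Q_{500201}$, $\frac14c_1^4c_4$; e: $Q_{410201}$, $\frac12c_1^3c_4^2$; f: $Q_{320201}$, $\frac12c_1^2c_2c_4^2$; - g: $Q_{220211}$, $\frac34c_1c_2c_4^2c_{10}$; g′: $Q_{220211}$, $\frac14c_1c_2c_3c_4^2$; l: $Q_{141110}$, $c_2^3c_4c_5$; - n: $Q_{222110}$, $\frac34c_1c_2^2c_3c_{10}$; o: $Q_{221111}$, $\frac34c_1c_2c_3c_4c_{10}$; q: $Q_{321200}$, $c_1^2c_2c_4^2$; r: $Q_{131210}$, $\frac12c_1c_2^2c_4c_5$; - s: $Q_{221210}$, $\frac34c_1c_2^2c_4c_{10}$;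 s′: $Q_{221210}$, $\frac14c_1c_2^2c_3c_4$; t: $Q_{121211}$, $\frac34c_1c_2c_4c_5c_{10}$; t′: $Q_{121211}$, $\frac12c_1c_2c_3c_4c_8$. The bases $\mathcal B_a,\dots,\mathcal B_f$ consist of the orbits, under all permutations of $v_1,v_2,v_3$ (acting simultaneously on knots and dual polynomials, and keeping the weights), of the rows abeflnrs, abeflors, abefglrt, abelnqrs′, abeloqrs′ and abeg′lqrt′, respectively. Each orbit union has 39 members; the corresponding basis functions $S_1,\dots,S_{39}$ are the weights times the simplex splines. The domain point $\xi_i$ of $S_i$ is the average of the five points obtained by replacing each factor $c_j$ of its dual polynomial by $v_j$ (with multiplicity). Fix one of these bases $\mathcal B_\star$ and write $f=S^Tc=\sum_{i=1}^{39}c_iS_i$ for $c\in\mathbb R^{39}$. Call $K>0$ a stability constant of $\mathcal B_\star$ if $K^{-1}\|c\|_\infty\le\|f\|_{L_\infty(T)}\le\|c\|_\infty$ for all nondegenerate triangles $T$ and all $c\in\mathbb R^{39}$. **Corollary.** (i) For every nondegenerate triangle $T$ the collocation matrix $M_\star=(S_j(\xi_i))_{i,j}$ is nonsingular, the number $\|M_\star^{-1}\|_\infty$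 (maximal absolute row sum) is the same for all nondegenerate $T$, and it is a stability constant of $\mathcal B_\star$. (ii) Let $K_\star$ be any stability constant of $\mathcal B_\star$, in particular $K_\star=\|M_\star^{-1}\|_\infty$. For every nondegenerate triangle $T$ with longest edge $h$ and every $c\in\mathbb R^{39}$, the spline $f=S^Tc$ lies in $\mathcal S^3_5$, and with $H(x)$ the Hessian matrix of $f|_T$ at $x$ (one-sided on the boundary), the maximum of $\|H(x)\|_\infty$ (maximal absolute row sum) over $x\in T$ exists and $$\max_{1\le i\le 39}|c_i-f(\xi_i)|\le 2K_\star h^2\max_{x\in T}\|H(x)\|_\infty .$$ -/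

import Mathlib

open MeasureTheory

attribute [local instance] Matrix.linftyOpNormedAddCommGroup

namespace PS12

/-- The Euclidean plane. -/
abbrev Plane := EuclideanSpace ℝ (Fin 2)

/-! ### The Powell-Sabin 12-split of the triangle with vertices `v 0, v 1, v 2`

The mathematical labels `1, ..., 10` of the vertices of the split are `0, ..., 9` here. -/

/-- The (closed) macrotriangle. -/
def triangle (v : Fin 3 → Plane) : Set Plane := convexHull ℝ (Set.range v)

/-- The ten vertices of the 12-split: the three corners, the midpoints of the edges
`[v₁, v₂]`, `[v₂, v₃]`, `[v₁, v₃]`, the midpoints of `[v₄, v₆]`, `[v₄, v₅]`, `[v₅, v₆]`,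
and the barycentre. -/
noncomputable def vertex (v : Fin 3 → Plane) : Fin 10 → Plane :=
  ![v 0, v 1, v 2,
    (1 / 2 : ℝ) • (v 0 + v 1), (1 / 2 : ℝ) • (v 1 + v 2), (1 / 2 : ℝ) • (v 0 + v 2),
    (1 / 4 : ℝ) • ((v 0 + v 1) + (v 0 + v 2)),
    (1 / 4 : ℝ) • ((v 0 + v 1) + (v 1 + v 2)),
    (1 / 4 : ℝ) • ((v 1 + v 2) + (v 0 + v 2)),
    (1 / 3 : ℝ) • (v 0 + v 1 + v 2)]

/-- The vertex labels of the twelve faces of the split. -/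
def faceVertices : Fin 12 → Finset (Fin 10) :=
  ![{0, 5, 6}, {0, 3, 6}, {1, 3, 7}, {1, 4, 7}, {2, 4, 8}, {2, 5, 8},
    {5, 6, 9}, {3, 6, 9}, {3, 7, 9}, {4, 7, 9}, {4, 8, 9}, {5, 8, 9}]

/-- The closed faces of the 12-split. -/
def face (v : Fin 3 → Plane) (k : Fin 12) : Set Plane :=
  convexHull ℝ (vertex v '' (faceVertices k : Set (Fin 10)))

/-- The half-open faces: every point of the macrotriangle is assigned to exactly one face, namely
the first closed face that contains it. -/
def halfOpenFace (v : Fin 3 → Plane) (k : Fin 12) : Set Plane :=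
  {x | x ∈ face v k ∧ ∀ l < k, x ∉ face v l}

/-- The `C³` quintic splines on the 12-split. -/
def splineSpace (v : Fin 3 → Plane) : Set (Plane → ℝ) :=
  {f | ContDiffOn ℝ 3 f (triangle v) ∧
    ∀ k : Fin 12, ∃ p : MvPolynomial (Fin 2) ℝ, p.totalDegree ≤ 5 ∧
      ∀ x ∈ face v k, f x = MvPolynomial.eval (fun i => x i) p}

/-! ### Simplex splines

A knot multiset `{v₁^{m₁} ⋯ v₁₀^{m₁₀}}` is given by its multiplicities `m : Fin 10 → ℕ`. -/

/-- The convex hull `[K]`. -/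
def hull (v : Fin 3 → Plane) (m : Fin 10 → ℕ) : Set Plane :=
  convexHull ℝ (vertex v '' {j | m j ≠ 0})

/-- The half-open convex hull `[K)`: the union of the half-open faces whose closed face lies
in `[K]`. -/
def halfOpenHull (v : Fin 3 → Plane) (m : Fin 10 → ℕ) : Set Plane :=
  ⋃ k ∈ {k : Fin 12 | face v k ⊆ hull v m}, halfOpenFace v k

/-- The area of a plane set. -/
noncomputable def area (s : Set Plane) : ℝ := (volume s).toReal

/-- Twice the signed area of the triangle `p, q, r`. -/
def orient (p q r : Plane) : ℝ :=
  (q 0 - p 0) * (r 1 - p 1) - (q 1 - p 1) * (r 0 - p 0)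

/-- The increasing triples of labels, in lexicographic order. -/
def triples : List (Fin 10 × Fin 10 × Fin 10) :=
  ((List.finRange 10).flatMap fun i => (List.finRange 10).flatMap fun j =>
    (List.finRange 10).map fun k => (i, j, k)).filter fun t => t.1 < t.2.1 ∧ t.2.1 < t.2.2

open Classical in
/-- The first triple of labels of knots (all of positive multiplicity) that are not collinear,
if there is one. -/
noncomputable def knotTriple (v : Fin 3 → Plane) (m : Fin 10 → ℕ) :
    Option (Fin 10 × Fin 10 × Fin 10) :=
  triples.find? fun t => m t.1 ≠ 0 ∧ m t.2.1 ≠ 0 ∧ m t.2.2 ≠ 0 ∧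
    orient (vertex v t.1) (vertex v t.2.1) (vertex v t.2.2) ≠ 0

/-- Coefficients `β₁, ..., β₁₀` with `x = ∑ βⱼ vⱼ`, `∑ βⱼ = 1` and `βⱼ = 0` whenever `mⱼ = 0`
(see `knotCoeff_spec`): the barycentric coordinates of `x` with respect to the first triple of
non-collinear knots. -/
noncomputable def knotCoeff (v : Fin 3 → Plane) (m : Fin 10 → ℕ) (x : Plane) : Fin 10 → ℝ :=
  match knotTriple v m with
  | none => 0
  | some (i, j, k) =>
      let p := vertex v i
      let q := vertex v j
      let r := vertex v k
      Pi.single i (orient x q r / orient p q r) + Pi.single j (orient p x r / orient p q r) +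
        Pi.single k (orient p q x / orient p q r)

open Classical in
/-- The (area normalized) simplex spline `Q[K]` of degree `d`, for a knot multiset `K` with
`d + 3` elements, by recursion on the degree. -/
noncomputable def simplexSpline (v : Fin 3 → Plane) : ℕ → (Fin 10 → ℕ) → Plane → ℝ
  | 0, m, x =>
      if area (hull v m) = 0 then 0
      else (halfOpenHull v m).indicator (fun _ => area (triangle v) / area (hull v m)) x
  | d + 1, m, x =>
      if area (hull v m) = 0 then 0
      else ∑ j, knotCoeff v m x j * simplexSpline v d (m - Pi.single j 1) x

/-! ### Symmetries -/

/-- The permutation of the ten vertices of the split induced by a permutation `σ` of the three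
corners. -/
def vertexPerm (σ : Equiv.Perm (Fin 3)) : Fin 10 → Fin 10 :=
  let corner : Fin 3 → Fin 10 := ![0, 1, 2]
  -- the midpoint of the edge opposite to a corner
  let opposite : Fin 3 → Fin 10 := ![4, 5, 3]
  -- the midpoint of the segment that cuts off a corner
  let near : Fin 3 → Fin 10 := ![6, 7, 8]
  ![corner (σ 0), corner (σ 1), corner (σ 2),
    opposite (σ 2), opposite (σ 0), opposite (σ 1),
    near (σ 0), near (σ 1), near (σ 2), 9]

/-- The image of a multiset of vertices, given by its multiplicities, under a permutation of
the corners. -/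
def permute (σ : Equiv.Perm (Fin 3)) (m : Fin 10 → ℕ) : Fin 10 → ℕ :=
  fun j => m (vertexPerm σ⁻¹ j)

/-! ### The six bases -/

/-- A weighted simplex spline `w Q[K]` with its dual polynomial: the knot multiset `K`, the
weight `w` and the multiset of the five dual points. A product `c₁^{n₁} ⋯ c₁₀^{n₁₀}` of linear
forms stands for the dual points `{v₁^{n₁} ⋯ v₁₀^{n₁₀}}`. -/
abbrev Entry := (Fin 10 → ℕ) × ℚ × (Fin 10 → ℕ)

/-- The names of the six bases. -/
inductive BasisName
  | Ba | Bb | Bc | Bd | Be | Bf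

/-- Representatives of the `S₃` equivalence classes in each basis. -/
def representatives : BasisName → List Entry :=
  -- knots 600101, dual polynomial c₁⁵
  let qa : Entry := (![6, 0, 0, 1, 0, 1, 0, 0, 0, 0], 1 / 4, ![5, 0, 0, 0, 0, 0, 0, 0, 0, 0])
  -- knots 500201, dual polynomial c₁⁴c₄
  let qb : Entry := (![5, 0, 0, 2, 0, 1, 0, 0, 0, 0], 1 / 4, ![4, 0, 0, 1, 0, 0, 0, 0, 0, 0])
  -- knots 410201, dual polynomial c₁³c₄²
  let qe : Entry := (![4, 1, 0, 2, 0, 1, 0, 0, 0, 0], 1 / 2, ![3, 0, 0, 2, 0, 0, 0, 0, 0, 0])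
  -- knots 320201, dual polynomial c₁²c₂c₄²
  let qf : Entry := (![3, 2, 0, 2, 0, 1, 0, 0, 0, 0], 1 / 2, ![2, 1, 0, 2, 0, 0, 0, 0, 0, 0])
  -- knots 220211, dual polynomial c₁c₂c₄²c₁₀ (basis c)
  let qg : Entry := (![2, 2, 0, 2, 1, 1, 0, 0, 0, 0], 3 / 4, ![1, 1, 0, 2, 0, 0, 0, 0, 0, 1])
  -- knots 220211, dual polynomial c₁c₂c₃c₄² (basis f)
  let qg' : Entry := (![2, 2, 0, 2, 1, 1, 0, 0, 0, 0], 1 / 4, ![1, 1, 1, 2, 0, 0, 0, 0, 0, 0])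
  -- knots 141110, dual polynomial c₂³c₄c₅
  let ql : Entry := (![1, 4, 1, 1, 1, 0, 0, 0, 0, 0], 1, ![0, 3, 0, 1, 1, 0, 0, 0, 0, 0])
  -- knots 222110, dual polynomial c₁c₂²c₃c₁₀
  let qn : Entry := (![2, 2, 2, 1, 1, 0, 0, 0, 0, 0], 3 / 4, ![1, 2, 1, 0, 0, 0, 0, 0, 0, 1])
  -- knots 221111, dual polynomial c₁c₂c₃c₄c₁₀
  let qo : Entry := (![2, 2, 1, 1, 1, 1, 0, 0, 0, 0], 3 / 4, ![1, 1, 1, 1, 0, 0, 0, 0, 0, 1])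
  -- knots 321200, dual polynomial c₁²c₂c₄²
  let qq : Entry := (![3, 2, 1, 2, 0, 0, 0, 0, 0, 0], 1, ![2, 1, 0, 2, 0, 0, 0, 0, 0, 0])
  -- knots 131210, dual polynomial c₁c₂²c₄c₅
  let qr : Entry := (![1, 3, 1, 2, 1, 0, 0, 0, 0, 0], 1 / 2, ![1, 2, 0, 1, 1, 0, 0, 0, 0, 0])
  -- knots 221210, dual polynomial c₁c₂²c₄c₁₀ (bases a, b)
  let qs : Entry := (![2, 2, 1, 2, 1, 0, 0, 0, 0, 0], 3 / 4, ![1, 2, 0, 1, 0, 0, 0, 0, 0, 1])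
  -- knots 221210, dual polynomial c₁c₂²c₃c₄ (bases d, e)
  let qs' : Entry := (![2, 2, 1, 2, 1, 0, 0, 0, 0, 0], 1 / 4, ![1, 2, 1, 1, 0, 0, 0, 0, 0, 0])
  -- knots 121211, dual polynomial c₁c₂c₄c₅c₁₀ (basis c)
  let qt : Entry := (![1, 2, 1, 2, 1, 1, 0, 0, 0, 0], 3 / 4, ![1, 1, 0, 1, 1, 0, 0, 0, 0, 1])
  -- knots 121211, dual polynomial c₁c₂c₃c₄c₈ (basis f)
  let qt' : Entry := (![1, 2, 1, 2, 1, 1, 0, 0, 0, 0], 1 / 2, ![1, 1, 1, 1, 0, 0, 0, 1, 0, 0])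
  fun
  | .Ba => [qa, qb, qe, qf, ql, qn, qr, qs]
  | .Bb => [qa, qb, qe, qf, ql, qo, qr, qs]
  | .Bc => [qa, qb, qe, qf, qg, ql, qr, qt]
  | .Bd => [qa, qb, qe, ql, qn, qq, qr, qs']
  | .Be => [qa, qb, qe, ql, qo, qq, qr, qs']
  | .Bf => [qa, qb, qe, qg', ql, qq, qr, qt']

/-- The 39 members of a basis: the union of the `S₃` equivalence classes of its
representatives. -/
def entries (b : BasisName) : Finset Entry :=
  (Finset.univ ×ˢ (representatives b).toFinset).image
    fun s : Equiv.Perm (Fin 3) × Entry => (permute s.1 s.2.1, s.2.2.1, permute s.1 s.2.2.2)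

/-- The index set of a basis; it has 39 elements. -/
abbrev Index (b : BasisName) := {s : Entry // s ∈ entries b}

/-- The basis function `S = w Q[K]`. -/
noncomputable def basisSpline (b : BasisName) (v : Fin 3 → Plane) (s : Index b) : Plane → ℝ :=
  fun x => (s.1.2.1 : ℝ) * simplexSpline v 5 s.1.1 x

/-- The domain point of a basis function: the average of its five dual points. -/
noncomputable def domainPoint (b : BasisName) (v : Fin 3 → Plane) (s : Index b) : Plane :=
  (1 / 5 : ℝ) • ∑ j, (s.1.2.2 j : ℝ) • vertex v j

/-- The spline `f = Sᵀ c`. -/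
noncomputable def spline (b : BasisName) (v : Fin 3 → Plane) (c : Index b → ℝ) : Plane → ℝ :=
  fun x => ∑ s, c s * basisSpline b v s x

/-- The collocation matrix `M = (Sⱼ(ξᵢ))`. -/
noncomputable def collocation (b : BasisName) (v : Fin 3 → Plane) :
    Matrix (Index b) (Index b) ℝ :=
  Matrix.of fun i j => basisSpline b v j (domainPoint b v i)

/-- `K > 0` is a stability constant of the basis, the same for all triangles:
`K⁻¹ ‖c‖_∞ ≤ ‖f‖_{L_∞} ≤ ‖c‖_∞` for every `f = Sᵀ c` on every nondegenerate triangle. -/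
def IsStabilityConstant (b : BasisName) (K : ℝ) : Prop :=
  0 < K ∧ ∀ v : Fin 3 → Plane, AffineIndependent ℝ v → ∀ c : Index b → ℝ,
    ENNReal.ofReal (K⁻¹ * ‖c‖) ≤ eLpNorm (spline b v c) ⊤ (volume.restrict (triangle v)) ∧
    eLpNorm (spline b v c) ⊤ (volume.restrict (triangle v)) ≤ ENNReal.ofReal ‖c‖

/-- The Hessian matrix at `x` of a function on the macrotriangle (one-sided on the boundary). -/
noncomputable def hessian (v : Fin 3 → Plane) (f : Plane → ℝ) (x : Plane) :
    Matrix (Fin 2) (Fin 2) ℝ :=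
  Matrix.of fun i j => iteratedFDerivWithin ℝ 2 f (triangle v) x
    ![EuclideanSpace.single i 1, EuclideanSpace.single j 1]

/-- The length of the longest edge. -/
noncomputable def longestEdge (v : Fin 3 → Plane) : ℝ :=
  max (max (dist (v 0) (v 1)) (dist (v 1) (v 2))) (dist (v 0) (v 2))

/-! ### Sanity facts for the definitions -/

theorem card_entries (b : BasisName) : (entries b).card = 39 := by
  cases b <;> decide +kernel

theorem vertex_vertexPerm (v : Fin 3 → Plane) (σ : Equiv.Perm (Fin 3)) (j : Fin 10) :
    vertex v (vertexPerm σ j) = vertex (v ∘ σ) j := by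
  have h01 : σ 0 ≠ σ 1 := fun h => absurd (σ.injective h) (by decide)
  have h02 : σ 0 ≠ σ 2 := fun h => absurd (σ.injective h) (by decide)
  have h12 : σ 1 ≠ σ 2 := fun h => absurd (σ.injective h) (by decide)
  simp only [vertex, vertexPerm, Function.comp_apply]
  generalize σ 0 = x at *
  generalize σ 1 = y at *
  generalize σ 2 = z at *
  fin_cases x <;> fin_cases y <;> first | exact absurd rfl h01 | skip
  all_goals fin_cases z <;> first | exact absurd rfl h02 | exact absurd rfl h12 | skip
  all_goals fin_cases j <;> simp <;> abel

theorem knotCoeff_spec (v : Fin 3 → Plane) (m : Fin 10 → ℕ) (h : knotTriple v m ≠ none)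
    (x : Plane) :
    (∑ j, knotCoeff v m x j • vertex v j = x) ∧ ∑ j, knotCoeff v m x j = 1 ∧
      ∀ j, m j = 0 → knotCoeff v m x j = 0 := by
  rcases ht : knotTriple v m with _ | ⟨i, j, k⟩
  · exact absurd ht h
  · have hp := List.find?_some ht
    simp only [decide_eq_true_eq] at hp
    obtain ⟨hi, hj, hk, ho⟩ := hp
    simp only [knotCoeff, ht]
    refine ⟨?_, ?_, ?_⟩
    · simp only [Pi.add_apply, add_smul, Finset.sum_add_distrib, Pi.single_apply, ite_smul,
        zero_smul, Finset.sum_ite_eq', Finset.mem_univ, if_true]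
      generalize vertex v i = p at *
      generalize vertex v j = q at *
      generalize vertex v k = r at *
      ext l
      simp only [PiLp.add_apply, PiLp.smul_apply, smul_eq_mul]
      field_simp
      fin_cases l <;> simp [orient] <;> ring
    · simp only [Pi.add_apply, Finset.sum_add_distrib, Finset.sum_pi_single', Finset.mem_univ,
        if_true]
      generalize vertex v i = p at *
      generalize vertex v j = q at *
      generalize vertex v k = r at *
      field_simp
      simp only [orient]
      ring
    · intro l hl
      have h1 : l ≠ i := fun h => hi (h ▸ hl)
      have h2 : l ≠ j := fun h => hj (h ▸ hl)
      have h3 : l ≠ k := fun h => hk (h ▸ hl)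
      simp [h1, h2, h3]

end PS12

/-! In barycentric coordinates `x`, `y` with respect to the macrotriangle, neither the basis
functions nor the domain points depend on the triangle. Apart from the analysis at the end, the
proof is therefore a finite computation with integers.

Across a line `ℓ = 0` two `C³` quintic pieces may differ by `ℓ⁴` times an affine function. This
suggests 39 generators: the 21 monomials of degree 5 in `x`, `y`, `o` (with `o = 1`), and the
products of `max ℓ 0 ^ 4` with `o`, `x`, `y` for the six interior lines `ℓ`. Every simplex spline
that occurs is tabulated by an integer coefficient vector. Running the defining recursion face by
face confirms the table, so on the macrotriangle each basis function equals one function defined on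
the whole plane (`simplexSpline_eq_splineVal`).

Four facts about the bases follow from the table. The functions are `C³` and quintic on each face,
because the fourth power of a positive part is `C³` (`contDiff_splineVal`,
`exists_polynomial_facePiece`). They are nonnegative, because on each face the piece is a polynomial
with nonnegative coefficients in the barycentric coordinates of that face (`splineVal_nonneg`). They
reproduce affine functions, with the values at the domain points as coefficients, because weighted
sums of coefficient vectors are multiples of unit vectors (`sum_affine_mul_smoothBasis`). Finally,
an integral multiple of the collocation matrix `M` has an inverse modulo 17, so `det M ≠ 0`
(`isUnit_det_collocationMatrix`).

Nonnegativity and the partition of unity give `‖f‖ ≤ ‖c‖`. Since `c = M⁻¹ (f(ξᵢ))ᵢ`, also `‖c‖ ≤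
‖M⁻¹‖ ‖f‖` (`isStabilityConstant_norm_inv`). For the error at `ξᵢ`, subtract from `f` its tangent
plane `φ` at `ξᵢ`. By affine reproduction `f - φ` has the coefficients `cⱼ - φ(ξⱼ)`, and the one
with index `i` is `cᵢ - f(ξᵢ)`. Stability bounds it by `K` times the maximum of `|f - φ|`, which two
applications of the mean value inequality bound by `2 h² max ‖H‖` (`norm_coeff_sub_le`). -/

namespace PS12

/-! ### Polynomial arithmetic that reduces in the kernel -/

/-- The ring operations, without the laws. -/
class Ops (α : Type*) where
  add : α → α → α
  mul : α → α → α
  smul : ℤ → α → α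
  ofInt : ℤ → α

/-- The bare functions on `ℤ` reduce quickly in the kernel. The instance for commutative rings has
low priority, so that integer computations use this one; the same generic definitions then serve for
real numbers, functions and polynomials. -/
instance : Ops ℤ := ⟨Int.add, Int.mul, Int.mul, id⟩

noncomputable instance (priority := low) {R : Type*} [CommRing R] : Ops R :=
  ⟨(· + ·), (· * ·), fun n x => (n : R) * x, fun n => (n : R)⟩

/-- Coefficientwise addition of lists of coefficients. -/
def addList {α : Type*} [Ops α] : List α → List α → List α
  | [], q => q
  | a :: p, [] => a :: p
  | a :: p, b :: q => Ops.add a b :: addList p q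

def mulList {α : Type*} [Ops α] : List α → List α → List α
  | [], _ => []
  | a :: p, q => addList (q.map (Ops.mul a)) (Ops.ofInt 0 :: mulList p q)

/-- A list stands for the polynomial with these coefficients, in ascending order. -/
instance {α : Type*} [Ops α] : Ops (List α) where
  add := addList
  mul := mulList
  -- Zero is the empty list, so vanishing coefficients in the sparse tables cost no arithmetic.
  smul n p := if n = 0 then [] else p.map (Ops.smul n)
  ofInt n := if n = 0 then [] else [Ops.ofInt n]

def linForm {α : Type*} [Ops α] (l : ℤ × ℤ × ℤ) (x y o : α) : α :=
  Ops.add (Ops.smul l.1 x) (Ops.add (Ops.smul l.2.1 y) (Ops.smul l.2.2 o))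

def powOps {α : Type*} [Ops α] (x : α) : ℕ → α
  | 0 => Ops.ofInt 1
  | n + 1 => Ops.mul x (powOps x n)

/-- The monomials of degree `5` in `x`, `y`, `o`. -/
def monomials {α : Type*} [Ops α] (x y o : α) : List α :=
  (List.range 6).flatMap fun i => (List.range (6 - i)).map fun j =>
    Ops.mul (powOps x i) (Ops.mul (powOps y j) (powOps o (5 - i - j)))

/-- The generators of the quintic `C³` splines: the monomials, and the products of the given fourth
powers `t` with `o`, `x` and `y`. -/
def generators {α : Type*} [Ops α] (t : List α) (x y o : α) : List α :=
  monomials x y o ++ t.flatMap fun s => [Ops.mul s o, Ops.mul s x, Ops.mul s y]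

def linComb {α : Type*} [Ops α] : List ℤ → List α → α
  | c :: cs, a :: as => Ops.add (Ops.smul c a) (linComb cs as)
  | _, _ => Ops.ofInt 0

/-- The interior lines of the 12-split, as linear forms in `x`, `y` and `o`, the first two
barycentric coordinates and the sum of all three. -/
def lines : List (ℤ × ℤ × ℤ) :=
  [(1, -1, 0), (1, 2, -1), (2, 1, -1), (2, 0, -1), (0, 2, -1), (-2, -2, 1)]

/-- Twelve times the first two barycentric coordinates of the vertices of the split. -/
def vertexCoords : List (ℤ × ℤ) :=
  [(12, 0), (0, 12), (0, 0), (6, 6), (0, 6), (6, 0), (6, 3), (3, 6), (3, 3), (4, 4)]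

def faceLists : List (List ℕ) :=
  [[0, 5, 6], [0, 3, 6], [1, 3, 7], [1, 4, 7], [2, 4, 8], [2, 5, 8],
    [5, 6, 9], [3, 6, 9], [3, 7, 9], [4, 7, 9], [4, 8, 9], [5, 8, 9]]

/-- The value of a linear form at a vertex, times twelve. -/
def formAt (l : ℤ × ℤ × ℤ) (j : ℕ) : ℤ :=
  let p := vertexCoords.getD j (0, 0)
  l.1 * p.1 + l.2.1 * p.2 + l.2.2 * 12

/-- Three non-collinear knots with their barycentric coordinate functions, the reciprocal of the
area of their triangle, and the faces which this triangle contains. -/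
structure TripleData where
  i : ℕ
  j : ℕ
  k : ℕ
  fi : ℤ × ℤ × ℤ
  fj : ℤ × ℤ × ℤ
  fk : ℤ × ℤ × ℤ
  ratio : ℤ
  inside : List Bool

def tripleTable : List TripleData := [
  ⟨0, 1, 2, (1, 0, 0), (0, 1, 0), (-1, -1, 1), 1,
    [true, true, true, true, true, true, true, true, true, true, true, true]⟩,
  ⟨0, 1, 4, (1, 0, 0), (1, 2, -1), (-2, -2, 2), 2,
    [false, true, true, true, false, false, false, true, true, true, false, false]⟩,
  ⟨0, 1, 5, (2, 1, -1), (0, 1, 0), (-2, -2, 2), 2,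
    [true, true, true, false, false, false, true, true, true, false, false, false]⟩,
  ⟨0, 2, 3, (1, -1, 0), (-1, -1, 1), (0, 2, 0), 2,
    [true, true, false, false, false, true, true, true, false, false, false, true]⟩,
  ⟨0, 2, 4, (1, 0, 0), (-1, -2, 1), (0, 2, 0), 2,
    [true, false, false, false, true, true, true, false, false, false, true, true]⟩,
  ⟨0, 3, 4, (0, -2, 1), (2, 4, -2), (-2, -2, 2), 4,
    [false, true, false, false, false, false, false, true, true, true, false, false]⟩,
  ⟨0, 3, 5, (2, 0, -1), (0, 2, 0), (-2, -2, 2), 4,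
    [true, true, false, false, false, false, false, false, false, false, false, false]⟩,
  ⟨0, 4, 5, (2, 2, -1), (0, 2, 0), (-2, -4, 2), 4,
    [true, false, false, false, false, false, true, false, false, false, true, true]⟩,
  ⟨1, 2, 3, (-1, 1, 0), (-1, -1, 1), (2, 0, 0), 2,
    [false, false, true, true, true, false, false, false, true, true, true, false]⟩,
  ⟨1, 2, 5, (0, 1, 0), (-2, -1, 1), (2, 0, 0), 2,
    [false, false, false, true, true, true, false, false, false, true, true, true]⟩,
  ⟨1, 3, 4, (0, 2, -1), (2, 0, 0), (-2, -2, 2), 4,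
    [false, false, true, true, false, false, false, false, false, false, false, false]⟩,
  ⟨1, 3, 5, (-2, 0, 1), (4, 2, -2), (-2, -2, 2), 4,
    [false, false, true, false, false, false, true, true, true, false, false, false]⟩,
  ⟨1, 4, 5, (2, 2, -1), (-4, -2, 2), (2, 0, 0), 4,
    [false, false, false, true, false, false, false, false, false, true, true, true]⟩,
  ⟨2, 3, 4, (0, -2, 1), (2, 0, 0), (-2, 2, 0), 4,
    [false, false, false, false, true, false, false, false, true, true, true, false]⟩,
  ⟨2, 3, 5, (-2, 0, 1), (0, 2, 0), (2, -2, 0), 4,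
    [false, false, false, false, false, true, true, true, false, false, false, true]⟩,
  ⟨2, 4, 5, (-2, -2, 1), (0, 2, 0), (2, 0, 0), 4,
    [false, false, false, false, true, true, false, false, false, false, false, false]⟩,
  ⟨3, 4, 5, (2, 2, -1), (-2, 0, 1), (0, -2, 1), 4,
    [false, false, false, false, false, false, true, true, true, true, true, true]⟩]

/-- This imitates `knotTriple` on the table, where the collinear triples have been left out. -/
def locate (l : List ℕ) : Option TripleData :=
  tripleTable.find? fun t =>
    !(l.getD t.i 0).beq 0 && !(l.getD t.j 0).beq 0 && !(l.getD t.k 0).beq 0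

def decr : List ℕ → ℕ → List ℕ
  | [], _ => []
  | a :: l, 0 => a.pred :: l
  | a :: l, i + 1 => a :: decr l i

/-- Multiplication of a polynomial in `x` and `y` by a linear form, with `o = 1`. -/
def mulForm (f : ℤ × ℤ × ℤ) (p : List (List ℤ)) : List (List ℤ) :=
  match p with
  | [] => []
  | p => Ops.add (Ops.smul f.2.2 p)
      (Ops.add (Ops.smul f.2.1 (p.map ((0 : ℤ) :: ·))) (Ops.smul f.1 ([] :: p)))

/-- The polynomial pieces, on the twelve faces, of a simplex spline. -/
def pieces : ℕ → List ℕ → List (List (List ℤ))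
  | 0, l =>
    match locate l with
    | none => []
    | some t => t.inside.map fun b => bif b then [[t.ratio]] else []
  | d + 1, l =>
    match locate l with
    | none => []
    | some t => Ops.add ((pieces d (decr l t.i)).map (mulForm t.fi))
        (Ops.add ((pieces d (decr l t.j)).map (mulForm t.fj))
          ((pieces d (decr l t.k)).map (mulForm t.fk)))

/-- A member of a basis: the multiplicities of the six knots, four times the weight, the
multiplicities of the dual points, and the coefficients of the simplex spline with respect to the
generators of the spline space. -/
structure Member where
  knots : List ℕ
  weight : ℤ
  dual : List ℕ
  coeffs : List ℤ

/-! ### Tables of the basis members, by orbit -/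

def orbitA : List Member := [
  ⟨[6,0,0,1,0,1], 1, [5,0,0,0,0,0,0,0,0,0],
    [0,0,0,0,0,0,0,0,0,0,0,0,0,0,0,0,0,0,0,0,0,0,0,0,0,0,0,0,0,0,-4,8,0,0,0,0,0,0,0]⟩,
  ⟨[0,6,0,1,1,0], 1, [0,5,0,0,0,0,0,0,0,0],
    [0,0,0,0,0,0,0,0,0,0,0,0,0,0,0,0,0,0,0,0,0,0,0,0,0,0,0,0,0,0,0,0,0,-4,0,8,0,0,0]⟩,
  ⟨[0,0,6,0,1,1], 1, [0,0,5,0,0,0,0,0,0,0],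
    [0,0,0,0,0,0,0,0,0,0,0,0,0,0,0,0,0,0,0,0,0,0,0,0,0,0,0,0,0,0,0,0,0,0,0,0,4,-8,-8]⟩]

def orbitB : List Member := [
  ⟨[5,0,0,2,0,1], 1, [4,0,0,1,0,0,0,0,0,0],
    [0,0,0,0,0,0,0,0,0,0,0,0,0,0,0,0,0,0,0,0,0,0,0,0,0,0,0,0,0,0,0,0,40,0,0,0,0,0,0]⟩,
  ⟨[5,0,0,1,0,2], 1, [4,0,0,0,0,1,0,0,0,0],
    [0,0,0,0,0,0,0,0,0,0,0,0,0,0,0,0,0,0,0,0,0,0,0,0,0,0,0,0,0,0,40,-40,-40,0,0,0,0,0,0]⟩,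
  ⟨[0,5,0,2,1,0], 1, [0,4,0,1,0,0,0,0,0,0],
    [0,0,0,0,0,0,0,0,0,0,0,0,0,0,0,0,0,0,0,0,0,0,0,0,0,0,0,0,0,0,0,0,0,0,40,0,0,0,0]⟩,
  ⟨[0,5,0,1,2,0], 1, [0,4,0,0,1,0,0,0,0,0],
    [0,0,0,0,0,0,0,0,0,0,0,0,0,0,0,0,0,0,0,0,0,0,0,0,0,0,0,0,0,0,0,0,0,40,-40,-40,0,0,0]⟩,
  ⟨[0,0,5,0,1,2], 1, [0,0,4,0,0,1,0,0,0,0],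
    [0,0,0,0,0,0,0,0,0,0,0,0,0,0,0,0,0,0,0,0,0,0,0,0,0,0,0,0,0,0,0,0,0,0,0,0,0,40,0]⟩,
  ⟨[0,0,5,0,2,1], 1, [0,0,4,0,1,0,0,0,0,0],
    [0,0,0,0,0,0,0,0,0,0,0,0,0,0,0,0,0,0,0,0,0,0,0,0,0,0,0,0,0,0,0,0,0,0,0,0,0,0,40]⟩]

def orbitE : List Member := [
  ⟨[4,1,0,2,0,1], 2, [3,0,0,2,0,0,0,0,0,0],
    [0,0,0,0,0,0,0,0,0,0,0,0,0,0,0,0,0,0,0,0,0,0,0,0,0,0,0,-8,16,8,8,-16,-40,0,0,0,0,0,0]⟩,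
  ⟨[4,0,1,1,0,2], 2, [3,0,0,0,0,2,0,0,0,0],
    [0,0,0,0,0,0,0,0,0,0,0,0,0,0,0,0,0,0,0,0,0,0,8,-8,0,0,0,0,0,0,-32,24,40,0,0,0,0,0,0]⟩,
  ⟨[1,4,0,2,1,0], 2, [0,3,0,2,0,0,0,0,0,0],
    [0,0,0,0,0,0,0,0,0,0,0,0,0,0,0,0,0,0,0,0,0,0,0,0,-8,8,16,0,0,0,0,0,0,8,-40,-16,0,0,0]⟩,
  ⟨[0,4,1,1,2,0], 2, [0,3,0,0,2,0,0,0,0,0],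
    [0,0,0,0,0,8,0,0,0,0,-40,0,0,0,80,0,0,-80,0,40,-8,0,8,-8,0,0,0,0,0,0,0,0,0,-32,40,24,0,0,0]⟩,
  ⟨[1,0,4,0,1,2], 2, [0,0,3,0,0,2,0,0,0,0],
    [8,-80,320,-640,640,-256,-40,320,-960,1280,-640,80,-480,960,-640,-80,320,-320,40,-80,-8,0,0,0,-8,8,16,0,0,0,0,0,0,0,0,0,-8,-24,16]⟩,
  ⟨[0,1,4,0,2,1], 2, [0,0,3,0,2,0,0,0,0,0],
    [8,-40,80,-80,40,-8,-80,320,-480,320,-80,320,-960,960,-320,-640,1280,-640,640,-640,-256,0,0,0,0,0,0,-8,16,8,0,0,0,0,0,0,-8,16,-24]⟩]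

def orbitF : List Member := [
  ⟨[3,2,0,2,0,1], 2, [2,1,0,2,0,0,0,0,0,0],
    [0,0,0,0,0,0,0,0,0,0,0,0,0,0,0,0,0,0,0,0,0,0,0,0,0,0,0,16,-32,24,-16,32,40,0,0,0,0,0,0]⟩,
  ⟨[3,0,2,1,0,2], 2, [2,0,1,0,0,2,0,0,0,0],
    [0,0,0,0,0,0,0,0,0,0,0,0,0,0,0,0,0,0,0,0,0,40,-56,-24,0,0,0,0,0,0,24,-8,-40,0,0,0,0,0,0]⟩,
  ⟨[2,3,0,2,1,0], 2, [1,2,0,2,0,0,0,0,0,0],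
    [0,0,0,0,0,0,0,0,0,0,0,0,0,0,0,0,0,0,0,0,0,0,0,0,16,24,-32,0,0,0,0,0,0,-16,40,32,0,0,0]⟩,
  ⟨[0,3,2,1,2,0], 2, [0,2,1,0,2,0,0,0,0,0],
    [0,0,0,0,40,-56,0,0,0,-160,200,0,0,240,-240,0,-160,80,40,40,-24,-40,24,56,0,0,0,0,0,0,0,0,0,24,-40,-8,0,0,0]⟩,
  ⟨[2,0,3,0,1,2], 2, [1,0,2,0,0,2,0,0,0,0],
    [-16,160,-640,1280,-1280,512,120,-960,2880,-3840,1920,-320,1920,-3840,2560,400,-1600,1600,-240,480,56,0,0,0,16,-56,-32,0,0,0,0,0,0,0,0,0,16,8,-32]⟩,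
  ⟨[0,2,3,0,2,1], 2, [0,1,2,0,2,0,0,0,0,0],
    [-16,120,-320,400,-240,56,160,-960,1920,-1600,480,-640,2880,-3840,1600,1280,-3840,2560,-1280,1920,512,0,0,0,0,0,0,16,-32,-56,0,0,0,0,0,0,16,-32,8]⟩]

def orbitG : List Member := [
  ⟨[2,2,0,2,1,1], 3, [1,1,0,2,0,0,0,0,0,1],
    [-4,40,-160,320,-320,128,40,-320,960,-1280,640,-160,960,-1920,1280,320,-1280,1280,-320,640,128,0,0,0,-16,-64,32,-16,32,-64,20,-40,-40,20,-40,-40,4,-8,-8]⟩,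
  ⟨[2,0,2,1,1,2], 3, [1,0,1,0,0,2,0,0,0,1],
    [20,-200,800,-1600,1600,-640,-160,1280,-3840,5120,-2560,480,-2880,5760,-3840,-640,2560,-2560,400,-800,-96,-80,96,64,-16,96,32,0,0,0,-20,0,40,-4,0,8,-20,0,40]⟩,
  ⟨[0,2,2,1,2,1], 3, [0,1,1,0,2,0,0,0,0,1],
    [20,-160,480,-640,320,0,-200,1280,-2880,2880,-1120,800,-3840,5280,-2240,-1600,5440,-3840,1520,-2720,-576,80,-64,-96,0,0,0,-16,32,96,-4,8,0,-20,40,0,-20,40,0]⟩]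

def orbitG' : List Member := [
  ⟨[2,2,0,2,1,1], 1, [1,1,1,2,0,0,0,0,0,0],
    [-4,40,-160,320,-320,128,40,-320,960,-1280,640,-160,960,-1920,1280,320,-1280,1280,-320,640,128,0,0,0,-16,-64,32,-16,32,-64,20,-40,-40,20,-40,-40,4,-8,-8]⟩,
  ⟨[2,0,2,1,1,2], 1, [1,1,1,0,0,2,0,0,0,0],
    [20,-200,800,-1600,1600,-640,-160,1280,-3840,5120,-2560,480,-2880,5760,-3840,-640,2560,-2560,400,-800,-96,-80,96,64,-16,96,32,0,0,0,-20,0,40,-4,0,8,-20,0,40]⟩,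
  ⟨[0,2,2,1,2,1], 1, [1,1,1,0,2,0,0,0,0,0],
    [20,-160,480,-640,320,0,-200,1280,-2880,2880,-1120,800,-3840,5280,-2240,-1600,5440,-3840,1520,-2720,-576,80,-64,-96,0,0,0,-16,32,96,-4,8,0,-20,40,0,-20,40,0]⟩]

def orbitL : List Member := [
  ⟨[1,4,1,1,1,0], 4, [0,3,0,1,1,0,0,0,0,0],
    [0,0,0,0,0,0,0,0,0,0,20,0,0,0,-40,0,0,40,0,-20,4,0,-4,4,4,-4,-8,0,0,0,0,0,0,-4,0,8,0,0,0]⟩,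
  ⟨[1,1,4,0,1,1], 4, [0,0,3,0,1,1,0,0,0,0],
    [-4,40,-160,320,-320,128,40,-240,600,-720,340,-160,600,-840,440,320,-720,440,-320,340,128,0,0,0,4,-4,-8,4,-8,-4,0,0,0,0,0,0,4,-8,-8]⟩,
  ⟨[4,1,1,1,0,1], 4, [3,0,0,1,0,1,0,0,0,0],
    [0,0,0,0,0,0,0,0,0,0,0,0,0,0,0,0,0,0,0,0,4,0,-4,4,0,0,0,4,-8,-4,-4,8,0,0,0,0,0,0,0]⟩]

def orbitN : List Member := [
  ⟨[2,2,2,1,1,0], 3, [1,2,1,0,0,0,0,0,0,1],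
    [0,0,0,0,0,0,0,0,0,0,0,0,0,120,-160,0,-80,0,20,40,-16,-20,16,24,4,16,-8,0,0,0,0,0,0,-4,0,8,0,0,0]⟩,
  ⟨[2,2,2,0,1,1], 3, [1,1,2,0,0,0,0,0,0,1],
    [-4,40,-160,320,-320,128,40,-320,960,-1280,640,-160,960,-1800,1120,320,-1280,1120,-320,640,128,0,0,0,4,-24,-8,4,-8,-24,0,0,0,0,0,0,4,-8,-8]⟩,
  ⟨[2,2,2,1,0,1], 3, [2,1,1,0,0,0,0,0,0,1],
    [0,0,0,0,0,0,0,0,0,0,0,0,0,0,0,0,80,-80,-20,-80,24,20,-24,-16,0,0,0,4,-8,16,-4,8,0,0,0,0,0,0,0]⟩]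

def orbitO : List Member := [
  ⟨[2,2,1,1,1,1], 3, [1,1,1,1,0,0,0,0,0,1],
    [4,-40,160,-320,320,-128,-40,320,-960,1280,-640,160,-960,1920,-1280,-320,1280,-1200,320,-680,-120,0,-8,8,0,40,0,0,0,40,-4,8,0,-4,0,8,-4,8,8]⟩,
  ⟨[2,1,2,1,1,1], 3, [1,1,1,0,0,1,0,0,0,1],
    [-4,40,-160,320,-320,128,40,-320,960,-1280,640,-160,960,-1920,1280,320,-1120,1040,-360,520,168,40,-40,-40,0,-40,0,8,-16,-8,-4,8,0,4,0,-8,4,-8,-8]⟩,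
  ⟨[1,2,2,1,1,1], 3, [1,1,1,0,1,0,0,0,0,1],
    [-4,40,-160,320,-320,128,40,-320,960,-1280,640,-160,960,-1680,960,320,-1440,1200,-280,760,88,-40,40,40,8,-8,-16,0,0,-40,4,-8,0,-4,0,8,4,-8,-8]⟩]

def orbitQ : List Member := [
  ⟨[3,2,1,2,0,0], 4, [2,1,0,2,0,0,0,0,0,0],
    [0,0,0,0,0,0,0,0,0,0,0,0,0,0,0,0,0,0,0,20,-8,0,8,12,0,0,0,0,0,0,0,0,0,0,0,0,0,0,0]⟩,
  ⟨[3,1,2,0,0,2], 4, [2,0,1,0,0,2,0,0,0,0],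
    [0,0,0,0,0,0,0,0,0,0,0,0,0,0,0,0,0,0,20,-20,-28,0,0,0,0,0,0,12,-4,-12,0,0,0,0,0,0,0,0,0]⟩,
  ⟨[2,3,1,2,0,0], 4, [1,2,0,2,0,0,0,0,0,0],
    [0,0,0,0,0,0,0,0,0,0,0,0,0,0,0,0,0,40,0,-40,12,0,-12,-8,0,0,0,0,0,0,0,0,0,0,0,0,0,0,0]⟩,
  ⟨[1,3,2,0,2,0], 4, [0,2,1,0,2,0,0,0,0,0],
    [0,0,0,0,20,-28,0,0,0,0,-20,0,0,0,0,0,0,0,0,0,0,0,0,0,12,-12,-4,0,0,0,0,0,0,0,0,0,0,0,0]⟩,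
  ⟨[2,1,3,0,0,2], 4, [1,0,2,0,0,2,0,0,0,0],
    [0,0,0,0,0,0,0,0,0,0,0,0,0,0,0,40,-80,40,-120,120,92,0,0,0,0,0,0,-8,-4,8,0,0,0,0,0,0,0,0,0]⟩,
  ⟨[1,2,3,0,2,0], 4, [0,1,2,0,2,0,0,0,0,0],
    [0,0,0,40,-120,92,0,0,0,-80,120,0,0,0,40,0,0,0,0,0,0,0,0,0,-8,8,-4,0,0,0,0,0,0,0,0,0,0,0,0]⟩]

def orbitR : List Member := [
  ⟨[1,3,1,2,1,0], 2, [1,2,0,1,1,0,0,0,0,0],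
    [0,0,0,0,0,0,0,0,0,0,0,0,0,0,80,0,0,-160,0,120,-32,0,32,8,8,-8,-16,0,0,0,0,0,0,-8,40,16,0,0,0]⟩,
  ⟨[1,1,3,0,1,2], 2, [1,0,2,0,1,1,0,0,0,0],
    [-8,80,-320,640,-640,256,40,-320,960,-1280,640,0,240,-720,560,-320,480,-80,640,-600,-384,0,0,0,8,-8,-16,8,24,-8,0,0,0,0,0,0,8,24,-16]⟩,
  ⟨[3,1,1,2,0,1], 2, [2,1,0,1,0,1,0,0,0,0],
    [0,0,0,0,0,0,0,0,0,0,0,0,0,0,0,0,0,0,0,0,8,0,-8,-32,0,0,0,8,-16,-8,-8,16,40,0,0,0,0,0,0]⟩,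
  ⟨[1,1,3,0,2,1], 2, [0,1,2,0,1,1,0,0,0,0],
    [-8,40,0,-320,640,-384,80,-320,240,480,-600,-320,960,-720,-80,640,-1280,560,-640,640,256,0,0,0,8,-8,24,8,-16,-8,0,0,0,0,0,0,8,-16,24]⟩,
  ⟨[3,1,1,1,0,2], 2, [2,0,1,1,0,1,0,0,0,0],
    [0,0,0,0,0,0,0,0,0,0,0,0,0,0,0,0,0,0,0,0,8,0,-8,8,0,0,0,-32,24,32,32,-24,-40,0,0,0,0,0,0]⟩,
  ⟨[1,3,1,1,2,0], 2, [0,2,1,1,1,0,0,0,0,0],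
    [0,0,0,0,0,0,0,0,0,0,40,0,0,0,-80,0,0,80,0,-40,8,0,-8,8,-32,32,24,0,0,0,0,0,0,32,-40,-24,0,0,0]⟩]

def orbitS : List Member := [
  ⟨[2,2,1,2,1,0], 3, [1,2,0,1,0,0,0,0,0,1],
    [0,0,0,0,0,0,0,0,0,0,0,0,0,0,0,0,0,80,0,-80,24,0,-24,-16,-16,-24,32,0,0,0,0,0,0,16,-40,-32,0,0,0]⟩,
  ⟨[2,1,2,0,1,2], 3, [1,0,2,0,0,1,0,0,0,1],
    [16,-160,640,-1280,1280,-512,-120,960,-2880,3840,-1920,320,-1920,3840,-2560,-320,1440,-1520,0,-240,128,0,0,0,-16,56,32,-16,-8,16,0,0,0,0,0,0,-16,-8,32]⟩,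
  ⟨[2,2,1,2,0,1], 3, [2,1,0,1,0,0,0,0,0,1],
    [0,0,0,0,0,0,0,0,0,0,0,0,0,0,0,0,0,0,0,40,-16,0,16,24,0,0,0,-16,32,-24,16,-32,-40,0,0,0,0,0,0]⟩,
  ⟨[1,2,2,0,2,1], 3, [0,1,2,0,1,0,0,0,0,1],
    [16,-120,320,-320,0,128,-160,960,-1920,1440,-240,640,-2880,3840,-1520,-1280,3840,-2560,1280,-1920,-512,0,0,0,-16,16,-8,-16,32,56,0,0,0,0,0,0,-16,32,-8]⟩,
  ⟨[2,1,2,1,0,2], 3, [2,0,1,0,0,1,0,0,0,1],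
    [0,0,0,0,0,0,0,0,0,0,0,0,0,0,0,0,0,0,40,-40,-56,-40,56,24,0,0,0,24,-8,-24,-24,8,40,0,0,0,0,0,0]⟩,
  ⟨[1,2,2,1,2,0], 3, [0,2,1,0,1,0,0,0,0,1],
    [0,0,0,0,0,0,0,0,0,160,-240,0,0,-240,240,0,160,-80,-40,-40,24,40,-24,-56,24,-24,-8,0,0,0,0,0,0,-24,40,8,0,0,0]⟩]

def orbitS' : List Member := [
  ⟨[2,2,1,2,1,0], 1, [1,2,1,1,0,0,0,0,0,0],
    [0,0,0,0,0,0,0,0,0,0,0,0,0,0,0,0,0,80,0,-80,24,0,-24,-16,-16,-24,32,0,0,0,0,0,0,16,-40,-32,0,0,0]⟩,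
  ⟨[2,1,2,0,1,2], 1, [1,1,2,0,0,1,0,0,0,0],
    [16,-160,640,-1280,1280,-512,-120,960,-2880,3840,-1920,320,-1920,3840,-2560,-320,1440,-1520,0,-240,128,0,0,0,-16,56,32,-16,-8,16,0,0,0,0,0,0,-16,-8,32]⟩,
  ⟨[2,2,1,2,0,1], 1, [2,1,1,1,0,0,0,0,0,0],
    [0,0,0,0,0,0,0,0,0,0,0,0,0,0,0,0,0,0,0,40,-16,0,16,24,0,0,0,-16,32,-24,16,-32,-40,0,0,0,0,0,0]⟩,
  ⟨[1,2,2,0,2,1], 1, [1,1,2,0,1,0,0,0,0,0],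
    [16,-120,320,-320,0,128,-160,960,-1920,1440,-240,640,-2880,3840,-1520,-1280,3840,-2560,1280,-1920,-512,0,0,0,-16,16,-8,-16,32,56,0,0,0,0,0,0,-16,32,-8]⟩,
  ⟨[2,1,2,1,0,2], 1, [2,1,1,0,0,1,0,0,0,0],
    [0,0,0,0,0,0,0,0,0,0,0,0,0,0,0,0,0,0,40,-40,-56,-40,56,24,0,0,0,24,-8,-24,-24,8,40,0,0,0,0,0,0]⟩,
  ⟨[1,2,2,1,2,0], 1, [1,2,1,0,1,0,0,0,0,0],
    [0,0,0,0,0,0,0,0,0,160,-240,0,0,-240,240,0,160,-80,-40,-40,24,40,-24,-56,24,-24,-8,0,0,0,0,0,0,-24,40,8,0,0,0]⟩]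

def orbitT : List Member := [
  ⟨[1,2,1,2,1,1], 3, [1,1,0,1,1,0,0,0,0,1],
    [4,-40,160,-320,320,-128,-40,320,-960,1280,-640,160,-960,1920,-1280,-320,1280,-1120,320,-800,-80,0,-48,-32,-16,16,32,16,-32,64,-20,40,40,12,-40,-24,-4,8,8]⟩,
  ⟨[1,1,2,1,1,2], 3, [1,0,1,0,1,1,0,0,0,1],
    [12,-120,480,-960,960,-384,-80,640,-1920,2560,-1280,160,-960,1920,-1280,0,320,-480,-400,320,352,80,-96,-64,-16,16,32,-32,-16,32,20,0,-40,4,0,-8,-12,-16,24]⟩,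
  ⟨[2,1,1,2,1,1], 3, [1,1,0,1,0,1,0,0,0,1],
    [4,-40,160,-320,320,-128,-40,320,-960,1280,-640,160,-960,1920,-1280,-320,1280,-1280,320,-560,-160,0,32,48,16,64,-32,-16,32,16,12,-24,-40,-20,40,40,-4,8,8]⟩,
  ⟨[1,1,2,1,2,1], 3, [0,1,1,0,1,1,0,0,0,1],
    [12,-80,160,0,-320,256,-120,640,-960,0,640,480,-1920,2400,-800,-960,2240,-1280,1040,-1120,-448,-80,64,96,-32,32,-16,-16,32,16,4,-8,0,20,-40,0,-12,24,-16]⟩,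
  ⟨[2,1,1,1,1,2], 3, [1,0,1,1,0,1,0,0,0,1],
    [-20,200,-800,1600,-1600,640,160,-1280,3840,-5120,2560,-480,2880,-5760,3840,640,-2560,2560,-320,720,-16,0,16,-16,16,-96,-32,48,-16,-48,-28,16,40,4,0,-8,20,0,-40]⟩,
  ⟨[1,2,1,1,2,1], 3, [0,1,1,1,1,0,0,0,0,1],
    [-20,160,-480,640,-320,0,200,-1280,2880,-2560,640,-800,3840,-5760,2720,1600,-5120,3680,-1600,2640,624,0,16,-16,48,-48,-16,16,-32,-96,4,-8,0,-28,40,16,20,-40,0]⟩]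

def orbitT' : List Member := [
  ⟨[1,2,1,2,1,1], 2, [1,1,1,1,0,0,0,1,0,0],
    [4,-40,160,-320,320,-128,-40,320,-960,1280,-640,160,-960,1920,-1280,-320,1280,-1120,320,-800,-80,0,-48,-32,-16,16,32,16,-32,64,-20,40,40,12,-40,-24,-4,8,8]⟩,
  ⟨[1,1,2,1,1,2], 2, [1,1,1,0,0,1,0,0,1,0],
    [12,-120,480,-960,960,-384,-80,640,-1920,2560,-1280,160,-960,1920,-1280,0,320,-480,-400,320,352,80,-96,-64,-16,16,32,-32,-16,32,20,0,-40,4,0,-8,-12,-16,24]⟩,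
  ⟨[2,1,1,2,1,1], 2, [1,1,1,1,0,0,1,0,0,0],
    [4,-40,160,-320,320,-128,-40,320,-960,1280,-640,160,-960,1920,-1280,-320,1280,-1280,320,-560,-160,0,32,48,16,64,-32,-16,32,16,12,-24,-40,-20,40,40,-4,8,8]⟩,
  ⟨[1,1,2,1,2,1], 2, [1,1,1,0,1,0,0,0,1,0],
    [12,-80,160,0,-320,256,-120,640,-960,0,640,480,-1920,2400,-800,-960,2240,-1280,1040,-1120,-448,-80,64,96,-32,32,-16,-16,32,16,4,-8,0,20,-40,0,-12,24,-16]⟩,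
  ⟨[2,1,1,1,1,2], 2, [1,1,1,0,0,1,1,0,0,0],
    [-20,200,-800,1600,-1600,640,160,-1280,3840,-5120,2560,-480,2880,-5760,3840,640,-2560,2560,-320,720,-16,0,16,-16,16,-96,-32,48,-16,-48,-28,16,40,4,0,-8,20,0,-40]⟩,
  ⟨[1,2,1,1,2,1], 2, [1,1,1,0,1,0,0,1,0,0],
    [-20,160,-480,640,-320,0,200,-1280,2880,-2560,640,-800,3840,-5760,2720,1600,-5120,3680,-1600,2640,624,0,16,-16,48,-48,-16,16,-32,-96,4,-8,0,-28,40,16,20,-40,0]⟩]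

def members : BasisName → List Member
  | .Ba => orbitA ++ orbitB ++ orbitE ++ orbitF ++ orbitL ++ orbitN ++ orbitR ++ orbitS
  | .Bb => orbitA ++ orbitB ++ orbitE ++ orbitF ++ orbitL ++ orbitO ++ orbitR ++ orbitS
  | .Bc => orbitA ++ orbitB ++ orbitE ++ orbitF ++ orbitG ++ orbitL ++ orbitR ++ orbitT
  | .Bd => orbitA ++ orbitB ++ orbitE ++ orbitL ++ orbitN ++ orbitQ ++ orbitR ++ orbitS'
  | .Be => orbitA ++ orbitB ++ orbitE ++ orbitL ++ orbitO ++ orbitQ ++ orbitR ++ orbitS'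
  | .Bf => orbitA ++ orbitB ++ orbitE ++ orbitG' ++ orbitL ++ orbitQ ++ orbitR ++ orbitT'

def allMembers : List Member :=
  orbitA ++ orbitB ++ orbitE ++ orbitF ++ orbitG ++ orbitG' ++ orbitL ++ orbitN ++ orbitO ++
    orbitQ ++ orbitR ++ orbitS ++ orbitS' ++ orbitT ++ orbitT'

/-- Whether a line has the face on its nonnegative side. -/
def lineSide (l : ℤ × ℤ × ℤ) (F : List ℕ) : Bool :=
  F.all fun j => decide (0 ≤ formAt l j)

/-- The fourth powers of the positive parts of the lines on a face. -/
def facePowers {α : Type*} [Ops α] (F : List ℕ) (x y o : α) : List α :=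
  lines.map fun l => bif lineSide l F then powOps (linForm l x y o) 4 else Ops.ofInt 0

/-- The generators as polynomials in `x` and `y` on each face. -/
def facePolys : List (List (List (List ℤ))) :=
  faceLists.map fun F => generators (facePowers F [[], [1]] [[0, 1]] [[1]]) [[], [1]] [[0, 1]] [[1]]

def isZero2 (p : List (List ℤ)) : Bool := p.all fun r => r.all fun c => decide (c = 0)

/-- A missing piece counts as zero: `headD` and `tail` let the list of pieces run out before the
list of faces does. -/
def piecesMatch : List (List (List ℤ)) → List (List (List (List ℤ))) → List ℤ → Bool
  | ps, g :: gs, c =>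
    isZero2 (Ops.add (linComb c g) (Ops.smul (-1) (ps.headD []))) && piecesMatch ps.tail gs c
  | _, [], _ => true

/-- Six multiplicities with sum eight. -/
def knotsOK (l : List ℕ) : Bool := l.length.beq 6 && l.sum.beq 8

/-- The linear form in two variables with the given values at the vertices of a face. -/
def faceForm (f : ℤ × ℤ → ℤ) (F : List ℕ) : List (List ℤ) :=
  -- The third barycentric coordinate is replaced by one, so its coefficient is the constant term;
  -- the first coordinate belongs to the outer list.
  let p := fun n => f (vertexCoords.getD (F.getD n 0) (0, 0))
  [[p 2, p 1], [p 0]]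

/-- The generators with multiples of the barycentric coordinates with respect to a face substituted
for the variables, the last one of which is replaced by one. -/
def faceGenerators (F : List ℕ) : List (List (List ℤ)) :=
  let x := faceForm Prod.fst F
  let y := faceForm Prod.snd F
  let o := faceForm (fun _ => 12) F
  generators (facePowers F x y o) x y o

def isNonneg2 (p : List (List ℤ)) : Bool := p.all fun r => r.all fun c => decide (0 ≤ c)

/-- Sixty times the first two barycentric coordinates of the domain point. -/
def Member.point (r : Member) : ℤ × ℤ :=
  (r.dual.zip vertexCoords).foldr (fun d s => (d.1 * d.2.1 + s.1, d.1 * d.2.2 + s.2)) (0, 0)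

def Member.entry (r : Member) : Entry :=
  (fun j => r.knots.getD j 0, (r.weight : ℚ) / 4, fun j => r.dual.getD j 0)

/-- The coefficients of a weighted sum of simplex splines. -/
def weightedSum (g : Member → ℤ) (rs : List Member) : List ℤ :=
  rs.foldr (fun r s => Ops.add (Ops.smul (g r) r.coeffs) s) []

def unitCoeffs (n : ℕ) (c : ℤ) : List ℤ := (List.range 39).map fun i => if i = n then c else 0

/-- The fourth powers of the positive parts of the lines at an integral point. -/
def intPowers (x y o : ℤ) : List ℤ := lines.map fun l => max (linForm l x y o) 0 ^ 4

/-- A multiple of a collocation matrix, modulo seventeen, by columns. -/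
def collocationColumns (rs : List Member) : List (List ℕ) :=
  let gs := rs.map fun r => generators (intPowers r.point.1 r.point.2 60) r.point.1 r.point.2 60
  rs.map fun r => gs.map fun g => (r.weight * linComb r.coeffs g % 17).toNat

def dotNat : List ℕ → List ℕ → ℕ
  | a :: l, b :: m => (a.mul b).add (dotNat l m)
  | _, _ => 0

/-- The inverses of these multiples of the collocation matrices, modulo seventeen. -/
def inverseRows : BasisName → List (List ℕ)
  | .Ba => [
    [8,0,0,0,0,0,0,0,0,0,0,0,0,0,0,0,0,0,0,0,0,0,0,0,0,0,0,0,0,0,0,0,0,0,0,0,0,0,0],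
    [0,8,0,0,0,0,0,0,0,0,0,0,0,0,0,0,0,0,0,0,0,0,0,0,0,0,0,0,0,0,0,0,0,0,0,0,0,0,0],
    [0,0,8,0,0,0,0,0,0,0,0,0,0,0,0,0,0,0,0,0,0,0,0,0,0,0,0,0,0,0,0,0,0,0,0,0,0,0,0],
    [7,11,0,12,0,10,0,0,0,5,0,3,0,0,0,16,0,12,0,0,0,0,0,0,0,0,0,0,0,0,0,0,0,0,0,0,0,0,0],
    [7,0,11,0,12,0,0,10,0,0,5,0,0,3,0,0,16,0,0,12,0,0,0,0,0,0,0,0,0,0,0,0,0,0,0,0,0,0,0],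
    [11,7,0,10,0,12,0,0,0,3,0,5,0,0,0,12,0,16,0,0,0,0,0,0,0,0,0,0,0,0,0,0,0,0,0,0,0,0,0],
    [0,7,11,0,0,0,12,0,10,0,0,0,5,0,3,0,0,0,16,0,12,0,0,0,0,0,0,0,0,0,0,0,0,0,0,0,0,0,0],
    [11,0,7,0,10,0,0,12,0,0,3,0,0,5,0,0,12,0,0,16,0,0,0,0,0,0,0,0,0,0,0,0,0,0,0,0,0,0,0],
    [0,11,7,0,0,0,10,0,12,0,0,0,3,0,5,0,0,0,12,0,16,0,0,0,0,0,0,0,0,0,0,0,0,0,0,0,0,0,0],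
    [6,4,0,3,0,3,0,0,0,4,0,8,0,0,0,3,0,11,0,0,0,0,0,0,0,0,0,0,0,0,0,0,0,0,0,0,0,0,0],
    [6,0,4,0,3,0,0,3,0,0,4,0,0,8,0,0,3,0,0,11,0,0,0,0,0,0,0,0,0,0,0,0,0,0,0,0,0,0,0],
    [4,6,0,3,0,3,0,0,0,8,0,4,0,0,0,11,0,3,0,0,0,0,0,0,0,0,0,0,0,0,0,0,0,0,0,0,0,0,0],
    [0,6,4,0,0,0,3,0,3,0,0,0,4,0,8,0,0,0,3,0,11,0,0,0,0,0,0,0,0,0,0,0,0,0,0,0,0,0,0],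
    [4,0,6,0,3,0,0,3,0,0,8,0,0,4,0,0,11,0,0,3,0,0,0,0,0,0,0,0,0,0,0,0,0,0,0,0,0,0,0],
    [0,4,6,0,0,0,3,0,3,0,0,0,8,0,4,0,0,0,11,0,3,0,0,0,0,0,0,0,0,0,0,0,0,0,0,0,0,0,0],
    [11,0,0,2,0,1,0,0,0,0,0,11,0,0,0,8,0,9,0,0,0,0,0,0,0,0,0,0,0,0,0,0,0,0,0,0,0,0,0],
    [11,0,0,0,2,0,0,1,0,0,0,0,0,11,0,0,8,0,0,9,0,0,0,0,0,0,0,0,0,0,0,0,0,0,0,0,0,0,0],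
    [0,11,0,1,0,2,0,0,0,11,0,0,0,0,0,9,0,8,0,0,0,0,0,0,0,0,0,0,0,0,0,0,0,0,0,0,0,0,0],
    [0,11,0,0,0,0,2,0,1,0,0,0,0,0,11,0,0,0,8,0,9,0,0,0,0,0,0,0,0,0,0,0,0,0,0,0,0,0,0],
    [0,0,11,0,1,0,0,2,0,0,11,0,0,0,0,0,9,0,0,8,0,0,0,0,0,0,0,0,0,0,0,0,0,0,0,0,0,0,0],
    [0,0,11,0,0,0,1,0,2,0,0,0,11,0,0,0,0,0,9,0,8,0,0,0,0,0,0,0,0,0,0,0,0,0,0,0,0,0,0],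
    [2,16,2,8,7,8,8,7,8,9,15,14,14,15,9,3,9,16,16,9,3,11,0,0,15,8,8,16,4,15,15,4,16,8,0,11,11,0,8],
    [2,2,16,7,8,7,8,8,8,15,9,15,9,14,14,9,3,9,3,16,16,0,11,0,8,15,8,4,16,4,16,15,15,0,8,0,8,11,11],
    [16,2,2,8,8,8,7,8,7,14,14,9,15,9,15,16,16,3,9,3,9,0,0,11,8,8,15,15,15,16,4,16,4,11,11,8,0,8,0],
    [16,7,16,14,14,3,3,14,14,13,15,3,3,15,13,13,8,5,5,8,13,13,5,5,8,12,12,5,4,6,6,4,5,3,6,15,15,6,3],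
    [16,16,7,14,14,14,14,3,3,15,13,15,13,3,3,8,13,8,13,5,5,5,13,5,12,8,12,4,5,4,5,6,6,6,3,6,3,15,15],
    [7,16,16,3,3,14,14,14,14,3,3,13,15,13,15,5,5,13,8,13,8,5,5,13,12,12,8,6,6,5,4,5,4,15,15,3,6,3,6],
    [0,7,7,16,14,4,12,14,0,7,10,7,9,2,15,14,4,16,7,8,10,10,10,14,7,13,9,15,11,4,16,2,10,15,8,14,11,11,2],
    [0,7,7,14,16,14,0,4,12,10,7,2,15,7,9,4,14,8,10,16,7,10,10,14,13,7,9,11,15,2,10,4,16,8,15,11,2,14,11],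
    [7,0,7,4,12,16,14,0,14,7,9,7,10,15,2,16,7,14,4,10,8,14,10,10,9,13,7,4,16,15,11,10,2,14,11,15,8,2,11],
    [7,0,7,14,0,14,16,12,4,2,15,10,7,9,7,8,10,4,14,7,16,14,10,10,9,7,13,2,10,11,15,16,4,11,2,8,15,11,14],
    [7,7,0,12,4,0,14,16,14,9,7,15,2,7,10,7,16,10,8,14,4,10,14,10,13,9,7,16,4,10,2,15,11,11,14,2,11,15,8],
    [7,7,0,0,14,12,4,14,16,15,2,9,7,10,7,10,8,7,16,4,14,10,14,10,7,9,13,10,2,16,4,11,15,2,11,11,14,8,15],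
    [4,11,2,14,13,2,14,7,4,7,4,11,4,8,3,4,9,16,1,9,5,0,10,13,15,5,0,14,4,2,3,0,2,3,8,13,11,12,13],
    [4,2,11,13,14,7,4,2,14,4,7,8,3,11,4,9,4,9,5,16,1,10,0,13,5,15,0,4,14,0,2,2,3,8,3,12,13,13,11],
    [11,4,2,2,14,14,13,4,7,11,4,7,4,3,8,16,1,4,9,5,9,13,10,0,0,5,15,2,3,14,4,2,0,13,11,3,8,13,12],
    [2,4,11,7,4,13,14,14,2,8,3,4,7,4,11,9,5,9,4,1,16,13,0,10,0,15,5,0,2,4,14,3,2,12,13,8,3,11,13],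
    [11,2,4,14,2,4,7,14,13,4,11,3,8,7,4,1,16,5,9,4,9,10,13,0,5,0,15,3,2,2,0,14,4,11,13,13,12,3,8],
    [2,11,4,4,7,14,2,13,14,3,8,4,11,4,7,5,9,1,16,9,4,0,13,10,15,0,5,2,0,3,2,4,14,13,12,11,13,8,3]]
  | .Bb => [
    [8,0,0,0,0,0,0,0,0,0,0,0,0,0,0,0,0,0,0,0,0,0,0,0,0,0,0,0,0,0,0,0,0,0,0,0,0,0,0],
    [0,8,0,0,0,0,0,0,0,0,0,0,0,0,0,0,0,0,0,0,0,0,0,0,0,0,0,0,0,0,0,0,0,0,0,0,0,0,0],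
    [0,0,8,0,0,0,0,0,0,0,0,0,0,0,0,0,0,0,0,0,0,0,0,0,0,0,0,0,0,0,0,0,0,0,0,0,0,0,0],
    [7,11,0,12,0,10,0,0,0,5,0,3,0,0,0,16,0,12,0,0,0,0,0,0,0,0,0,0,0,0,0,0,0,0,0,0,0,0,0],
    [7,0,11,0,12,0,0,10,0,0,5,0,0,3,0,0,16,0,0,12,0,0,0,0,0,0,0,0,0,0,0,0,0,0,0,0,0,0,0],
    [11,7,0,10,0,12,0,0,0,3,0,5,0,0,0,12,0,16,0,0,0,0,0,0,0,0,0,0,0,0,0,0,0,0,0,0,0,0,0],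
    [0,7,11,0,0,0,12,0,10,0,0,0,5,0,3,0,0,0,16,0,12,0,0,0,0,0,0,0,0,0,0,0,0,0,0,0,0,0,0],
    [11,0,7,0,10,0,0,12,0,0,3,0,0,5,0,0,12,0,0,16,0,0,0,0,0,0,0,0,0,0,0,0,0,0,0,0,0,0,0],
    [0,11,7,0,0,0,10,0,12,0,0,0,3,0,5,0,0,0,12,0,16,0,0,0,0,0,0,0,0,0,0,0,0,0,0,0,0,0,0],
    [6,4,0,3,0,3,0,0,0,4,0,8,0,0,0,3,0,11,0,0,0,0,0,0,0,0,0,0,0,0,0,0,0,0,0,0,0,0,0],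
    [6,0,4,0,3,0,0,3,0,0,4,0,0,8,0,0,3,0,0,11,0,0,0,0,0,0,0,0,0,0,0,0,0,0,0,0,0,0,0],
    [4,6,0,3,0,3,0,0,0,8,0,4,0,0,0,11,0,3,0,0,0,0,0,0,0,0,0,0,0,0,0,0,0,0,0,0,0,0,0],
    [0,6,4,0,0,0,3,0,3,0,0,0,4,0,8,0,0,0,3,0,11,0,0,0,0,0,0,0,0,0,0,0,0,0,0,0,0,0,0],
    [4,0,6,0,3,0,0,3,0,0,8,0,0,4,0,0,11,0,0,3,0,0,0,0,0,0,0,0,0,0,0,0,0,0,0,0,0,0,0],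
    [0,4,6,0,0,0,3,0,3,0,0,0,8,0,4,0,0,0,11,0,3,0,0,0,0,0,0,0,0,0,0,0,0,0,0,0,0,0,0],
    [11,0,0,2,0,1,0,0,0,0,0,11,0,0,0,8,0,9,0,0,0,0,0,0,0,0,0,0,0,0,0,0,0,0,0,0,0,0,0],
    [11,0,0,0,2,0,0,1,0,0,0,0,0,11,0,0,8,0,0,9,0,0,0,0,0,0,0,0,0,0,0,0,0,0,0,0,0,0,0],
    [0,11,0,1,0,2,0,0,0,11,0,0,0,0,0,9,0,8,0,0,0,0,0,0,0,0,0,0,0,0,0,0,0,0,0,0,0,0,0],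
    [0,11,0,0,0,0,2,0,1,0,0,0,0,0,11,0,0,0,8,0,9,0,0,0,0,0,0,0,0,0,0,0,0,0,0,0,0,0,0],
    [0,0,11,0,1,0,0,2,0,0,11,0,0,0,0,0,9,0,0,8,0,0,0,0,0,0,0,0,0,0,0,0,0,0,0,0,0,0,0],
    [0,0,11,0,0,0,1,0,2,0,0,0,11,0,0,0,0,0,9,0,8,0,0,0,0,0,0,0,0,0,0,0,0,0,0,0,0,0,0],
    [5,14,5,3,3,0,0,3,3,12,15,11,11,15,12,6,4,9,9,4,6,14,8,8,1,5,1,9,9,5,5,9,9,5,4,6,6,4,5],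
    [5,5,14,3,3,3,3,0,0,15,12,15,12,11,11,4,6,4,6,9,9,8,14,8,5,1,1,9,9,9,9,5,5,4,5,4,5,6,6],
    [14,5,5,0,0,3,3,3,3,11,11,12,15,12,15,9,9,6,4,6,4,8,8,14,1,1,5,5,5,9,9,9,9,6,6,5,4,5,4],
    [13,13,10,11,1,11,1,2,2,8,5,8,5,1,1,4,5,4,5,11,11,11,8,11,15,9,9,5,12,5,12,7,7,1,9,1,9,0,0],
    [13,10,13,1,11,2,2,11,1,5,8,1,1,8,5,5,4,11,11,4,5,8,11,11,9,15,9,12,5,7,7,5,12,9,1,0,0,1,9],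
    [10,13,13,2,2,1,11,1,11,1,1,5,8,5,8,11,11,5,4,5,4,11,11,8,9,9,15,7,7,12,5,12,5,0,0,9,1,9,1],
    [0,6,9,3,5,4,9,13,9,11,2,3,14,10,10,11,3,11,9,11,1,6,9,11,12,11,0,3,13,5,15,12,4,2,6,4,14,3,13],
    [0,9,6,5,3,13,9,4,9,2,11,10,10,3,14,3,11,11,1,11,9,9,6,11,11,12,0,13,3,12,4,5,15,6,2,3,13,4,14],
    [6,0,9,4,9,3,5,9,13,3,14,11,2,10,10,11,9,11,3,1,11,11,9,6,12,0,11,5,15,3,13,4,12,4,14,2,6,13,3],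
    [9,0,6,13,9,5,3,9,4,10,10,2,11,14,3,11,1,3,11,9,11,11,6,9,11,0,12,12,4,13,3,15,5,3,13,6,2,14,4],
    [6,9,0,9,4,9,13,3,5,14,3,10,10,11,2,9,11,1,11,11,3,9,11,6,0,12,11,15,5,4,12,3,13,14,4,13,3,2,6],
    [9,6,0,9,13,9,4,5,3,10,10,14,3,2,11,1,11,9,11,3,11,6,11,9,0,11,12,4,12,15,5,13,3,13,3,14,4,6,2],
    [5,11,14,15,13,16,3,0,7,11,11,7,7,1,0,16,12,9,7,0,1,12,0,9,4,0,6,1,13,2,9,2,5,7,5,3,13,10,13],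
    [5,14,11,13,15,0,7,16,3,11,11,1,0,7,7,12,16,0,1,9,7,0,12,9,0,4,6,13,1,2,5,2,9,5,7,10,13,3,13],
    [11,5,14,16,3,15,13,7,0,7,7,11,11,0,1,9,7,16,12,1,0,9,0,12,4,6,0,2,9,1,13,5,2,3,13,7,5,13,10],
    [14,5,11,0,7,13,15,3,16,1,0,11,11,7,7,0,1,12,16,7,9,9,12,0,0,6,4,2,5,13,1,9,2,10,13,5,7,13,3],
    [11,14,5,3,16,7,0,15,13,7,7,0,1,11,11,7,9,1,0,16,12,0,9,12,6,4,0,9,2,5,2,1,13,13,3,13,10,7,5],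
    [14,11,5,7,0,3,16,13,15,0,1,7,7,11,11,1,0,7,9,12,16,12,9,0,6,0,4,5,2,9,2,13,1,13,10,13,3,5,7]]
  | .Bc => [
    [8,0,0,0,0,0,0,0,0,0,0,0,0,0,0,0,0,0,0,0,0,0,0,0,0,0,0,0,0,0,0,0,0,0,0,0,0,0,0],
    [0,8,0,0,0,0,0,0,0,0,0,0,0,0,0,0,0,0,0,0,0,0,0,0,0,0,0,0,0,0,0,0,0,0,0,0,0,0,0],
    [0,0,8,0,0,0,0,0,0,0,0,0,0,0,0,0,0,0,0,0,0,0,0,0,0,0,0,0,0,0,0,0,0,0,0,0,0,0,0],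
    [7,11,0,12,0,10,0,0,0,5,0,3,0,0,0,16,0,12,0,0,0,0,0,0,0,0,0,0,0,0,0,0,0,0,0,0,0,0,0],
    [7,0,11,0,12,0,0,10,0,0,5,0,0,3,0,0,16,0,0,12,0,0,0,0,0,0,0,0,0,0,0,0,0,0,0,0,0,0,0],
    [11,7,0,10,0,12,0,0,0,3,0,5,0,0,0,12,0,16,0,0,0,0,0,0,0,0,0,0,0,0,0,0,0,0,0,0,0,0,0],
    [0,7,11,0,0,0,12,0,10,0,0,0,5,0,3,0,0,0,16,0,12,0,0,0,0,0,0,0,0,0,0,0,0,0,0,0,0,0,0],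
    [11,0,7,0,10,0,0,12,0,0,3,0,0,5,0,0,12,0,0,16,0,0,0,0,0,0,0,0,0,0,0,0,0,0,0,0,0,0,0],
    [0,11,7,0,0,0,10,0,12,0,0,0,3,0,5,0,0,0,12,0,16,0,0,0,0,0,0,0,0,0,0,0,0,0,0,0,0,0,0],
    [6,4,0,3,0,3,0,0,0,4,0,8,0,0,0,3,0,11,0,0,0,0,0,0,0,0,0,0,0,0,0,0,0,0,0,0,0,0,0],
    [6,0,4,0,3,0,0,3,0,0,4,0,0,8,0,0,3,0,0,11,0,0,0,0,0,0,0,0,0,0,0,0,0,0,0,0,0,0,0],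
    [4,6,0,3,0,3,0,0,0,8,0,4,0,0,0,11,0,3,0,0,0,0,0,0,0,0,0,0,0,0,0,0,0,0,0,0,0,0,0],
    [0,6,4,0,0,0,3,0,3,0,0,0,4,0,8,0,0,0,3,0,11,0,0,0,0,0,0,0,0,0,0,0,0,0,0,0,0,0,0],
    [4,0,6,0,3,0,0,3,0,0,8,0,0,4,0,0,11,0,0,3,0,0,0,0,0,0,0,0,0,0,0,0,0,0,0,0,0,0,0],
    [0,4,6,0,0,0,3,0,3,0,0,0,8,0,4,0,0,0,11,0,3,0,0,0,0,0,0,0,0,0,0,0,0,0,0,0,0,0,0],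
    [11,0,0,2,0,1,0,0,0,0,0,11,0,0,0,8,0,9,0,0,0,0,0,0,0,0,0,0,0,0,0,0,0,0,0,0,0,0,0],
    [11,0,0,0,2,0,0,1,0,0,0,0,0,11,0,0,8,0,0,9,0,0,0,0,0,0,0,0,0,0,0,0,0,0,0,0,0,0,0],
    [0,11,0,1,0,2,0,0,0,11,0,0,0,0,0,9,0,8,0,0,0,0,0,0,0,0,0,0,0,0,0,0,0,0,0,0,0,0,0],
    [0,11,0,0,0,0,2,0,1,0,0,0,0,0,11,0,0,0,8,0,9,0,0,0,0,0,0,0,0,0,0,0,0,0,0,0,0,0,0],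
    [0,0,11,0,1,0,0,2,0,0,11,0,0,0,0,0,9,0,0,8,0,0,0,0,0,0,0,0,0,0,0,0,0,0,0,0,0,0,0],
    [0,0,11,0,0,0,1,0,2,0,0,0,11,0,0,0,0,0,9,0,8,0,0,0,0,0,0,0,0,0,0,0,0,0,0,0,0,0,0],
    [7,7,8,0,7,0,7,8,8,7,9,7,9,16,16,8,10,8,10,7,7,7,15,15,13,9,13,4,15,4,15,13,13,15,10,15,10,15,15],
    [7,8,7,7,0,8,8,0,7,9,7,16,16,7,9,10,8,7,7,8,10,15,7,15,9,13,13,15,4,13,13,4,15,10,15,15,15,15,10],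
    [8,7,7,8,8,7,0,7,0,16,16,9,7,9,7,7,7,10,8,10,8,15,15,7,13,13,9,13,13,15,4,15,4,15,15,10,15,10,15],
    [4,6,4,12,7,14,14,7,12,15,8,7,7,8,15,0,3,0,0,3,0,15,3,15,10,8,8,12,5,11,11,5,12,15,11,9,9,11,15],
    [4,4,6,7,12,7,12,14,14,8,15,8,15,7,7,3,0,3,0,0,0,3,15,15,8,10,8,5,12,5,12,11,11,11,15,11,15,9,9],
    [6,4,4,14,14,12,7,12,7,7,7,15,8,15,8,0,0,0,3,0,3,15,15,3,8,8,10,11,11,12,5,12,5,9,9,15,11,15,11],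
    [3,0,16,15,2,3,16,5,16,15,6,16,13,15,3,1,2,8,16,8,0,7,3,15,10,11,7,10,5,4,10,15,1,10,2,0,9,9,7],
    [3,16,0,2,15,5,16,3,16,6,15,15,3,16,13,2,1,8,0,8,16,3,7,15,11,10,7,5,10,15,1,4,10,2,10,9,7,0,9],
    [0,3,16,3,16,15,2,16,5,16,13,15,6,3,15,8,16,1,2,0,8,7,15,3,7,11,10,4,10,10,5,1,15,0,9,10,2,7,9],
    [16,3,0,5,16,2,15,16,3,15,3,6,15,13,16,8,0,2,1,16,8,3,15,7,7,10,11,15,1,5,10,10,4,9,7,2,10,9,0],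
    [0,16,3,16,3,16,5,15,2,13,16,3,15,15,6,16,8,0,8,1,2,15,7,3,11,7,10,10,4,1,15,10,5,9,0,7,9,10,2],
    [16,0,3,16,5,16,3,2,15,3,15,13,16,6,15,0,8,16,8,2,1,15,3,7,10,7,11,1,15,10,4,5,10,7,9,9,0,2,10],
    [7,13,0,0,7,4,14,9,13,9,9,11,7,5,11,5,1,7,3,16,8,8,6,7,1,5,11,14,0,8,4,4,1,1,12,4,15,11,9],
    [7,0,13,7,0,9,13,4,14,9,9,5,11,11,7,1,5,16,8,7,3,6,8,7,5,1,11,0,14,4,1,8,4,12,1,11,9,4,15],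
    [13,7,0,4,14,0,7,13,9,11,7,9,9,11,5,7,3,5,1,8,16,8,7,6,11,5,1,8,4,14,0,1,4,4,15,1,12,9,11],
    [0,7,13,9,13,7,0,14,4,5,11,9,9,7,11,16,8,1,5,3,7,6,7,8,11,1,5,4,1,0,14,4,8,11,9,12,1,15,4],
    [13,0,7,14,4,13,9,0,7,7,11,11,5,9,9,3,7,8,16,5,1,7,8,6,5,11,1,4,8,1,4,14,0,15,4,9,11,1,12],
    [0,13,7,13,9,14,4,7,0,11,5,7,11,9,9,8,16,3,7,1,5,7,6,8,1,11,5,1,4,4,8,0,14,9,11,15,4,12,1]]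
  | .Bd => [
    [8,0,0,0,0,0,0,0,0,0,0,0,0,0,0,0,0,0,0,0,0,0,0,0,0,0,0,0,0,0,0,0,0,0,0,0,0,0,0],
    [0,8,0,0,0,0,0,0,0,0,0,0,0,0,0,0,0,0,0,0,0,0,0,0,0,0,0,0,0,0,0,0,0,0,0,0,0,0,0],
    [0,0,8,0,0,0,0,0,0,0,0,0,0,0,0,0,0,0,0,0,0,0,0,0,0,0,0,0,0,0,0,0,0,0,0,0,0,0,0],
    [7,11,0,12,0,10,0,0,0,5,0,3,0,0,0,0,0,0,0,0,0,16,0,12,0,0,0,0,0,0,0,0,0,0,0,0,0,0,0],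
    [7,0,11,0,12,0,0,10,0,0,5,0,0,3,0,0,0,0,0,0,0,0,16,0,0,12,0,0,0,0,0,0,0,0,0,0,0,0,0],
    [11,7,0,10,0,12,0,0,0,3,0,5,0,0,0,0,0,0,0,0,0,12,0,16,0,0,0,0,0,0,0,0,0,0,0,0,0,0,0],
    [0,7,11,0,0,0,12,0,10,0,0,0,5,0,3,0,0,0,0,0,0,0,0,0,16,0,12,0,0,0,0,0,0,0,0,0,0,0,0],
    [11,0,7,0,10,0,0,12,0,0,3,0,0,5,0,0,0,0,0,0,0,0,12,0,0,16,0,0,0,0,0,0,0,0,0,0,0,0,0],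
    [0,11,7,0,0,0,10,0,12,0,0,0,3,0,5,0,0,0,0,0,0,0,0,0,12,0,16,0,0,0,0,0,0,0,0,0,0,0,0],
    [6,4,0,3,0,3,0,0,0,4,0,8,0,0,0,0,0,0,0,0,0,3,0,11,0,0,0,0,0,0,0,0,0,0,0,0,0,0,0],
    [6,0,4,0,3,0,0,3,0,0,4,0,0,8,0,0,0,0,0,0,0,0,3,0,0,11,0,0,0,0,0,0,0,0,0,0,0,0,0],
    [4,6,0,3,0,3,0,0,0,8,0,4,0,0,0,0,0,0,0,0,0,11,0,3,0,0,0,0,0,0,0,0,0,0,0,0,0,0,0],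
    [0,6,4,0,0,0,3,0,3,0,0,0,4,0,8,0,0,0,0,0,0,0,0,0,3,0,11,0,0,0,0,0,0,0,0,0,0,0,0],
    [4,0,6,0,3,0,0,3,0,0,8,0,0,4,0,0,0,0,0,0,0,0,11,0,0,3,0,0,0,0,0,0,0,0,0,0,0,0,0],
    [0,4,6,0,0,0,3,0,3,0,0,0,8,0,4,0,0,0,0,0,0,0,0,0,11,0,3,0,0,0,0,0,0,0,0,0,0,0,0],
    [0,9,0,3,12,8,8,12,3,13,10,16,16,10,13,7,6,6,5,15,15,7,13,4,4,13,7,16,5,8,8,5,16,10,15,11,11,15,10],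
    [0,0,9,12,3,12,3,8,8,10,13,10,13,16,16,6,7,6,15,5,15,13,7,13,7,4,4,5,16,5,16,8,8,15,10,15,10,11,11],
    [9,0,0,8,8,3,12,3,12,16,16,13,10,13,10,6,6,7,15,15,5,4,4,7,13,7,13,8,8,16,5,16,5,11,11,10,15,10,15],
    [7,12,7,2,0,12,12,0,2,9,4,13,13,4,9,10,12,12,16,15,15,11,6,12,12,6,11,4,16,8,8,16,4,5,13,6,6,13,5],
    [7,7,12,0,2,0,2,12,12,4,9,4,9,13,13,12,10,12,15,16,15,6,11,6,11,12,12,16,4,16,4,8,8,13,5,13,5,6,6],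
    [12,7,7,12,12,2,0,2,0,13,13,9,4,9,4,12,12,10,15,15,16,12,12,11,6,11,6,8,8,4,16,4,16,6,6,5,13,5,13],
    [11,0,0,2,0,1,0,0,0,0,0,11,0,0,0,0,0,0,0,0,0,8,0,9,0,0,0,0,0,0,0,0,0,0,0,0,0,0,0],
    [11,0,0,0,2,0,0,1,0,0,0,0,0,11,0,0,0,0,0,0,0,0,8,0,0,9,0,0,0,0,0,0,0,0,0,0,0,0,0],
    [0,11,0,1,0,2,0,0,0,11,0,0,0,0,0,0,0,0,0,0,0,9,0,8,0,0,0,0,0,0,0,0,0,0,0,0,0,0,0],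
    [0,11,0,0,0,0,2,0,1,0,0,0,0,0,11,0,0,0,0,0,0,0,0,0,8,0,9,0,0,0,0,0,0,0,0,0,0,0,0],
    [0,0,11,0,1,0,0,2,0,0,11,0,0,0,0,0,0,0,0,0,0,0,9,0,0,8,0,0,0,0,0,0,0,0,0,0,0,0,0],
    [0,0,11,0,0,0,1,0,2,0,0,0,11,0,0,0,0,0,0,0,0,0,0,0,9,0,8,0,0,0,0,0,0,0,0,0,0,0,0],
    [8,0,4,12,15,15,7,15,13,13,1,15,1,14,11,5,3,12,2,12,8,9,14,8,1,12,12,3,1,9,7,9,16,7,2,4,15,16,0],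
    [8,4,0,15,12,15,13,15,7,1,13,14,11,15,1,3,5,12,12,2,8,14,9,12,12,8,1,1,3,9,16,9,7,2,7,16,0,4,15],
    [0,8,4,15,7,12,15,13,15,15,1,13,1,11,14,12,3,5,8,12,2,8,1,9,14,12,12,9,7,3,1,16,9,4,15,7,2,0,16],
    [4,8,0,15,13,15,12,7,15,14,11,1,13,1,15,12,5,3,8,2,12,12,12,14,9,1,8,9,16,1,3,7,9,16,0,2,7,15,4],
    [0,4,8,7,15,13,15,12,15,1,15,11,14,13,1,3,12,5,12,8,2,1,8,12,12,9,14,7,9,16,9,3,1,15,4,0,16,7,2],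
    [4,0,8,13,15,7,15,15,12,11,14,1,15,1,13,5,12,3,2,8,12,12,12,1,8,14,9,16,9,7,9,1,3,0,16,15,4,2,7],
    [12,14,1,3,10,1,13,5,5,13,2,9,6,4,9,9,10,2,5,4,10,10,14,16,16,6,16,11,15,12,15,16,10,15,16,11,6,12,1],
    [12,1,14,10,3,5,5,1,13,2,13,4,9,9,6,10,9,2,4,5,10,14,10,6,16,16,16,15,11,16,10,12,15,16,15,12,1,11,6],
    [14,12,1,1,13,3,10,5,5,9,6,13,2,9,4,2,10,9,10,4,5,16,16,10,14,16,6,12,15,11,15,10,16,11,6,15,16,1,12],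
    [1,12,14,5,5,10,3,13,1,4,9,2,13,6,9,2,9,10,10,5,4,6,16,14,10,16,16,16,10,15,11,15,12,12,1,16,15,6,11],
    [14,1,12,13,1,5,5,3,10,6,9,9,4,13,2,10,2,9,4,10,5,16,16,16,6,10,14,15,12,10,16,11,15,6,11,1,12,15,16],
    [1,14,12,5,5,13,1,10,3,9,4,6,9,2,13,9,2,10,5,10,4,16,6,16,16,14,10,10,16,15,12,15,11,1,12,6,11,16,15]]
  | .Be => [
    [8,0,0,0,0,0,0,0,0,0,0,0,0,0,0,0,0,0,0,0,0,0,0,0,0,0,0,0,0,0,0,0,0,0,0,0,0,0,0],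
    [0,8,0,0,0,0,0,0,0,0,0,0,0,0,0,0,0,0,0,0,0,0,0,0,0,0,0,0,0,0,0,0,0,0,0,0,0,0,0],
    [0,0,8,0,0,0,0,0,0,0,0,0,0,0,0,0,0,0,0,0,0,0,0,0,0,0,0,0,0,0,0,0,0,0,0,0,0,0,0],
    [7,11,0,12,0,10,0,0,0,5,0,3,0,0,0,0,0,0,0,0,0,16,0,12,0,0,0,0,0,0,0,0,0,0,0,0,0,0,0],
    [7,0,11,0,12,0,0,10,0,0,5,0,0,3,0,0,0,0,0,0,0,0,16,0,0,12,0,0,0,0,0,0,0,0,0,0,0,0,0],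
    [11,7,0,10,0,12,0,0,0,3,0,5,0,0,0,0,0,0,0,0,0,12,0,16,0,0,0,0,0,0,0,0,0,0,0,0,0,0,0],
    [0,7,11,0,0,0,12,0,10,0,0,0,5,0,3,0,0,0,0,0,0,0,0,0,16,0,12,0,0,0,0,0,0,0,0,0,0,0,0],
    [11,0,7,0,10,0,0,12,0,0,3,0,0,5,0,0,0,0,0,0,0,0,12,0,0,16,0,0,0,0,0,0,0,0,0,0,0,0,0],
    [0,11,7,0,0,0,10,0,12,0,0,0,3,0,5,0,0,0,0,0,0,0,0,0,12,0,16,0,0,0,0,0,0,0,0,0,0,0,0],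
    [6,4,0,3,0,3,0,0,0,4,0,8,0,0,0,0,0,0,0,0,0,3,0,11,0,0,0,0,0,0,0,0,0,0,0,0,0,0,0],
    [6,0,4,0,3,0,0,3,0,0,4,0,0,8,0,0,0,0,0,0,0,0,3,0,0,11,0,0,0,0,0,0,0,0,0,0,0,0,0],
    [4,6,0,3,0,3,0,0,0,8,0,4,0,0,0,0,0,0,0,0,0,11,0,3,0,0,0,0,0,0,0,0,0,0,0,0,0,0,0],
    [0,6,4,0,0,0,3,0,3,0,0,0,4,0,8,0,0,0,0,0,0,0,0,0,3,0,11,0,0,0,0,0,0,0,0,0,0,0,0],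
    [4,0,6,0,3,0,0,3,0,0,8,0,0,4,0,0,0,0,0,0,0,0,11,0,0,3,0,0,0,0,0,0,0,0,0,0,0,0,0],
    [0,4,6,0,0,0,3,0,3,0,0,0,8,0,4,0,0,0,0,0,0,0,0,0,11,0,3,0,0,0,0,0,0,0,0,0,0,0,0],
    [11,16,11,14,8,1,1,8,14,4,12,9,9,12,4,6,0,0,12,8,12,5,2,10,10,2,5,1,9,2,2,9,1,8,8,9,9,8,8],
    [11,11,16,8,14,8,14,1,1,12,4,12,4,9,9,0,6,0,8,12,12,2,5,2,5,10,10,9,1,9,1,2,2,8,8,8,8,9,9],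
    [16,11,11,1,1,14,8,14,8,9,9,4,12,4,12,0,0,6,12,12,8,10,10,5,2,5,2,2,2,1,9,1,9,9,9,8,8,8,8],
    [6,6,5,0,4,0,4,10,10,12,3,12,3,13,13,0,14,0,10,0,0,8,0,8,0,5,5,13,7,13,7,8,8,1,1,1,1,9,9],
    [6,5,6,4,0,10,10,0,4,3,12,13,13,12,3,14,0,0,0,10,0,0,8,5,5,8,0,7,13,8,8,13,7,1,1,9,9,1,1],
    [5,6,6,10,10,4,0,4,0,13,13,3,12,3,12,0,0,14,0,0,10,5,5,0,8,0,8,8,8,7,13,7,13,9,9,1,1,1,1],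
    [11,0,0,2,0,1,0,0,0,0,0,11,0,0,0,0,0,0,0,0,0,8,0,9,0,0,0,0,0,0,0,0,0,0,0,0,0,0,0],
    [11,0,0,0,2,0,0,1,0,0,0,0,0,11,0,0,0,0,0,0,0,0,8,0,0,9,0,0,0,0,0,0,0,0,0,0,0,0,0],
    [0,11,0,1,0,2,0,0,0,11,0,0,0,0,0,0,0,0,0,0,0,9,0,8,0,0,0,0,0,0,0,0,0,0,0,0,0,0,0],
    [0,11,0,0,0,0,2,0,1,0,0,0,0,0,11,0,0,0,0,0,0,0,0,0,8,0,9,0,0,0,0,0,0,0,0,0,0,0,0],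
    [0,0,11,0,1,0,0,2,0,0,11,0,0,0,0,0,0,0,0,0,0,0,9,0,0,8,0,0,0,0,0,0,0,0,0,0,0,0,0],
    [0,0,11,0,0,0,1,0,2,0,0,0,11,0,0,0,0,0,0,0,0,0,0,0,9,0,8,0,0,0,0,0,0,0,0,0,0,0,0],
    [9,2,10,10,15,9,12,12,2,15,14,8,12,16,3,3,13,7,11,7,6,1,14,15,1,2,4,6,6,14,6,7,6,8,15,5,14,12,16],
    [9,10,2,15,10,12,2,9,12,14,15,16,3,8,12,13,3,7,7,11,6,14,1,2,4,15,1,6,6,7,6,14,6,15,8,12,16,5,14],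
    [2,9,10,9,12,10,15,2,12,8,12,15,14,3,16,7,13,3,11,6,7,15,1,1,14,4,2,14,6,6,6,6,7,5,14,8,15,16,12],
    [10,9,2,12,2,15,10,12,9,16,3,14,15,12,8,7,3,13,7,6,11,2,4,14,1,1,15,7,6,6,6,6,14,12,16,15,8,14,5],
    [2,10,9,12,9,2,12,10,15,12,8,3,16,15,14,13,7,3,6,11,7,1,15,4,2,1,14,6,14,6,7,6,6,14,5,16,12,8,15],
    [10,2,9,2,12,12,9,15,10,3,16,12,8,14,15,3,7,13,6,7,11,4,2,1,15,14,1,6,7,6,14,6,6,16,12,14,5,15,8],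
    [9,9,16,1,1,7,11,9,8,14,7,11,15,0,8,1,11,0,0,14,16,2,12,12,14,2,8,11,8,8,3,11,4,15,8,11,9,4,4],
    [9,16,9,1,1,9,8,7,11,7,14,0,8,11,15,11,1,0,14,0,16,12,2,2,8,12,14,8,11,11,4,8,3,8,15,4,4,11,9],
    [9,9,16,7,11,1,1,8,9,11,15,14,7,8,0,0,11,1,0,16,14,12,14,2,12,8,2,8,3,11,8,4,11,11,9,15,8,4,4],
    [16,9,9,9,8,1,1,11,7,0,8,7,14,15,11,0,1,11,14,16,0,2,8,12,2,14,12,11,4,8,11,3,8,4,4,8,15,9,11],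
    [9,16,9,11,7,8,9,1,1,15,11,8,0,14,7,11,0,1,16,0,14,14,12,8,2,2,12,3,8,4,11,11,8,9,11,4,4,15,8],
    [16,9,9,8,9,11,7,1,1,8,0,15,11,7,14,1,0,11,16,14,0,8,2,14,12,12,2,4,11,3,8,8,11,4,4,9,11,8,15]]
  | .Bf => [
    [8,0,0,0,0,0,0,0,0,0,0,0,0,0,0,0,0,0,0,0,0,0,0,0,0,0,0,0,0,0,0,0,0,0,0,0,0,0,0],
    [0,8,0,0,0,0,0,0,0,0,0,0,0,0,0,0,0,0,0,0,0,0,0,0,0,0,0,0,0,0,0,0,0,0,0,0,0,0,0],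
    [0,0,8,0,0,0,0,0,0,0,0,0,0,0,0,0,0,0,0,0,0,0,0,0,0,0,0,0,0,0,0,0,0,0,0,0,0,0,0],
    [7,11,0,12,0,10,0,0,0,5,0,3,0,0,0,0,0,0,0,0,0,16,0,12,0,0,0,0,0,0,0,0,0,0,0,0,0,0,0],
    [7,0,11,0,12,0,0,10,0,0,5,0,0,3,0,0,0,0,0,0,0,0,16,0,0,12,0,0,0,0,0,0,0,0,0,0,0,0,0],
    [11,7,0,10,0,12,0,0,0,3,0,5,0,0,0,0,0,0,0,0,0,12,0,16,0,0,0,0,0,0,0,0,0,0,0,0,0,0,0],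
    [0,7,11,0,0,0,12,0,10,0,0,0,5,0,3,0,0,0,0,0,0,0,0,0,16,0,12,0,0,0,0,0,0,0,0,0,0,0,0],
    [11,0,7,0,10,0,0,12,0,0,3,0,0,5,0,0,0,0,0,0,0,0,12,0,0,16,0,0,0,0,0,0,0,0,0,0,0,0,0],
    [0,11,7,0,0,0,10,0,12,0,0,0,3,0,5,0,0,0,0,0,0,0,0,0,12,0,16,0,0,0,0,0,0,0,0,0,0,0,0],
    [6,4,0,3,0,3,0,0,0,4,0,8,0,0,0,0,0,0,0,0,0,3,0,11,0,0,0,0,0,0,0,0,0,0,0,0,0,0,0],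
    [6,0,4,0,3,0,0,3,0,0,4,0,0,8,0,0,0,0,0,0,0,0,3,0,0,11,0,0,0,0,0,0,0,0,0,0,0,0,0],
    [4,6,0,3,0,3,0,0,0,8,0,4,0,0,0,0,0,0,0,0,0,11,0,3,0,0,0,0,0,0,0,0,0,0,0,0,0,0,0],
    [0,6,4,0,0,0,3,0,3,0,0,0,4,0,8,0,0,0,0,0,0,0,0,0,3,0,11,0,0,0,0,0,0,0,0,0,0,0,0],
    [4,0,6,0,3,0,0,3,0,0,8,0,0,4,0,0,0,0,0,0,0,0,11,0,0,3,0,0,0,0,0,0,0,0,0,0,0,0,0],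
    [0,4,6,0,0,0,3,0,3,0,0,0,8,0,4,0,0,0,0,0,0,0,0,0,11,0,3,0,0,0,0,0,0,0,0,0,0,0,0],
    [4,4,13,0,13,0,13,10,10,4,15,4,15,9,9,16,14,14,14,6,14,11,14,11,14,12,12,1,1,1,1,7,7,10,4,10,4,5,5],
    [4,13,4,13,0,10,10,0,13,15,4,9,9,4,15,14,16,14,6,14,14,14,11,12,12,11,14,1,1,7,7,1,1,4,10,5,5,10,4],
    [13,4,4,10,10,13,0,13,0,9,9,15,4,15,4,14,14,16,14,14,6,12,12,14,11,14,11,7,7,1,1,1,1,5,5,4,10,4,10],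
    [0,10,0,2,2,13,13,2,2,4,0,13,13,0,4,15,10,15,2,6,6,2,10,11,11,10,2,1,13,11,11,13,1,10,11,5,5,11,10],
    [0,0,10,2,2,2,2,13,13,0,4,0,4,13,13,10,15,15,6,2,6,10,2,10,2,11,11,13,1,13,1,11,11,11,10,11,10,5,5],
    [10,0,0,13,13,2,2,2,2,13,13,4,0,4,0,15,15,10,6,6,2,11,11,2,10,2,10,11,11,1,13,1,13,5,5,10,11,10,11],
    [11,0,0,2,0,1,0,0,0,0,0,11,0,0,0,0,0,0,0,0,0,8,0,9,0,0,0,0,0,0,0,0,0,0,0,0,0,0,0],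
    [11,0,0,0,2,0,0,1,0,0,0,0,0,11,0,0,0,0,0,0,0,0,8,0,0,9,0,0,0,0,0,0,0,0,0,0,0,0,0],
    [0,11,0,1,0,2,0,0,0,11,0,0,0,0,0,0,0,0,0,0,0,9,0,8,0,0,0,0,0,0,0,0,0,0,0,0,0,0,0],
    [0,11,0,0,0,0,2,0,1,0,0,0,0,0,11,0,0,0,0,0,0,0,0,0,8,0,9,0,0,0,0,0,0,0,0,0,0,0,0],
    [0,0,11,0,1,0,0,2,0,0,11,0,0,0,0,0,0,0,0,0,0,0,9,0,0,8,0,0,0,0,0,0,0,0,0,0,0,0,0],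
    [0,0,11,0,0,0,1,0,2,0,0,0,11,0,0,0,0,0,0,0,0,0,0,0,9,0,8,0,0,0,0,0,0,0,0,0,0,0,0],
    [8,13,2,1,11,15,10,10,9,9,16,16,4,12,4,0,1,5,8,2,6,9,10,12,12,12,8,8,11,1,13,5,5,10,8,3,0,7,1],
    [8,2,13,11,1,10,9,15,10,16,9,12,4,16,4,1,0,5,2,8,6,10,9,12,8,12,12,11,8,5,5,1,13,8,10,7,1,3,0],
    [13,8,2,15,10,1,11,9,10,16,4,9,16,4,12,0,5,1,6,2,8,12,12,9,10,8,12,1,13,8,11,5,5,3,0,10,8,1,7],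
    [2,8,13,10,9,11,1,10,15,12,4,16,9,4,16,1,5,0,6,8,2,12,8,10,9,12,12,5,5,11,8,13,1,7,1,8,10,0,3],
    [13,2,8,10,15,9,10,1,11,4,16,4,12,9,16,5,0,1,2,6,8,12,12,8,12,9,10,13,1,5,5,8,11,0,3,1,7,10,8],
    [2,13,8,9,10,10,15,11,1,4,12,4,16,16,9,5,1,0,8,6,2,8,12,12,12,10,9,5,5,13,1,11,8,1,7,0,3,8,10],
    [12,15,11,14,6,10,15,13,11,0,4,5,2,7,13,14,9,8,0,1,5,12,0,10,5,6,11,5,2,4,0,14,9,11,3,8,8,11,3],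
    [12,11,15,6,14,13,11,10,15,4,0,7,13,5,2,9,14,8,1,0,5,0,12,6,11,10,5,2,5,14,9,4,0,3,11,11,3,8,8],
    [15,12,11,10,15,14,6,11,13,5,2,0,4,13,7,14,8,9,5,1,0,10,5,12,0,11,6,4,0,5,2,9,14,8,8,11,3,3,11],
    [11,12,15,13,11,6,14,15,10,7,13,4,0,2,5,9,8,14,5,0,1,6,11,0,12,5,10,14,9,2,5,0,4,11,3,3,11,8,8],
    [15,11,12,15,10,11,13,14,6,2,5,13,7,0,4,8,14,9,1,5,0,5,10,11,6,12,0,0,4,9,14,5,2,8,8,3,11,11,3],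
    [11,15,12,11,13,15,10,6,14,13,7,2,5,4,0,8,9,14,0,5,1,11,6,5,10,0,12,9,14,0,4,2,5,3,11,8,8,3,11]]
-- Row `i` of the claimed inverse is tested against the columns numbered from `j` on. Natural number
-- arithmetic keeps the kernel computation fast.
def checkRow (a : List ℕ) (i : ℕ) : List (List ℕ) → ℕ → Bool
  | [], _ => true
  | c :: cs, j => ((dotNat a c).mod 17).beq (bif i.beq j then 1 else 0) && checkRow a i cs (j + 1)

def checkRows (cs : List (List ℕ)) : List (List ℕ) → ℕ → Bool
  | [], _ => true
  | a :: as, i => checkRow a i cs 0 && checkRows cs as (i + 1)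

/-! ### Facts about the tables that are decided by computation -/

theorem entries_eq_members (b : BasisName) :
    entries b = ((members b).map Member.entry).toFinset := by
  cases b <;> decide +kernel

theorem length_members (b : BasisName) : (members b).length = 39 := by
  cases b <;> decide +kernel

theorem knotsOK_members : (allMembers.all fun r => knotsOK r.knots) = true := by
  decide +kernel

theorem length_dual_members : (allMembers.all fun r => r.dual.length.beq 10) = true := by
  decide +kernel

theorem sum_dual_members : (allMembers.all fun r => r.dual.sum.beq 5) = true := by
  decide +kernel

theorem weight_members : (allMembers.all fun r => decide (0 ≤ r.weight)) = true := by
  decide +kernel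

/-- Partition of unity: position 0 is the monomial `o⁵`, and the factor 4 comes from storing four
times the weights. -/
theorem weightedSum_one (b : BasisName) :
    weightedSum (fun r => r.weight) (members b) = unitCoeffs 0 4 := by
  cases b <;> decide +kernel

/-- Reproduction of `x`, whose monomial `x o⁴` has position 6; 240 is 4 for the weights times 60 for
the domain points. Likewise `y o⁴` has position 1. -/
theorem weightedSum_fst (b : BasisName) :
    weightedSum (fun r => r.weight * r.point.1) (members b) = unitCoeffs 6 240 := by
  cases b <;> decide +kernel

theorem weightedSum_snd (b : BasisName) :
    weightedSum (fun r => r.weight * r.point.2) (members b) = unitCoeffs 1 240 := by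
  cases b <;> decide +kernel

set_option maxHeartbeats 2000000 in
theorem checkRows_members (b : BasisName) :
    checkRows (collocationColumns (members b)) (inverseRows b) 0 = true := by
  cases b <;> decide +kernel

theorem length_inverseRows (b : BasisName) :
    (inverseRows b).length = 39 ∧ ∀ a ∈ inverseRows b, a.length = 39 := by
  cases b <;> decide +kernel

/-- This is the Bernstein criterion for positivity, without the binomial factors: nonnegative
coefficients in the barycentric coordinates of each face. -/
theorem isNonneg2_members :
    ((faceLists.map faceGenerators).all fun g => allMembers.all fun r =>
      isNonneg2 (linComb r.coeffs g)) = true := by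
  decide +kernel

theorem piecesMatch_members :
    (allMembers.all fun r => piecesMatch (pieces 5 r.knots) facePolys r.coeffs) = true := by
  decide +kernel

/-! ### Evaluation of the polynomials -/

/-- A map that respects the operations. -/
structure OpsHom {α β : Type*} [Ops α] [Ops β] (f : α → β) : Prop where
  add : ∀ a b, f (Ops.add a b) = Ops.add (f a) (f b)
  mul : ∀ a b, f (Ops.mul a b) = Ops.mul (f a) (f b)
  smul : ∀ n a, f (Ops.smul n a) = Ops.smul n (f a)
  ofInt : ∀ n, f (Ops.ofInt n) = Ops.ofInt n

section CommRing

variable {R S : Type*} [CommRing R] [CommRing S]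

theorem Ops.add_eq (a b : R) : Ops.add a b = a + b := rfl
theorem Ops.mul_eq (a b : R) : Ops.mul a b = a * b := rfl
theorem Ops.smul_eq (n : ℤ) (a : R) : Ops.smul n a = n * a := rfl
theorem Ops.ofInt_eq (n : ℤ) : (Ops.ofInt n : R) = n := rfl

theorem OpsHom.intCast : OpsHom (Int.cast : ℤ → R) :=
  ⟨Int.cast_add, Int.cast_mul, Int.cast_mul, fun _ => rfl⟩

theorem OpsHom.ringHom (f : R →+* S) : OpsHom f where
  add := map_add f
  mul := map_mul f
  smul n a := by simp [Ops.smul_eq]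
  ofInt n := by simp [Ops.ofInt_eq]

theorem linForm_eq (l : ℤ × ℤ × ℤ) (x y o : R) :
    linForm l x y o = l.1 * x + l.2.1 * y + l.2.2 * o := by
  simp only [linForm, Ops.add_eq, Ops.smul_eq]; ring

theorem powOps_eq (x : R) (n : ℕ) : powOps x n = x ^ n := by
  induction n with
  | zero => simp [powOps, Ops.ofInt_eq]
  | succ n ih => rw [powOps, ih, Ops.mul_eq, pow_succ']

theorem linComb_nil (l : List R) : linComb [] l = 0 := by
  simp [linComb, Ops.ofInt_eq]

theorem linComb_cons (c : ℤ) (cs : List ℤ) (a : R) (l : List R) :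
    linComb (c :: cs) (a :: l) = c * a + linComb cs l := rfl

theorem linComb_nil_right (c : List ℤ) : linComb c ([] : List R) = 0 := by
  cases c <;> simp [linComb, Ops.ofInt_eq]

theorem linComb_add (c d : List ℤ) (l : List R) :
    linComb (Ops.add c d) l = linComb c l + linComb d l := by
  induction c generalizing d l with
  | nil => rw [linComb_nil, zero_add]; rfl
  | cons a c ih =>
    cases d with
    | nil => rw [linComb_nil, add_zero]; rfl
    | cons b d =>
      cases l with
      | nil => simp [linComb_nil_right]
      | cons g l =>
        have h : Ops.add (a :: c) (b :: d) = (a + b) :: Ops.add c d := rfl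
        rw [h]
        simp only [linComb_cons, ih, Int.cast_add]
        ring

theorem linComb_smul (n : ℤ) (c : List ℤ) (l : List R) :
    linComb (Ops.smul n c) l = n * linComb c l := by
  have h : Ops.smul n c = if n = 0 then [] else c.map (n * ·) := rfl
  rw [h]
  split_ifs with hn
  · simp [hn, linComb_nil]
  · clear h
    induction c generalizing l with
    | nil => simp [linComb_nil]
    | cons a c ih =>
      cases l with
      | nil => simp [linComb_nil_right]
      | cons g l => simp only [List.map_cons, linComb_cons, ih, Int.cast_mul]; ring

theorem linComb_map_mul (k : R) (c : List ℤ) (l : List R) :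
    linComb c (l.map (k * ·)) = k * linComb c l := by
  induction c generalizing l with
  | nil => simp [linComb_nil]
  | cons a c ih =>
    cases l with
    | nil => simp [linComb_nil_right]
    | cons g l => simp only [List.map_cons, linComb_cons, ih]; ring

theorem linComb_weightedSum (g : Member → ℤ) (rs : List Member) (l : List R) :
    linComb (weightedSum g rs) l = (rs.map fun r => (g r : R) * linComb r.coeffs l).sum := by
  induction rs with
  | nil => simp [weightedSum, linComb_nil]
  | cons r rs ih =>
    rw [weightedSum, List.foldr_cons, linComb_add, linComb_smul, List.map_cons, List.sum_cons, ← ih]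
    rfl

/-- All generators have degree 5 once the fourth powers count with degree 4. This homogeneity clears
denominators, both in the positivity argument and for the collocation matrix. -/
theorem generators_homogeneous (k : R) (t : List R) (x y o : R) :
    generators (t.map (k ^ 4 * ·)) (k * x) (k * y) (k * o) =
      (generators t x y o).map (k ^ 5 * ·) := by
  simp only [generators, List.map_append, List.map_flatMap, List.flatMap_map]
  congr 1
  · simp only [monomials, List.map_flatMap, List.map_map]
    refine List.flatMap_congr fun i hi => List.map_congr_left fun j hj => ?_
    rw [List.mem_range] at hi hj
    have h : k ^ 5 = k ^ i * (k ^ j * k ^ (5 - i - j)) := by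
      rw [← pow_add, ← pow_add]; congr 1; lia
    simp only [Function.comp_apply, Ops.mul_eq, powOps_eq, mul_pow, h]
    ring
  · congr 1
    funext s
    simp only [List.map_cons, List.map_nil, Ops.mul_eq, List.cons.injEq, and_true]
    refine ⟨?_, ?_, ?_⟩ <;> ring

end CommRing

section OpsHom

variable {α β : Type*} [Ops α] [Ops β] {f : α → β}

theorem OpsHom.linForm (hf : OpsHom f) (l : ℤ × ℤ × ℤ) (x y o : α) :
    f (linForm l x y o) = PS12.linForm l (f x) (f y) (f o) := by
  simp only [PS12.linForm, hf.add, hf.smul]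

theorem OpsHom.powOps (hf : OpsHom f) (x : α) (n : ℕ) : f (powOps x n) = PS12.powOps (f x) n := by
  induction n with
  | zero => exact hf.ofInt 1
  | succ n ih => rw [PS12.powOps, hf.mul, ih]; rfl

theorem OpsHom.monomials (hf : OpsHom f) (x y o : α) :
    (monomials x y o).map f = PS12.monomials (f x) (f y) (f o) := by
  simp only [PS12.monomials, List.map_flatMap, List.map_map, Function.comp_def, hf.mul, hf.powOps]

theorem OpsHom.generators (hf : OpsHom f) (t : List α) (x y o : α) :
    (generators t x y o).map f = PS12.generators (t.map f) (f x) (f y) (f o) := by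
  simp only [PS12.generators, List.map_append, hf.monomials, List.map_flatMap, List.flatMap_map,
    List.map_cons, List.map_nil, hf.mul]

theorem OpsHom.facePowers (hf : OpsHom f) (F : List ℕ) (x y o : α) :
    (facePowers F x y o).map f = PS12.facePowers F (f x) (f y) (f o) := by
  simp only [PS12.facePowers, List.map_map]
  refine List.map_congr_left fun l _ => ?_
  simp only [Function.comp_apply]
  cases lineSide l F
  · exact hf.ofInt 0
  · simp only [cond_true, hf.powOps, hf.linForm]

theorem OpsHom.linComb (hf : OpsHom f) (c : List ℤ) (l : List α) :
    f (linComb c l) = PS12.linComb c (l.map f) := by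
  induction c generalizing l with
  | nil => simp only [PS12.linComb, hf.ofInt]
  | cons a c ih =>
    cases l with
    | nil => simp only [PS12.linComb, hf.ofInt, List.map_nil]
    | cons g l => simp only [PS12.linComb, List.map_cons, hf.add, hf.smul, ih]

end OpsHom

/-- The value at `x` of the polynomial with the given list of coefficients. -/
def evalList {α : Type*} (f : α → ℝ) (x : ℝ) (p : List α) : ℝ :=
  p.foldr (fun a s => f a + x * s) 0

section evalList

variable {α : Type*} {f : α → ℝ} {x : ℝ}

theorem evalList_nil : evalList f x [] = 0 := rfl

theorem evalList_cons (a : α) (p : List α) : evalList f x (a :: p) = f a + x * evalList f x p := rfl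

theorem evalList_map (g : α → α) (k : ℝ) (h : ∀ a, f (g a) = k * f a) (p : List α) :
    evalList f x (p.map g) = k * evalList f x p := by
  induction p with
  | nil => simp [evalList_nil]
  | cons a p ih => rw [List.map_cons, evalList_cons, evalList_cons, ih, h]; ring

variable [Ops α]

theorem evalList_add (hf : OpsHom f) (p q : List α) :
    evalList f x (addList p q) = evalList f x p + evalList f x q := by
  induction p generalizing q with
  | nil => simp [addList, evalList_nil]
  | cons a p ih =>
    cases q with
    | nil => simp [addList, evalList_nil]
    | cons b q =>
      simp only [addList, evalList_cons, ih, hf.add, Ops.add_eq]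
      ring

theorem evalList_mul (hf : OpsHom f) (p q : List α) :
    evalList f x (mulList p q) = evalList f x p * evalList f x q := by
  induction p with
  | nil => simp [mulList, evalList_nil]
  | cons a p ih =>
    rw [mulList, evalList_add hf, evalList_cons, evalList_cons, ih,
      evalList_map (Ops.mul a) (f a) (fun b => hf.mul a b), hf.ofInt, Ops.ofInt_eq]
    push_cast
    ring

theorem OpsHom.evalList (hf : OpsHom f) (x : ℝ) : OpsHom (evalList f x) where
  add := evalList_add hf
  mul := evalList_mul hf
  smul n p := by
    have h : Ops.smul n p = if n = 0 then [] else p.map (Ops.smul n) := rfl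
    rw [h, Ops.smul_eq]
    split_ifs with hn
    · simp [hn, evalList_nil]
    · exact evalList_map _ _ (fun a => hf.smul n a) p
  ofInt n := by
    have h : (Ops.ofInt n : List α) = if n = 0 then [] else [Ops.ofInt n] := rfl
    rw [h, Ops.ofInt_eq]
    split_ifs with hn
    · simp [hn, evalList_nil]
    · simp [evalList_cons, evalList_nil, hf.ofInt, Ops.ofInt_eq]

end evalList

/-- The value of a polynomial in two variables. -/
def eval2 (x y : ℝ) : List (List ℤ) → ℝ := evalList (evalList (Int.cast : ℤ → ℝ) y) x

theorem opsHom_eval2 (x y : ℝ) : OpsHom (eval2 x y) := (OpsHom.intCast.evalList y).evalList x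

theorem eval2_nil (x y : ℝ) : eval2 x y [] = 0 := rfl

theorem eval2_mulForm (x y : ℝ) (f : ℤ × ℤ × ℤ) (p : List (List ℤ)) :
    eval2 x y (mulForm f p) = linForm f x y 1 * eval2 x y p := by
  cases p with
  | nil => simp [mulForm, eval2_nil]
  | cons r p =>
    have h1 : eval2 x y ((r :: p).map ((0 : ℤ) :: ·)) = y * eval2 x y (r :: p) :=
      evalList_map _ y (fun a => by simp [evalList_cons]) _
    have h2 : eval2 x y ([] :: r :: p) = x * eval2 x y (r :: p) := by
      simp only [eval2, evalList_cons, evalList_nil, zero_add]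
    rw [mulForm]
    · simp only [(opsHom_eval2 x y).add, (opsHom_eval2 x y).smul, h1, h2, linForm_eq, Ops.add_eq,
        Ops.smul_eq]
      ring
    · simp

theorem eval2_eq_zero {p : List (List ℤ)} (h : isZero2 p = true) (x y : ℝ) : eval2 x y p = 0 := by
  have h1 : ∀ r : List ℤ, (r.all fun c => decide (c = 0)) = true →
      evalList (Int.cast : ℤ → ℝ) y r = 0 := by
    intro r hr
    induction r with
    | nil => rfl
    | cons a r ih =>
      simp only [List.all_cons, Bool.and_eq_true, decide_eq_true_eq] at hr
      rw [evalList_cons, ih hr.2, hr.1]; simp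
  induction p with
  | nil => rfl
  | cons r p ih =>
    simp only [isZero2, List.all_cons, Bool.and_eq_true] at h
    rw [eval2, evalList_cons, h1 r h.1, zero_add]
    exact mul_eq_zero_of_right _ (ih h.2)

theorem eval2_nonneg {p : List (List ℤ)} (h : isNonneg2 p = true) {x y : ℝ} (hx : 0 ≤ x)
    (hy : 0 ≤ y) : 0 ≤ eval2 x y p := by
  have h1 : ∀ r : List ℤ, (r.all fun c => decide (0 ≤ c)) = true →
      0 ≤ evalList (Int.cast : ℤ → ℝ) y r := by
    intro r hr
    induction r with
    | nil => exact le_rfl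
    | cons a r ih =>
      simp only [List.all_cons, Bool.and_eq_true, decide_eq_true_eq] at hr
      rw [evalList_cons]
      have := ih hr.2
      have : (0 : ℝ) ≤ a := by exact_mod_cast hr.1
      positivity
  induction p with
  | nil => exact le_rfl
  | cons r p ih =>
    simp only [isNonneg2, List.all_cons, Bool.and_eq_true] at h
    rw [eval2, evalList_cons]
    have h2 := h1 r h.1
    have h3 : 0 ≤ evalList (evalList (Int.cast : ℤ → ℝ) y) x p := ih h.2
    positivity

/-! ### Splines in barycentric coordinates -/

/-- The fourth powers of the positive parts of the interior lines. -/
noncomputable def posPowers (x y o : ℝ) : List ℝ := lines.map fun l => max (linForm l x y o) 0 ^ 4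

/-- The spline with the given coefficients at the point with first barycentric coordinates `x`,
`y`. -/
noncomputable def splineVal (c : List ℤ) (x y : ℝ) : ℝ :=
  linComb c (generators (posPowers x y 1) x y 1)

/-- The polynomial piece of the spline on a face. -/
noncomputable def facePiece (F : List ℕ) (c : List ℤ) (x y : ℝ) : ℝ :=
  linComb c (generators (facePowers F x y 1) x y 1)

/-- The point with first barycentric coordinates `x`, `y` has the barycentric coordinates `a`, `b`,
`c` with respect to the face `F`. -/
def HasFaceCoords (F : List ℕ) (x y a b c : ℝ) : Prop :=
  12 * x = a * (vertexCoords.getD (F.getD 0 0) (0, 0)).1 +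
    b * (vertexCoords.getD (F.getD 1 0) (0, 0)).1 +
    c * (vertexCoords.getD (F.getD 2 0) (0, 0)).1 ∧
  12 * y = a * (vertexCoords.getD (F.getD 0 0) (0, 0)).2 +
    b * (vertexCoords.getD (F.getD 1 0) (0, 0)).2 +
    c * (vertexCoords.getD (F.getD 2 0) (0, 0)).2 ∧
  a + b + c = 1

/-- The point with first barycentric coordinates `x`, `y` lies in the face `F`. -/
def InFace (F : List ℕ) (x y : ℝ) : Prop :=
  ∃ a b c : ℝ, 0 ≤ a ∧ 0 ≤ b ∧ 0 ≤ c ∧ HasFaceCoords F x y a b c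

theorem linForm_of_hasFaceCoords {F : List ℕ} {x y a b c : ℝ} (h : HasFaceCoords F x y a b c)
    (l : ℤ × ℤ × ℤ) :
    12 * linForm l x y 1 =
      a * formAt l (F.getD 0 0) + b * formAt l (F.getD 1 0) + c * formAt l (F.getD 2 0) := by
  obtain ⟨h1, h2, h3⟩ := h
  simp only [linForm_eq, formAt]
  push_cast
  linear_combination (l.1 : ℝ) * h1 + l.2.1 * h2 - 12 * l.2.2 * h3

/-- No interior line crosses a face: the three vertices of a face always lie in one closed
half-plane of the line. -/
theorem lineSide_cases : ∀ F ∈ faceLists, ∀ l ∈ lines,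
    (lineSide l F = true ∧
      0 ≤ formAt l (F.getD 0 0) ∧ 0 ≤ formAt l (F.getD 1 0) ∧ 0 ≤ formAt l (F.getD 2 0)) ∨
    (lineSide l F = false ∧
      formAt l (F.getD 0 0) ≤ 0 ∧ formAt l (F.getD 1 0) ≤ 0 ∧ formAt l (F.getD 2 0) ≤ 0) := by
  decide +kernel

/-- A form of constant sign on the face has a positive part that is the form itself or zero there;
the sign at a point is read off from the values at the three vertices. -/
theorem posPowers_eq_facePowers {F : List ℕ} (hF : F ∈ faceLists) {x y : ℝ} (h : InFace F x y) :
    posPowers x y 1 = facePowers F x y 1 := by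
  obtain ⟨a, b, c, ha, hb, hc, h⟩ := h
  refine List.map_congr_left fun l hl => ?_
  have h12 := linForm_of_hasFaceCoords h l
  rcases lineSide_cases F hF l hl with ⟨hs, h0, h1, h2⟩ | ⟨hs, h0, h1, h2⟩
  · rw [hs, cond_true, powOps_eq, max_eq_left]
    have h0' : (0 : ℝ) ≤ formAt l (F.getD 0 0) := by exact_mod_cast h0
    have h1' : (0 : ℝ) ≤ formAt l (F.getD 1 0) := by exact_mod_cast h1
    have h2' : (0 : ℝ) ≤ formAt l (F.getD 2 0) := by exact_mod_cast h2
    have := mul_nonneg ha h0'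
    have := mul_nonneg hb h1'
    have := mul_nonneg hc h2'
    linarith
  · rw [hs, cond_false, Ops.ofInt_eq, max_eq_right]
    · simp
    have h0' : (formAt l (F.getD 0 0) : ℝ) ≤ 0 := by exact_mod_cast h0
    have h1' : (formAt l (F.getD 1 0) : ℝ) ≤ 0 := by exact_mod_cast h1
    have h2' : (formAt l (F.getD 2 0) : ℝ) ≤ 0 := by exact_mod_cast h2
    have := mul_nonpos_of_nonneg_of_nonpos ha h0'
    have := mul_nonpos_of_nonneg_of_nonpos hb h1'
    have := mul_nonpos_of_nonneg_of_nonpos hc h2'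
    linarith

theorem splineVal_eq_facePiece {F : List ℕ} (hF : F ∈ faceLists) {x y : ℝ} (h : InFace F x y)
    (c : List ℤ) : splineVal c x y = facePiece F c x y := by
  rw [splineVal, facePiece, posPowers_eq_facePowers hF h]

theorem eval2_x (x y : ℝ) : eval2 x y [[], [1]] = x := by
  simp [eval2, evalList_cons, evalList_nil]

theorem eval2_y (x y : ℝ) : eval2 x y [[0, 1]] = y := by
  simp [eval2, evalList_cons, evalList_nil]

theorem eval2_one (x y : ℝ) : eval2 x y [[1]] = 1 := by
  simp [eval2, evalList_cons, evalList_nil]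

theorem eval2_facePolys (F : List ℕ) (c : List ℤ) (x y : ℝ) :
    eval2 x y (linComb c (generators (facePowers F [[], [1]] [[0, 1]] [[1]])
      [[], [1]] [[0, 1]] [[1]])) = facePiece F c x y := by
  have h := opsHom_eval2 x y
  rw [h.linComb, h.generators, h.facePowers, eval2_x, eval2_y, eval2_one, facePiece]

theorem eval2_eq_of_piecesMatch (c : List ℤ) (x y : ℝ) :
    ∀ (Fs : List (List ℕ)) (ps : List (List (List ℤ))),
      piecesMatch ps (Fs.map fun F =>
        generators (facePowers F [[], [1]] [[0, 1]] [[1]]) [[], [1]] [[0, 1]] [[1]]) c = true →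
      ∀ k, k < Fs.length → eval2 x y (ps.getD k []) = facePiece (Fs.getD k []) c x y := by
  intro Fs
  induction Fs with
  | nil => intro ps _ k hk; simp at hk
  | cons F Fs ih =>
    intro ps h k hk
    simp only [List.map_cons, piecesMatch, Bool.and_eq_true] at h
    cases k with
    | zero =>
      have h0 := eval2_eq_zero h.1 x y
      rw [(opsHom_eval2 x y).add, (opsHom_eval2 x y).smul, eval2_facePolys] at h0
      simp only [Ops.add_eq, Ops.smul_eq] at h0
      push_cast at h0
      have h1 : ps.getD 0 [] = ps.headD [] := by cases ps <;> rfl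
      rw [h1, List.getD_cons_zero]
      linarith
    | succ k =>
      have h1 : ps.getD (k + 1) [] = ps.tail.getD k [] := by cases ps <;> simp
      rw [h1, List.getD_cons_succ]
      exact ih _ h.2 k (by simpa using hk)

theorem eval2_pieces {r : Member} (hr : r ∈ allMembers) {k : ℕ} (hk : k < 12) (x y : ℝ) :
    eval2 x y ((pieces 5 r.knots).getD k []) = facePiece (faceLists.getD k []) r.coeffs x y :=
  eval2_eq_of_piecesMatch r.coeffs x y faceLists _
    (List.all_eq_true.1 piecesMatch_members r hr) k hk

theorem eval2_faceForm (f : ℤ × ℤ → ℤ) (F : List ℕ) (s t : ℝ) :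
    eval2 s t (faceForm f F) = s * f (vertexCoords.getD (F.getD 0 0) (0, 0)) +
      t * f (vertexCoords.getD (F.getD 1 0) (0, 0)) + f (vertexCoords.getD (F.getD 2 0) (0, 0)) := by
  simp only [eval2, faceForm, evalList_cons, evalList_nil]
  ring

theorem facePowers_homogeneous (F : List ℕ) (k x y o : ℝ) :
    facePowers F (k * x) (k * y) (k * o) = (facePowers F x y o).map (k ^ 4 * ·) := by
  simp only [facePowers, List.map_map]
  refine List.map_congr_left fun l _ => ?_
  simp only [Function.comp_apply]
  cases lineSide l F
  · simp [Ops.ofInt_eq]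
  · simp only [cond_true, powOps_eq, linForm_eq]; ring

/-- For positive `c`, the polynomial with nonnegative coefficients takes at `(a / c, b / c)` the
value `(12 / c) ^ 5` times the piece. -/
theorem facePiece_nonneg_of_pos {r : Member} (hr : r ∈ allMembers) {F : List ℕ}
    (hF : F ∈ faceLists) {x y a b c : ℝ} (ha : 0 ≤ a) (hb : 0 ≤ b) (hc : 0 < c)
    (h : HasFaceCoords F x y a b c) : 0 ≤ facePiece F r.coeffs x y := by
  have hall := isNonneg2_members
  rw [List.all_map, List.all_eq_true] at hall
  have h0 := eval2_nonneg (List.all_eq_true.1 (hall F hF) r hr) (div_nonneg ha hc.le)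
    (div_nonneg hb hc.le)
  have hom := opsHom_eval2 (a / c) (b / c)
  obtain ⟨h1, h2, h3⟩ := h
  have e1 : eval2 (a / c) (b / c) (faceForm Prod.fst F) = 12 / c * x := by
    rw [eval2_faceForm]; field_simp; linarith
  have e2 : eval2 (a / c) (b / c) (faceForm Prod.snd F) = 12 / c * y := by
    rw [eval2_faceForm]; field_simp; linarith
  have e3 : eval2 (a / c) (b / c) (faceForm (fun _ => 12) F) = 12 / c * 1 := by
    rw [eval2_faceForm]; field_simp; push_cast; linarith
  simp only [faceGenerators] at h0
  -- The common factor `12 / c` of the three arguments comes out as its fifth power.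
  rw [hom.linComb, hom.generators, hom.facePowers, e1, e2, e3, facePowers_homogeneous,
    generators_homogeneous, linComb_map_mul] at h0
  exact nonneg_of_mul_nonneg_right h0 (by positivity)

theorem splineVal_one (b : BasisName) (x y : ℝ) :
    ((members b).map fun r => (r.weight : ℝ) * splineVal r.coeffs x y).sum = 4 := by
  have h := linComb_weightedSum (fun r => r.weight) (members b)
    (generators (posPowers x y 1) x y 1)
  rw [weightedSum_one] at h
  simp only [splineVal]
  rw [← h]
  simp [unitCoeffs, List.range, List.range.loop, generators, monomials, linComb_cons,
    linComb_nil, posPowers, lines, Ops.mul_eq, powOps_eq]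

theorem splineVal_fst (b : BasisName) (x y : ℝ) :
    ((members b).map fun r => (r.weight : ℝ) * r.point.1 * splineVal r.coeffs x y).sum =
      240 * x := by
  have h := linComb_weightedSum (fun r => r.weight * r.point.1) (members b)
    (generators (posPowers x y 1) x y 1)
  rw [weightedSum_fst] at h
  simp only [splineVal]
  push_cast at h
  rw [← h]
  simp [unitCoeffs, List.range, List.range.loop, generators, monomials, linComb_cons,
    linComb_nil, posPowers, lines, Ops.mul_eq, powOps_eq]

theorem splineVal_snd (b : BasisName) (x y : ℝ) :
    ((members b).map fun r => (r.weight : ℝ) * r.point.2 * splineVal r.coeffs x y).sum =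
      240 * y := by
  have h := linComb_weightedSum (fun r => r.weight * r.point.2) (members b)
    (generators (posPowers x y 1) x y 1)
  rw [weightedSum_snd] at h
  simp only [splineVal]
  push_cast at h
  rw [← h]
  simp [unitCoeffs, List.range, List.range.loop, generators, monomials, linComb_cons,
    linComb_nil, posPowers, lines, Ops.mul_eq, powOps_eq]

/-! ### Triangles in the plane -/

theorem mem_convexHull_triple {p q r x : Plane} :
    x ∈ convexHull ℝ {p, q, r} ↔ ∃ a b c : ℝ, 0 ≤ a ∧ 0 ≤ b ∧ 0 ≤ c ∧ a + b + c = 1 ∧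
      x = a • p + b • q + c • r := by
  constructor
  · intro hx
    have hsub : convexHull ℝ {p, q, r} ⊆ {x : Plane | ∃ a b c : ℝ, 0 ≤ a ∧ 0 ≤ b ∧ 0 ≤ c ∧
        a + b + c = 1 ∧ x = a • p + b • q + c • r} := by
      refine convexHull_min ?_ ?_
      · rintro y (rfl | rfl | rfl)
        · exact ⟨1, 0, 0, by simp⟩
        · exact ⟨0, 1, 0, by simp⟩
        · exact ⟨0, 0, 1, by simp⟩
      · rintro y ⟨a, b, c, ha, hb, hc, h1, rfl⟩ z ⟨a', b', c', ha', hb', hc', h1', rfl⟩ s t hs ht hst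
        refine ⟨s * a + t * a', s * b + t * b', s * c + t * c', by positivity, by positivity,
          by positivity, ?_, by module⟩
        linear_combination s * h1 + t * h1' + hst
    exact hsub hx
  · rintro ⟨a, b, c, ha, hb, hc, h1, rfl⟩
    have h := (convex_convexHull ℝ ({p, q, r} : Set Plane)).sum_mem (t := Finset.univ)
      (w := ![a, b, c]) (z := ![p, q, r])
      (by intro i _; fin_cases i <;> simpa)
      (by simpa [Fin.sum_univ_three] using h1)
      (by intro i _; fin_cases i <;> exact subset_convexHull _ _ (by simp))
    simpa [Fin.sum_univ_three] using h

/-- The orientation is the 3 × 3 determinant of the points in homogeneous coordinates, so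
barycentric combinations multiply it by the determinant of their weights. -/
theorem orient_combo (p q r : Plane) {a b c a' b' c' a'' b'' c'' : ℝ} (h : a + b + c = 1)
    (h' : a' + b' + c' = 1) (h'' : a'' + b'' + c'' = 1) :
    orient (a • p + b • q + c • r) (a' • p + b' • q + c' • r) (a'' • p + b'' • q + c'' • r) =
      (a * (b' * c'' - c' * b'') - b * (a' * c'' - c' * a'') + c * (a' * b'' - b' * a'')) *
        orient p q r := by
  obtain rfl : c = 1 - a - b := by linarith
  obtain rfl : c' = 1 - a' - b' := by linarith
  obtain rfl : c'' = 1 - a'' - b'' := by linarith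
  simp only [orient, PiLp.add_apply, PiLp.smul_apply, smul_eq_mul]
  ring

theorem orient_ne_zero {v : Fin 3 → Plane} (hv : AffineIndependent ℝ v) :
    orient (v 0) (v 1) (v 2) ≠ 0 := by
  intro h
  rw [affineIndependent_iff_linearIndependent_vsub ℝ v 0] at hv
  have h01 : ((v 1 0 - v 0 0) * (v 2 1 - v 0 1) - (v 1 1 - v 0 1) * (v 2 0 - v 0 0)) = 0 := h
  have key := Fintype.linearIndependent_iff.1 hv
  let i1 : {x : Fin 3 // x ≠ 0} := ⟨1, by decide⟩
  let i2 : {x : Fin 3 // x ≠ 0} := ⟨2, by decide⟩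
  have huniv : (Finset.univ : Finset {x : Fin 3 // x ≠ 0}) = {i1, i2} := by decide
  have hne : i1 ≠ i2 := by decide
  have hcomb : ∀ a b : ℝ, a • (v 1 - v 0) + b • (v 2 - v 0) = 0 → a = 0 ∧ b = 0 := by
    intro a b hab
    have h := key (fun i => if i = i1 then a else b) (by
      rw [huniv, Finset.sum_pair hne]
      simpa [hne.symm] using hab)
    refine ⟨by simpa using h i1, by simpa [hne.symm] using h i2⟩
  -- The coefficients are cofactors: if the determinant of the edge vectors vanishes, these
  -- combinations of them vanish. The second coefficients then show that the first edge is zero.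
  have e1 := hcomb (v 2 1 - v 0 1) (-(v 1 1 - v 0 1)) (by
    ext l; fin_cases l <;> simp <;> first | ring1 | linear_combination h01)
  have e2 := hcomb (v 2 0 - v 0 0) (-(v 1 0 - v 0 0)) (by
    ext l; fin_cases l <;> simp <;> first | ring1 | linear_combination -h01)
  have h3 : v 1 - v 0 = 0 := by
    ext l; fin_cases l
    · simpa using neg_eq_zero.1 e2.2
    · simpa using neg_eq_zero.1 e1.2
  have := hcomb 1 0 (by simp [h3])
  simp at this

/-- The linear part of the affine map that takes the standard triangle to `p, q, r`. -/
noncomputable def edgeMap (p q r : Plane) : Plane →ₗ[ℝ] Plane :=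
  Matrix.toLin (EuclideanSpace.basisFun (Fin 2) ℝ).toBasis (EuclideanSpace.basisFun (Fin 2) ℝ).toBasis
    !![q 0 - p 0, r 0 - p 0; q 1 - p 1, r 1 - p 1]

theorem det_edgeMap (p q r : Plane) : LinearMap.det (edgeMap p q r) = orient p q r := by
  rw [edgeMap, LinearMap.det_toLin, Matrix.det_fin_two_of, orient]
  ring

theorem edgeMap_single_zero (p q r : Plane) : edgeMap p q r (EuclideanSpace.single 0 1) = q - p := by
  have h := Matrix.toLin_self (EuclideanSpace.basisFun (Fin 2) ℝ).toBasis
    (EuclideanSpace.basisFun (Fin 2) ℝ).toBasis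
    !![q 0 - p 0, r 0 - p 0; q 1 - p 1, r 1 - p 1] 0
  simp only [OrthonormalBasis.coe_toBasis, EuclideanSpace.basisFun_apply, Fin.sum_univ_two] at h
  rw [edgeMap, h]
  ext l; fin_cases l <;> simp

theorem edgeMap_single_one (p q r : Plane) : edgeMap p q r (EuclideanSpace.single 1 1) = r - p := by
  have h := Matrix.toLin_self (EuclideanSpace.basisFun (Fin 2) ℝ).toBasis
    (EuclideanSpace.basisFun (Fin 2) ℝ).toBasis
    !![q 0 - p 0, r 0 - p 0; q 1 - p 1, r 1 - p 1] 1
  simp only [OrthonormalBasis.coe_toBasis, EuclideanSpace.basisFun_apply, Fin.sum_univ_two] at h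
  rw [edgeMap, h]
  ext l; fin_cases l <;> simp

def standardTriangle : Set Plane :=
  convexHull ℝ {0, EuclideanSpace.single 0 1, EuclideanSpace.single 1 1}

theorem convexHull_triple_eq_image (p q r : Plane) :
    convexHull ℝ {p, q, r} = (p + ·) '' (edgeMap p q r '' standardTriangle) := by
  rw [standardTriangle, (edgeMap p q r).image_convexHull]
  have h := (AffineEquiv.constVAdd ℝ Plane p).toAffineMap.image_convexHull
    (edgeMap p q r '' {0, EuclideanSpace.single 0 1, EuclideanSpace.single 1 1})
  have hf : ⇑(AffineEquiv.constVAdd ℝ Plane p).toAffineMap = (p + ·) := by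
    funext x; simp
  rw [hf] at h
  rw [h]
  congr 1
  simp only [Set.image_insert_eq, Set.image_singleton, map_zero, edgeMap_single_zero,
    edgeMap_single_one, add_zero, add_sub_cancel]

/-- The triangle is an affine image of the standard triangle. The area of the latter is never
computed: it cancels from ratios, and only its positivity matters. -/
theorem area_triple (p q r : Plane) :
    area (convexHull ℝ {p, q, r}) = |orient p q r| * area standardTriangle := by
  rw [area, convexHull_triple_eq_image, Set.image_add_left, measure_preimage_add,
    Measure.addHaar_image_linearMap, det_edgeMap, ENNReal.toReal_mul,
    ENNReal.toReal_ofReal (abs_nonneg _), area]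

theorem volume_convexHull_ne_top {s : Set Plane} (hs : s.Finite) :
    volume (convexHull ℝ s) ≠ ⊤ :=
  (hs.isCompact_convexHull ℝ).measure_lt_top.ne

theorem area_standardTriangle_pos : 0 < area standardTriangle := by
  refine ENNReal.toReal_pos (ne_of_gt ?_) (volume_convexHull_ne_top (by simp))
  have hsub : {y : Plane | 0 < y 0 ∧ 0 < y 1 ∧ y 0 + y 1 < 1} ⊆ standardTriangle := by
    rintro y ⟨h0, h1, h2⟩
    refine mem_convexHull_triple.2 ⟨1 - y 0 - y 1, y 0, y 1, by linarith, h0.le, h1.le, by ring, ?_⟩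
    ext l; fin_cases l <;> simp
  have hopen : IsOpen {y : Plane | 0 < y 0 ∧ 0 < y 1 ∧ y 0 + y 1 < 1} := by
    have h0 : Continuous fun y : Plane => y 0 := by fun_prop
    have h1 : Continuous fun y : Plane => y 1 := by fun_prop
    exact (isOpen_lt continuous_const h0).inter
      ((isOpen_lt continuous_const h1).inter (isOpen_lt (h0.add h1) continuous_const))
  refine lt_of_lt_of_le (hopen.measure_pos volume ⟨!₂[1 / 4, 1 / 4], ?_⟩) (measure_mono hsub)
  refine ⟨?_, ?_, ?_⟩ <;> norm_num

/-! ### Barycentric coordinates with respect to the macrotriangle -/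

noncomputable def baryX (v : Fin 3 → Plane) (x : Plane) : ℝ :=
  orient x (v 1) (v 2) / orient (v 0) (v 1) (v 2)

noncomputable def baryY (v : Fin 3 → Plane) (x : Plane) : ℝ :=
  orient (v 0) x (v 2) / orient (v 0) (v 1) (v 2)

/-- The point with given first barycentric coordinates. -/
noncomputable def baryPoint (v : Fin 3 → Plane) (x y : ℝ) : Plane :=
  x • v 0 + y • v 1 + (1 - x - y) • v 2

section

variable {v : Fin 3 → Plane} (hv : AffineIndependent ℝ v)

include hv

theorem baryPoint_bary (x : Plane) : baryPoint v (baryX v x) (baryY v x) = x := by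
  have h := orient_ne_zero hv
  ext l
  simp only [baryPoint, baryX, baryY, PiLp.add_apply, PiLp.smul_apply, smul_eq_mul]
  field_simp
  fin_cases l <;> simp [orient] <;> ring

theorem baryX_baryPoint (x y : ℝ) : baryX v (baryPoint v x y) = x := by
  have h := orient_ne_zero hv
  rw [baryX, div_eq_iff h]
  simp only [baryPoint, orient, PiLp.add_apply, PiLp.smul_apply, smul_eq_mul]
  ring

theorem baryY_baryPoint (x y : ℝ) : baryY v (baryPoint v x y) = y := by
  have h := orient_ne_zero hv
  rw [baryY, div_eq_iff h]
  simp only [baryPoint, orient, PiLp.add_apply, PiLp.smul_apply, smul_eq_mul]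
  ring

end

theorem baryPoint_combo (v : Fin 3 → Plane) {a b c : ℝ} (h : a + b + c = 1)
    (x y x' y' x'' y'' : ℝ) :
    a • baryPoint v x y + b • baryPoint v x' y' + c • baryPoint v x'' y'' =
      baryPoint v (a * x + b * x' + c * x'') (a * y + b * y' + c * y'') := by
  obtain rfl : c = 1 - a - b := by linarith
  simp only [baryPoint]
  module

/-- Twelve times the first two barycentric coordinates of a vertex of the split. -/
def coordsAt (j : ℕ) : ℤ × ℤ := vertexCoords.getD j (0, 0)

theorem vertex_eq_baryPoint (v : Fin 3 → Plane) (j : Fin 10) :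
    vertex v j = baryPoint v ((coordsAt j).1 / 12) ((coordsAt j).2 / 12) := by
  fin_cases j <;> simp [vertex, coordsAt, vertexCoords, baryPoint] <;> module

section

variable {v : Fin 3 → Plane} (hv : AffineIndependent ℝ v)

include hv

theorem baryX_vertex (j : Fin 10) : baryX v (vertex v j) = (coordsAt j).1 / 12 := by
  rw [vertex_eq_baryPoint, baryX_baryPoint hv]

theorem baryY_vertex (j : Fin 10) : baryY v (vertex v j) = (coordsAt j).2 / 12 := by
  rw [vertex_eq_baryPoint, baryY_baryPoint hv]

theorem linForm_vertex (f : ℤ × ℤ × ℤ) (j : Fin 10) :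
    linForm f (baryX v (vertex v j)) (baryY v (vertex v j)) 1 = formAt f j / 12 := by
  rw [baryX_vertex hv, baryY_vertex hv, linForm_eq]
  simp only [formAt, coordsAt]
  push_cast
  ring

theorem mem_triangle {x : Plane} :
    x ∈ triangle v ↔ 0 ≤ baryX v x ∧ 0 ≤ baryY v x ∧ baryX v x + baryY v x ≤ 1 := by
  have hr : Set.range v = {v 0, v 1, v 2} := by
    ext y
    simp only [Set.mem_range, Set.mem_insert_iff, Set.mem_singleton_iff, Fin.exists_fin_succ,
      Fin.exists_fin_zero]
    simp [eq_comm]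
  rw [triangle, hr, mem_convexHull_triple]
  constructor
  · rintro ⟨a, b, c, ha, hb, hc, h1, rfl⟩
    obtain rfl : c = 1 - a - b := by linarith
    have hx := baryX_baryPoint hv a b
    have hy := baryY_baryPoint hv a b
    rw [baryPoint] at hx hy
    rw [hx, hy]
    exact ⟨ha, hb, by linarith⟩
  · rintro ⟨h0, h1, h2⟩
    exact ⟨_, _, 1 - baryX v x - baryY v x, h0, h1, by linarith, by ring,
      (baryPoint_bary hv x).symm⟩

theorem mem_convexHull_vertices {i j k : Fin 10} {x : Plane} :
    x ∈ convexHull ℝ {vertex v i, vertex v j, vertex v k} ↔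
      InFace [i, j, k] (baryX v x) (baryY v x) := by
  rw [mem_convexHull_triple]
  constructor
  · rintro ⟨a, b, c, ha, hb, hc, h1, rfl⟩
    refine ⟨a, b, c, ha, hb, hc, ?_⟩
    rw [vertex_eq_baryPoint v i, vertex_eq_baryPoint v j, vertex_eq_baryPoint v k,
      baryPoint_combo v h1, baryX_baryPoint hv, baryY_baryPoint hv]
    refine ⟨?_, ?_, h1⟩ <;> simp [coordsAt] <;> ring
  · rintro ⟨a, b, c, ha, hb, hc, h1, h2, h3⟩
    refine ⟨a, b, c, ha, hb, hc, h3, ?_⟩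
    rw [vertex_eq_baryPoint v i, vertex_eq_baryPoint v j, vertex_eq_baryPoint v k,
      baryPoint_combo v h3]
    conv_lhs => rw [← baryPoint_bary hv x]
    simp only [List.getD_cons_zero, List.getD_cons_succ] at h1 h2
    congr 1 <;> simp only [coordsAt] <;> linarith

theorem mem_face {k : Fin 12} {x : Plane} :
    x ∈ face v k ↔ InFace (faceLists.getD k []) (baryX v x) (baryY v x) := by
  have h : ∀ i j l : Fin 10, vertex v '' (({i, j, l} : Finset (Fin 10)) : Set (Fin 10)) =
      {vertex v i, vertex v j, vertex v l} := by
    intro i j l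
    simp [Set.image_insert_eq]
  rw [face]
  fin_cases k <;> exact (h _ _ _).symm ▸ mem_convexHull_vertices hv

end

/-- The medians separate the six orderings of the barycentric coordinates `x`, `y`, `z`. The
midlines then decide whether the largest coordinate exceeds the sum of the other two, which gives
twelve cases. -/
theorem exists_inFace {x y : ℝ} (hx : 0 ≤ x) (hy : 0 ≤ y) (hxy : x + y ≤ 1) :
    ∃ k : Fin 12, InFace (faceLists.getD k []) x y := by
  obtain ⟨z, hz⟩ : ∃ z, z = 1 - x - y := ⟨_, rfl⟩
  have aux : ∀ (k : Fin 12) (a b c : ℝ), 0 ≤ a → 0 ≤ b → 0 ≤ c →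
      HasFaceCoords (faceLists.getD k []) x y a b c →
      ∃ k : Fin 12, InFace (faceLists.getD k []) x y :=
    fun k a b c ha hb hc h => ⟨k, a, b, c, ha, hb, hc, h⟩
  rcases le_total x y with h1 | h1 <;> rcases le_total y z with h2 | h2 <;>
    rcases le_total x z with h3 | h3
  · rcases le_total (x + y) z with h4 | h4
    -- As in all regular cases, the face coordinates are multiples of differences that the ordering
    -- makes nonnegative: they solve the linear system given by the vertices of the face.
    · (refine aux 4 (z - x - y) (2 * (y - x)) (4 * x) ?_ ?_ ?_ ⟨?_, ?_, ?_⟩ <;>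
        try simp [faceLists, vertexCoords]) <;> linarith
    · (refine aux 10 (2 * (y - x)) (4 * (z - y)) (3 * (x + y - z)) ?_ ?_ ?_ ⟨?_, ?_, ?_⟩ <;>
        try simp [faceLists, vertexCoords]) <;> linarith
  -- A cyclic chain of inequalities forces `x = y = z`; the barycentre is the third vertex of this
  -- face.
  · (refine aux 6 0 0 1 ?_ ?_ ?_ ⟨?_, ?_, ?_⟩ <;>
        try simp [faceLists, vertexCoords]) <;> linarith
  · rcases le_total (x + z) y with h4 | h4
    · (refine aux 3 (y - x - z) (2 * (z - x)) (4 * x) ?_ ?_ ?_ ⟨?_, ?_, ?_⟩ <;>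
        try simp [faceLists, vertexCoords]) <;> linarith
    · (refine aux 9 (2 * (z - x)) (4 * (y - z)) (3 * (x + z - y)) ?_ ?_ ?_ ⟨?_, ?_, ?_⟩ <;>
        try simp [faceLists, vertexCoords]) <;> linarith
  · rcases le_total (x + z) y with h4 | h4
    · (refine aux 2 (y - x - z) (2 * (x - z)) (4 * z) ?_ ?_ ?_ ⟨?_, ?_, ?_⟩ <;>
        try simp [faceLists, vertexCoords]) <;> linarith
    · (refine aux 8 (2 * (x - z)) (4 * (y - x)) (3 * (x + z - y)) ?_ ?_ ?_ ⟨?_, ?_, ?_⟩ <;>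
        try simp [faceLists, vertexCoords]) <;> linarith
  · rcases le_total (x + y) z with h4 | h4
    · (refine aux 5 (z - x - y) (2 * (x - y)) (4 * y) ?_ ?_ ?_ ⟨?_, ?_, ?_⟩ <;>
        try simp [faceLists, vertexCoords]) <;> linarith
    · (refine aux 11 (2 * (x - y)) (4 * (z - x)) (3 * (x + y - z)) ?_ ?_ ?_ ⟨?_, ?_, ?_⟩ <;>
        try simp [faceLists, vertexCoords]) <;> linarith
  · rcases le_total (y + z) x with h4 | h4
    · (refine aux 0 (x - y - z) (2 * (z - y)) (4 * y) ?_ ?_ ?_ ⟨?_, ?_, ?_⟩ <;>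
        try simp [faceLists, vertexCoords]) <;> linarith
    · (refine aux 6 (2 * (z - y)) (4 * (x - z)) (3 * (y + z - x)) ?_ ?_ ?_ ⟨?_, ?_, ?_⟩ <;>
        try simp [faceLists, vertexCoords]) <;> linarith
  · (refine aux 6 0 0 1 ?_ ?_ ?_ ⟨?_, ?_, ?_⟩ <;>
        try simp [faceLists, vertexCoords]) <;> linarith
  · rcases le_total (y + z) x with h4 | h4
    · (refine aux 1 (x - y - z) (2 * (y - z)) (4 * z) ?_ ?_ ?_ ⟨?_, ?_, ?_⟩ <;>
        try simp [faceLists, vertexCoords]) <;> linarith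
    · (refine aux 7 (2 * (y - z)) (4 * (x - y)) (3 * (y + z - x)) ?_ ?_ ?_ ⟨?_, ?_, ?_⟩ <;>
        try simp [faceLists, vertexCoords]) <;> linarith

theorem exists_mem_halfOpenFace {v : Fin 3 → Plane} (hv : AffineIndependent ℝ v) {x : Plane}
    (hx : x ∈ triangle v) : ∃ k, x ∈ halfOpenFace v k := by
  classical
  obtain ⟨h0, h1, h2⟩ := (mem_triangle hv).1 hx
  obtain ⟨k, hk⟩ := exists_inFace h0 h1 h2
  have hne : (Finset.univ.filter fun k => x ∈ face v k).Nonempty := ⟨k, by simpa [mem_face hv] using hk⟩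
  refine ⟨(Finset.univ.filter fun k => x ∈ face v k).min' hne, ?_, fun l hl hxl => ?_⟩
  · simpa using Finset.min'_mem _ hne
  · exact absurd (Finset.min'_le _ l (by simpa using hxl)) (not_le.2 hl)

theorem halfOpenFace_unique {v : Fin 3 → Plane} {x : Plane} {k l : Fin 12}
    (hk : x ∈ halfOpenFace v k) (hl : x ∈ halfOpenFace v l) : k = l := by
  rcases lt_trichotomy k l with h | h | h
  · exact absurd hk.1 (hl.2 k h)
  · exact h
  · exact absurd hl.1 (hk.2 l h)

theorem mem_halfOpenHull {v : Fin 3 → Plane} {m : Fin 10 → ℕ} {x : Plane} {k : Fin 12}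
    (hk : x ∈ halfOpenFace v k) : x ∈ halfOpenHull v m ↔ face v k ⊆ hull v m := by
  simp only [halfOpenHull, Set.mem_iUnion, Set.mem_ofPred_eq, exists_prop]
  constructor
  · rintro ⟨l, hl, hxl⟩
    rwa [halfOpenFace_unique hk hxl]
  · exact fun h => ⟨k, h, hk⟩

/-! ### Simplex splines are given by their tabulated coefficients -/

theorem natBeq_eq_decide (a b : ℕ) : a.beq b = decide (a = b) := by
  rw [Bool.eq_iff_iff, Nat.beq_eq, decide_eq_true_eq]

def knotsFun (l : List ℕ) : Fin 10 → ℕ := fun j => l.getD j 0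

/-- The determinant of the barycentric coordinates of three vertices, times `12 ^ 3`. -/
def labelDet (i j k : ℕ) : ℤ :=
  let p := coordsAt i
  let q := coordsAt j
  let r := coordsAt k
  p.1 * (q.2 * (12 - r.1 - r.2) - (12 - q.1 - q.2) * r.2) -
    p.2 * (q.1 * (12 - r.1 - r.2) - (12 - q.1 - q.2) * r.1) +
    (12 - p.1 - p.2) * (q.1 * r.2 - q.2 * r.1)

def TripleData.first (t : TripleData) : Fin 10 := Fin.ofNat 10 t.i
def TripleData.second (t : TripleData) : Fin 10 := Fin.ofNat 10 t.j
def TripleData.third (t : TripleData) : Fin 10 := Fin.ofNat 10 t.k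

def TripleData.labels (t : TripleData) : Fin 10 × Fin 10 × Fin 10 := (t.first, t.second, t.third)

/-- The table consists of the non-collinear triples among the first six labels, in the lexicographic
order of `triples`. Hence a search for the first suitable triple gives the same result in both
lists. -/
theorem labels_tripleTable :
    tripleTable.map TripleData.labels =
      triples.filter fun t => decide (t.2.2 < 6 ∧ labelDet t.1 t.2.1 t.2.2 ≠ 0) := by
  decide +kernel

theorem lt_tripleTable : ∀ t ∈ tripleTable, t.i < t.j ∧ t.j < t.k ∧ t.k < 6 := by
  decide +kernel

theorem forms_tripleTable : ∀ t ∈ tripleTable,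
    (t.fi.1 * (coordsAt t.i).1 + t.fj.1 * (coordsAt t.j).1 + t.fk.1 * (coordsAt t.k).1 = 12 ∧
    t.fi.2.1 * (coordsAt t.i).1 + t.fj.2.1 * (coordsAt t.j).1 + t.fk.2.1 * (coordsAt t.k).1 = 0 ∧
    t.fi.2.2 * (coordsAt t.i).1 + t.fj.2.2 * (coordsAt t.j).1 + t.fk.2.2 * (coordsAt t.k).1 = 0) ∧
    (t.fi.1 * (coordsAt t.i).2 + t.fj.1 * (coordsAt t.j).2 + t.fk.1 * (coordsAt t.k).2 = 0 ∧
    t.fi.2.1 * (coordsAt t.i).2 + t.fj.2.1 * (coordsAt t.j).2 + t.fk.2.1 * (coordsAt t.k).2 = 12 ∧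
    t.fi.2.2 * (coordsAt t.i).2 + t.fj.2.2 * (coordsAt t.j).2 + t.fk.2.2 * (coordsAt t.k).2 = 0) ∧
    (t.fi.1 + t.fj.1 + t.fk.1 = 0 ∧ t.fi.2.1 + t.fj.2.1 + t.fk.2.1 = 0 ∧
    t.fi.2.2 + t.fj.2.2 + t.fk.2.2 = 1) := by
  decide +kernel

theorem formAt_tripleTable : ∀ t ∈ tripleTable,
    (formAt t.fi t.i = 12 ∧ formAt t.fi t.j = 0 ∧ formAt t.fi t.k = 0) ∧
    (formAt t.fj t.i = 0 ∧ formAt t.fj t.j = 12 ∧ formAt t.fj t.k = 0) ∧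
    (formAt t.fk t.i = 0 ∧ formAt t.fk t.j = 0 ∧ formAt t.fk t.k = 12) := by
  decide +kernel

theorem ratio_tripleTable : ∀ t ∈ tripleTable, t.ratio * |labelDet t.i t.j t.k| = 1728 := by
  decide +kernel

theorem inside_tripleTable : ∀ t ∈ tripleTable, ∀ k : Fin 12,
    (t.inside.getD k false = true ↔ ∀ j ∈ faceVertices k,
      0 ≤ formAt t.fi j ∧ 0 ≤ formAt t.fj j ∧ 0 ≤ formAt t.fk j) := by
  decide +kernel

theorem inside_length : ∀ t ∈ tripleTable, t.inside.length = 12 := by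
  decide +kernel

theorem val_first {t : TripleData} (ht : t ∈ tripleTable) : (t.first : ℕ) = t.i := by
  have := lt_tripleTable t ht
  simp only [TripleData.first, Fin.ofNat]; lia

theorem val_second {t : TripleData} (ht : t ∈ tripleTable) : (t.second : ℕ) = t.j := by
  have := lt_tripleTable t ht
  simp only [TripleData.second, Fin.ofNat]; lia

theorem val_third {t : TripleData} (ht : t ∈ tripleTable) : (t.third : ℕ) = t.k := by
  have := lt_tripleTable t ht
  simp only [TripleData.third, Fin.ofNat]; lia

/-- Collinearity of vertices and ratios of areas are thus integer data, independent of the triangle;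
`1728 = 12 ^ 3` clears the denominators of three coordinate rows. -/
theorem orient_vertex (v : Fin 3 → Plane) (i j k : Fin 10) :
    orient (vertex v i) (vertex v j) (vertex v k) =
      labelDet i j k / 1728 * orient (v 0) (v 1) (v 2) := by
  rw [vertex_eq_baryPoint, vertex_eq_baryPoint, vertex_eq_baryPoint]
  simp only [baryPoint]
  rw [orient_combo _ _ _ (by ring) (by ring) (by ring)]
  simp only [labelDet]
  push_cast
  ring

theorem mem_triples {i j k : Fin 10} : (i, j, k) ∈ triples ↔ i < j ∧ j < k := by
  simp [triples]

theorem orient_swap_left (p q r : Plane) : orient q p r = -orient p q r := by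
  simp only [orient]; ring

theorem orient_swap_right (p q r : Plane) : orient p r q = -orient p q r := by
  simp only [orient]; ring

/-- The search only sees increasing triples. As the orientation is alternating, these decide all the
others. -/
theorem orient_eq_zero_of_knotTriple {v : Fin 3 → Plane} {m : Fin 10 → ℕ}
    (h : knotTriple v m = none) {i j k : Fin 10} (hi : m i ≠ 0) (hj : m j ≠ 0) (hk : m k ≠ 0) :
    orient (vertex v i) (vertex v j) (vertex v k) = 0 := by
  have key : ∀ i j k : Fin 10, m i ≠ 0 → m j ≠ 0 → m k ≠ 0 → i < j → j < k →
      orient (vertex v i) (vertex v j) (vertex v k) = 0 := by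
    intro i j k hi hj hk hij hjk
    by_contra hne
    have := List.find?_eq_none.1 h (i, j, k) (mem_triples.2 ⟨hij, hjk⟩)
    simp [hi, hj, hk, hne] at this
  have h1 : ∀ p q : Plane, orient p p q = 0 := fun p q => by simp [orient]
  have h2 : ∀ p q : Plane, orient p q q = 0 := fun p q => by simp only [orient]; ring
  have h3 : ∀ p q : Plane, orient p q p = 0 := fun p q => by simp [orient]
  rcases lt_trichotomy i j with hij | rfl | hij
  · rcases lt_trichotomy j k with hjk | rfl | hjk
    · exact key i j k hi hj hk hij hjk
    · exact h2 _ _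
    · rcases lt_trichotomy i k with hik | rfl | hik
      · rw [← neg_eq_zero, ← orient_swap_right]; exact key i k j hi hk hj hik hjk
      · exact h3 _ _
      · rw [← neg_eq_zero, ← orient_swap_right, ← neg_eq_zero, ← orient_swap_left]
        exact key k i j hk hi hj hik hij
  · exact h1 _ _
  · rcases lt_trichotomy i k with hik | rfl | hik
    · rw [← neg_eq_zero, ← orient_swap_left]; exact key j i k hj hi hk hij hik
    · exact h3 _ _
    · rcases lt_trichotomy j k with hjk | rfl | hjk
      · rw [← neg_eq_zero, ← orient_swap_left, ← neg_eq_zero, ← orient_swap_right]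
        exact key j k i hj hk hi hjk hik
      · exact h2 _ _
      · rw [← neg_eq_zero, ← orient_swap_left, ← neg_eq_zero, ← orient_swap_right,
          ← neg_eq_zero, ← orient_swap_left]
        exact key k j i hk hj hi hjk hij

theorem knotTriple_eq {v : Fin 3 → Plane} (hv : AffineIndependent ℝ v) {l : List ℕ}
    (hl : l.length = 6) :
    knotTriple v (knotsFun l) = (locate l).map TripleData.labels := by
  classical
  have h1 : (locate l).map TripleData.labels = (tripleTable.map TripleData.labels).find? fun t =>
      decide (knotsFun l t.1 ≠ 0 ∧ knotsFun l t.2.1 ≠ 0 ∧ knotsFun l t.2.2 ≠ 0) := by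
    rw [List.find?_map, locate]
    congr 1
    refine List.find?_congr fun t ht => ?_
    simp only [Function.comp_apply, TripleData.labels, knotsFun, val_first ht, val_second ht,
      val_third ht]
    rw [Bool.eq_iff_iff]
    simp [and_assoc, natBeq_eq_decide]
  rw [h1, labels_tripleTable, List.find?_filter, knotTriple]
  refine List.find?_congr fun t _ => ?_
  rw [Bool.eq_iff_iff]
  simp only [decide_eq_true_eq, orient_vertex, ne_eq, mul_eq_zero, orient_ne_zero hv, or_false,
    div_eq_zero_iff, Int.cast_eq_zero]
  -- Labels from six on lie beyond the list and have the default multiplicity zero.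
  have h6 : knotsFun l t.2.2 ≠ 0 → t.2.2 < 6 := by
    intro h
    by_contra h'
    refine h (List.getD_eq_default _ _ ?_)
    rw [hl]
    exact not_lt.1 h'
  constructor
  · rintro ⟨a, b, c, d⟩
    exact ⟨⟨h6 c, fun e => d (Or.inl e)⟩, a, b, c⟩
  · rintro ⟨⟨-, d⟩, a, b, c⟩
    exact ⟨a, b, c, by simpa using d⟩

theorem sum_forms {t : TripleData} (ht : t ∈ tripleTable) (x y : ℝ) :
    linForm t.fi x y 1 + linForm t.fj x y 1 + linForm t.fk x y 1 = 1 := by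
  obtain ⟨-, -, h1, h2, h3⟩ := forms_tripleTable t ht
  have h1' : (t.fi.1 + t.fj.1 + t.fk.1 : ℝ) = 0 := by exact_mod_cast h1
  have h2' : (t.fi.2.1 + t.fj.2.1 + t.fk.2.1 : ℝ) = 0 := by exact_mod_cast h2
  have h3' : (t.fi.2.2 + t.fj.2.2 + t.fk.2.2 : ℝ) = 1 := by exact_mod_cast h3
  simp only [linForm_eq]
  linear_combination x * h1' + y * h2' + h3'

section

variable {v : Fin 3 → Plane} (hv : AffineIndependent ℝ v)

include hv

theorem combo_forms {t : TripleData} (ht : t ∈ tripleTable) (x : Plane) :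
    linForm t.fi (baryX v x) (baryY v x) 1 • vertex v t.first +
      linForm t.fj (baryX v x) (baryY v x) 1 • vertex v t.second +
      linForm t.fk (baryX v x) (baryY v x) 1 • vertex v t.third = x := by
  conv_rhs => rw [← baryPoint_bary hv x]
  rw [vertex_eq_baryPoint, vertex_eq_baryPoint, vertex_eq_baryPoint, val_first ht, val_second ht,
    val_third ht, baryPoint_combo v (sum_forms ht _ _)]
  obtain ⟨⟨h1, h2, h3⟩, ⟨h4, h5, h6⟩, -⟩ := forms_tripleTable t ht
  simp only [linForm_eq]
  have h1' := congrArg (Int.cast : ℤ → ℝ) h1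
  have h2' := congrArg (Int.cast : ℤ → ℝ) h2
  have h3' := congrArg (Int.cast : ℤ → ℝ) h3
  have h4' := congrArg (Int.cast : ℤ → ℝ) h4
  have h5' := congrArg (Int.cast : ℤ → ℝ) h5
  have h6' := congrArg (Int.cast : ℤ → ℝ) h6
  push_cast at h1' h2' h3' h4' h5' h6'
  congr 1
  · linear_combination (baryX v x * h1' + baryY v x * h2' + h3') / 12
  · linear_combination (baryX v x * h4' + baryY v x * h5' + h6') / 12

theorem orient_labels_ne_zero {t : TripleData} (ht : t ∈ tripleTable) :
    orient (vertex v t.first) (vertex v t.second) (vertex v t.third) ≠ 0 := by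
  rw [orient_vertex, val_first ht, val_second ht, val_third ht]
  refine mul_ne_zero (div_ne_zero ?_ (by norm_num)) (orient_ne_zero hv)
  intro h
  have h0 : labelDet t.i t.j t.k = 0 := by exact_mod_cast h
  have := ratio_tripleTable t ht
  simp [h0] at this

/-- The tabulated forms express `x` as an affine combination of the three knots (`combo_forms`).
Substituting this into the quotients of orientations gives the forms back, as in Cramer's rule. -/
theorem knotCoeff_eq {l : List ℕ} (hl : l.length = 6) {t : TripleData} (ht : t ∈ tripleTable)
    (hlt : locate l = some t) (x : Plane) :
    knotCoeff v (knotsFun l) x =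
      Pi.single t.first (linForm t.fi (baryX v x) (baryY v x) 1) +
      Pi.single t.second (linForm t.fj (baryX v x) (baryY v x) 1) +
      Pi.single t.third (linForm t.fk (baryX v x) (baryY v x) 1) := by
  have h : knotTriple v (knotsFun l) = some (t.first, t.second, t.third) := by
    rw [knotTriple_eq hv hl, hlt]; rfl
  have hne := orient_labels_ne_zero hv ht
  have hs := sum_forms ht (baryX v x) (baryY v x)
  simp only [knotCoeff, h]
  have hc := combo_forms hv ht x
  set a := linForm t.fi (baryX v x) (baryY v x) 1
  set b := linForm t.fj (baryX v x) (baryY v x) 1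
  set c := linForm t.fk (baryX v x) (baryY v x) 1
  set p := vertex v t.first
  set q := vertex v t.second
  set r := vertex v t.third
  have e1 : orient x q r = a * orient p q r := by
    have := orient_combo p q r hs (a' := 0) (b' := 1) (c' := 0) (a'' := 0) (b'' := 0) (c'' := 1)
      (by norm_num) (by norm_num)
    rw [hc] at this
    simpa using this
  have e2 : orient p x r = b * orient p q r := by
    have := orient_combo p q r (a := 1) (b := 0) (c := 0) (by norm_num) hs (a'' := 0) (b'' := 0)
      (c'' := 1) (by norm_num)
    rw [hc] at this
    simpa using this
  have e3 : orient p q x = c * orient p q r := by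
    have := orient_combo p q r (a := 1) (b := 0) (c := 0) (by norm_num) (a' := 0) (b' := 1)
      (c' := 0) (by norm_num) hs
    rw [hc] at this
    simpa using this
  rw [e1, e2, e3, mul_div_cancel_right₀ _ hne, mul_div_cancel_right₀ _ hne,
    mul_div_cancel_right₀ _ hne]

theorem mem_convexHull_labels {t : TripleData} (ht : t ∈ tripleTable) {x : Plane} :
    x ∈ convexHull ℝ {vertex v t.first, vertex v t.second, vertex v t.third} ↔
      0 ≤ linForm t.fi (baryX v x) (baryY v x) 1 ∧ 0 ≤ linForm t.fj (baryX v x) (baryY v x) 1 ∧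
      0 ≤ linForm t.fk (baryX v x) (baryY v x) 1 := by
  constructor
  · intro hx
    rw [mem_convexHull_vertices hv] at hx
    obtain ⟨a, b, c, ha, hb, hc, h⟩ := hx
    have key := linForm_of_hasFaceCoords h
    simp only [List.getD_cons_zero, List.getD_cons_succ, val_first ht, val_second ht,
      val_third ht] at key
    obtain ⟨⟨h1, h2, h3⟩, ⟨h4, h5, h6⟩, h7, h8, h9⟩ := formAt_tripleTable t ht
    have k1 := key t.fi
    have k2 := key t.fj
    have k3 := key t.fk
    rw [h1, h2, h3] at k1
    rw [h4, h5, h6] at k2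
    rw [h7, h8, h9] at k3
    push_cast at k1 k2 k3
    refine ⟨?_, ?_, ?_⟩ <;> linarith
  · rintro ⟨h1, h2, h3⟩
    exact mem_convexHull_triple.2 ⟨_, _, _, h1, h2, h3, sum_forms ht _ _, (combo_forms hv ht x).symm⟩

/-- By convexity it suffices to test the vertices of the face, where the signs of the three forms
are integer data. -/
theorem face_subset_iff {t : TripleData} (ht : t ∈ tripleTable) (k : Fin 12) :
    face v k ⊆ convexHull ℝ {vertex v t.first, vertex v t.second, vertex v t.third} ↔
      t.inside.getD k false = true := by
  rw [inside_tripleTable t ht, face, (convex_convexHull ℝ _).convexHull_subset_iff,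
    Set.image_subset_iff]
  refine forall₂_congr fun j _ => ?_
  rw [Set.mem_preimage, mem_convexHull_labels hv ht, linForm_vertex hv, linForm_vertex hv,
    linForm_vertex hv]
  have h : ∀ z : ℤ, (0 : ℝ) ≤ z / 12 ↔ 0 ≤ z := by
    intro z
    rw [le_div_iff₀ (by norm_num), zero_mul]
    exact_mod_cast Iff.rfl
  rw [h, h, h]

theorem area_labels {t : TripleData} (ht : t ∈ tripleTable) :
    area (convexHull ℝ {vertex v t.first, vertex v t.second, vertex v t.third}) ≠ 0 ∧
    area (triangle v) / area (convexHull ℝ {vertex v t.first, vertex v t.second, vertex v t.third}) =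
      t.ratio := by
  have hs := area_standardTriangle_pos
  have hne := orient_labels_ne_zero hv ht
  have hr : Set.range v = {v 0, v 1, v 2} := by
    ext y
    simp only [Set.mem_range, Set.mem_insert_iff, Set.mem_singleton_iff, Fin.exists_fin_succ,
      Fin.exists_fin_zero]
    simp [eq_comm]
  rw [triangle, hr, area_triple, area_triple]
  refine ⟨mul_ne_zero (abs_ne_zero.2 hne) hs.ne', ?_⟩
  rw [mul_div_mul_right _ _ hs.ne', div_eq_iff (abs_ne_zero.2 hne), orient_vertex, val_first ht,
    val_second ht, val_third ht, abs_mul, abs_div]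
  have h := congrArg (Int.cast : ℤ → ℝ) (ratio_tripleTable t ht)
  push_cast at h
  have h' : |(1728 : ℝ)| = 1728 := abs_of_pos (by norm_num)
  rw [h']
  linear_combination -|orient (v 0) (v 1) (v 2)| / 1728 * h

end

theorem locate_mem {l : List ℕ} {t : TripleData} (h : locate l = some t) : t ∈ tripleTable :=
  List.mem_of_find?_eq_some h

theorem locate_knots {l : List ℕ} {t : TripleData} (h : locate l = some t) :
    knotsFun l t.first ≠ 0 ∧ knotsFun l t.second ≠ 0 ∧ knotsFun l t.third ≠ 0 := by
  have ht := locate_mem h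
  have := List.find?_some h
  simp only [Bool.and_eq_true, Bool.not_eq_true', natBeq_eq_decide, decide_eq_false_iff_not] at this
  simp only [knotsFun, val_first ht, val_second ht, val_third ht]
  tauto

theorem length_decr (l : List ℕ) (i : ℕ) : (decr l i).length = l.length := by
  induction l generalizing i with
  | nil => rfl
  | cons a l ih => cases i <;> simp [decr, ih]

theorem sum_decr (l : List ℕ) (i : ℕ) (h : l.getD i 0 ≠ 0) : (decr l i).sum + 1 = l.sum := by
  induction l generalizing i with
  | nil => simp at h
  | cons a l ih =>
    cases i with
    | zero =>
      simp only [List.getD_cons_zero] at h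
      simp only [decr, List.sum_cons, Nat.pred_eq_sub_one]
      lia
    | succ i =>
      simp only [List.getD_cons_succ] at h
      simp only [decr, List.sum_cons, ← ih i h]
      lia

theorem getD_decr (l : List ℕ) (i j : ℕ) :
    (decr l i).getD j 0 = l.getD j 0 - if j = i then 1 else 0 := by
  induction l generalizing i j with
  | nil => simp [decr]
  | cons a l ih =>
    cases i with
    | zero => cases j <;> simp [decr]
    | succ i =>
      cases j with
      | zero => simp [decr]
      | succ j => simp only [decr, List.getD_cons_succ, ih, Nat.succ_inj]

theorem knotsFun_decr (l : List ℕ) (i : Fin 10) :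
    knotsFun (decr l i) = knotsFun l - Pi.single i 1 := by
  funext j
  simp only [knotsFun, Pi.sub_apply, Pi.single_apply, getD_decr, Fin.ext_iff]

theorem sum_knotsFun {l : List ℕ} (hl : l.length = 6) : ∑ j, knotsFun l j = l.sum := by
  match l, hl with
  | [a, b, c, d, e, f], _ =>
    simp [Fin.sum_univ_succ, knotsFun]

/-- In degree zero there are three knots counted with multiplicity, so the hull is spanned by three
labels, possibly with repetitions. -/
theorem support_of_sum_eq_three {m : Fin 10 → ℕ} (h : ∑ j, m j = 3) :
    ∃ a b c : Fin 10, {j | m j ≠ 0} = ({a, b, c} : Set (Fin 10)) := by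
  let s := Finsupp.toMultiset (Finsupp.equivFunOnFinite.symm m)
  have hc : s.card = 3 := by
    rw [← h, Finsupp.card_toMultiset]
    exact Finsupp.sum_fintype _ _ fun _ => rfl
  obtain ⟨a, b, c, habc⟩ := Multiset.card_eq_three.1 hc
  refine ⟨a, b, c, ?_⟩
  ext j
  have hj : j ∈ s ↔ m j ≠ 0 := by
    rw [Finsupp.mem_toMultiset, Finsupp.mem_support_iff]; rfl
  rw [Set.mem_ofPred_eq, ← hj, habc]
  simp

theorem eval2_getD_addList (x y : ℝ) (p q : List (List (List ℤ))) (k : ℕ) :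
    eval2 x y ((Ops.add p q).getD k []) = eval2 x y (p.getD k []) + eval2 x y (q.getD k []) := by
  change eval2 x y ((addList p q).getD k []) = _
  induction p generalizing q k with
  | nil => simp [addList, eval2_nil]
  | cons a p ih =>
    cases q with
    | nil => simp [addList, eval2_nil]
    | cons b q =>
      cases k with
      | zero => simp only [addList, List.getD_cons_zero, (opsHom_eval2 x y).add, Ops.add_eq]
      | succ k => simp only [addList, List.getD_cons_succ, ih]

theorem eval2_getD_map_mulForm (x y : ℝ) (f : ℤ × ℤ × ℤ) (p : List (List (List ℤ))) (k : ℕ) :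
    eval2 x y ((p.map (mulForm f)).getD k []) = linForm f x y 1 * eval2 x y (p.getD k []) := by
  -- `mulForm f []` is `[]`, so the default value beyond the end of the list is preserved.
  have h : (p.map (mulForm f)).getD k (mulForm f []) = mulForm f (p.getD k []) := List.getD_map _ _ _
  rw [← eval2_mulForm, ← h]
  rfl

theorem hull_eq {v : Fin 3 → Plane} {m : Fin 10 → ℕ} {a b c : Fin 10}
    (h : {j | m j ≠ 0} = ({a, b, c} : Set (Fin 10))) :
    hull v m = convexHull ℝ {vertex v a, vertex v b, vertex v c} := by
  rw [hull, h, Set.image_insert_eq, Set.image_pair]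

theorem area_hull_ne_zero {v : Fin 3 → Plane} (hv : AffineIndependent ℝ v) {l : List ℕ}
    {t : TripleData} (h : locate l = some t) : area (hull v (knotsFun l)) ≠ 0 := by
  have h1 := (area_labels hv (locate_mem h)).1
  have hsub : convexHull ℝ {vertex v t.first, vertex v t.second, vertex v t.third} ⊆
      hull v (knotsFun l) := by
    refine convexHull_mono ?_
    obtain ⟨k1, k2, k3⟩ := locate_knots h
    rintro y (rfl | rfl | rfl)
    · exact ⟨_, k1, rfl⟩
    · exact ⟨_, k2, rfl⟩
    · exact ⟨_, k3, rfl⟩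
  have hfin : volume (hull v (knotsFun l)) ≠ ⊤ := volume_convexHull_ne_top (Set.toFinite _)
  have hle := ENNReal.toReal_mono hfin (measure_mono hsub)
  have hpos : 0 < area (convexHull ℝ {vertex v t.first, vertex v t.second, vertex v t.third}) :=
    lt_of_le_of_ne ENNReal.toReal_nonneg h1.symm
  exact (lt_of_lt_of_le hpos hle).ne'

/-- Both recursions choose the same triple and the same affine coefficients and remove the same
knots. Fixing the half-open face that contains `x` turns the indicator function in degree zero into
one entry of the table. -/
theorem simplexSpline_eq_eval2_pieces {v : Fin 3 → Plane} (hv : AffineIndependent ℝ v)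
    {x : Plane} {k : Fin 12} (hx : x ∈ halfOpenFace v k) (d : ℕ) (l : List ℕ) (hl : l.length = 6)
    (hs : l.sum = d + 3) :
    simplexSpline v d (knotsFun l) x =
      eval2 (baryX v x) (baryY v x) ((pieces d l).getD k []) := by
  induction d generalizing l with
  | zero =>
    obtain ⟨a, b, c, habc⟩ := support_of_sum_eq_three ((sum_knotsFun hl).trans hs)
    rw [simplexSpline, pieces]
    rcases hlt : locate l with _ | t
    · have hk : knotTriple v (knotsFun l) = none := by rw [knotTriple_eq hv hl, hlt]; rfl
      -- Without a non-collinear triple the three spanning labels are collinear, so the hull has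
      -- area zero.
      have hm : ∀ j ∈ ({a, b, c} : Set (Fin 10)), knotsFun l j ≠ 0 := fun j hj => by
        rw [← habc] at hj; exact hj
      rw [if_pos]
      · simp [eval2_nil]
      · rw [hull_eq habc, area_triple, orient_eq_zero_of_knotTriple hk (hm a (by simp))
          (hm b (by simp)) (hm c (by simp))]
        simp
    · have ht := locate_mem hlt
      obtain ⟨k1, k2, k3⟩ := locate_knots hlt
      -- Three distinct labels of positive multiplicity exhaust a multiset of three elements.
      have hset : {j | knotsFun l j ≠ 0} = ({t.first, t.second, t.third} : Set (Fin 10)) := by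
        have hsub : ({t.first, t.second, t.third} : Finset (Fin 10)) ⊆ {a, b, c} := by
          intro j hj
          have : j ∈ ({a, b, c} : Set (Fin 10)) := by
            rw [← habc]
            simp only [Finset.mem_insert, Finset.mem_singleton] at hj
            rcases hj with rfl | rfl | rfl <;> assumption
          simpa using this
        have hcard : ({t.first, t.second, t.third} : Finset (Fin 10)).card = 3 := by
          obtain ⟨h1, h2, -⟩ := lt_tripleTable t ht
          rw [← val_first ht, ← val_second ht] at h1
          rw [← val_second ht, ← val_third ht] at h2
          rw [Finset.card_eq_three]
          exact ⟨_, _, _, (Fin.lt_def.2 h1).ne, (Fin.lt_def.2 (h1.trans h2)).ne,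
            (Fin.lt_def.2 h2).ne, rfl⟩
        have heq := Finset.eq_of_subset_of_card_le hsub (hcard ▸ Finset.card_le_three)
        rw [habc]
        have := congrArg (fun s : Finset (Fin 10) => (s : Set (Fin 10))) heq
        simpa using this.symm
      classical
      rw [if_neg (area_hull_ne_zero hv hlt), Set.indicator_apply, hull_eq hset,
        (area_labels hv ht).2]
      simp only [mem_halfOpenHull hx, hull_eq hset, face_subset_iff hv ht]
      have hlen : (k : ℕ) < t.inside.length := by rw [inside_length t ht]; exact k.2
      rw [List.getD_eq_getElem _ _ hlen, List.getD_eq_getElem _ _ (by simpa using hlen),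
        List.getElem_map]
      cases t.inside[(k : ℕ)] <;> simp [eval2, evalList_cons, evalList_nil]
  | succ d ih =>
    rw [simplexSpline, pieces]
    rcases hlt : locate l with _ | t
    · have hk : knotTriple v (knotsFun l) = none := by rw [knotTriple_eq hv hl, hlt]; rfl
      -- Without a triple all coefficients are zero, so the value is zero in either branch of the
      -- area test.
      simp [knotCoeff, hk, eval2_nil]
    · have ht := locate_mem hlt
      obtain ⟨k1, k2, k3⟩ := locate_knots hlt
      rw [if_neg (area_hull_ne_zero hv hlt), knotCoeff_eq hv hl ht hlt]
      simp only [Pi.add_apply, add_mul, Finset.sum_add_distrib, Pi.single_apply, ite_mul, zero_mul,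
        Finset.sum_ite_eq', Finset.mem_univ, if_true, eval2_getD_addList, eval2_getD_map_mulForm]
      rw [← knotsFun_decr, ← knotsFun_decr, ← knotsFun_decr, val_first ht, val_second ht,
        val_third ht]
      simp only [knotsFun, val_first ht, val_second ht, val_third ht] at k1 k2 k3
      rw [ih _ (by rw [length_decr, hl]) (by have := sum_decr l _ k1; lia),
        ih _ (by rw [length_decr, hl]) (by have := sum_decr l _ k2; lia),
        ih _ (by rw [length_decr, hl]) (by have := sum_decr l _ k3; lia), add_assoc]

theorem faceLists_getD_mem (k : Fin 12) : faceLists.getD k [] ∈ faceLists := by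
  rw [List.getD_eq_getElem _ _ (by exact k.2)]
  exact List.getElem_mem _

/-- The right side no longer mentions faces: on the macrotriangle the simplex spline does not feel
the assignment of points to half-open faces. -/
theorem simplexSpline_eq_splineVal {v : Fin 3 → Plane} (hv : AffineIndependent ℝ v) {r : Member}
    (hr : r ∈ allMembers) {x : Plane} (hx : x ∈ triangle v) :
    simplexSpline v 5 (knotsFun r.knots) x = splineVal r.coeffs (baryX v x) (baryY v x) := by
  obtain ⟨k, hk⟩ := exists_mem_halfOpenFace hv hx
  have h := List.all_eq_true.1 knotsOK_members r hr
  simp only [knotsOK, Bool.and_eq_true, Nat.beq_eq] at h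
  rw [simplexSpline_eq_eval2_pieces hv hk 5 _ h.1 h.2, eval2_pieces hr k.2,
    splineVal_eq_facePiece (faceLists_getD_mem k) ((mem_face hv).1 hk.1)]

/-! ### Smoothness -/

theorem hasDerivAt_max_zero_pow (n : ℕ) (t : ℝ) :
    HasDerivAt (fun s : ℝ => max s 0 ^ (n + 2)) ((n + 2) * max t 0 ^ (n + 1)) t := by
  rcases lt_trichotomy t 0 with h | rfl | h
  · have h0 : (n + 2) * max t 0 ^ (n + 1) = (0 : ℝ) := by simp [max_eq_right h.le]
    rw [h0]
    refine (hasDerivAt_const t (0 : ℝ)).congr_of_eventuallyEq ?_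
    filter_upwards [gt_mem_nhds h] with s hs
    simp [max_eq_right hs.le]
  · simp only [max_self, ne_eq, Nat.add_eq_zero_iff, one_ne_zero, and_false, not_false_eq_true,
      zero_pow, mul_zero]
    rw [hasDerivAt_iff_isLittleO_nhds_zero]
    -- At the kink the increment is at most `|h| ^ (n + 2)`, which is `o(h)`.
    have hO : (fun h : ℝ => max (0 + h) 0 ^ (n + 2) - max 0 0 ^ (n + 2) - h • (0 : ℝ)) =O[nhds 0]
        fun h : ℝ => h ^ (n + 2) := by
      refine Asymptotics.IsBigO.of_bound 1 (Filter.Eventually.of_forall fun h => ?_)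
      simp only [zero_add, max_self, ne_eq, Nat.add_eq_zero_iff, OfNat.ofNat_ne_zero,
        and_false, not_false_eq_true, zero_pow, sub_zero, smul_zero, norm_pow, one_mul]
      refine pow_le_pow_left₀ (norm_nonneg _) ?_ _
      rw [Real.norm_eq_abs, Real.norm_eq_abs, abs_of_nonneg (le_max_right _ _)]
      exact max_le (le_abs_self h) (abs_nonneg h)
    exact hO.trans_isLittleO (by simpa using Asymptotics.isLittleO_pow_id (𝕜 := ℝ) (n := n + 2) (by lia))
  · have h0 : max t 0 = t := max_eq_left h.le
    have := hasDerivAt_pow (n + 2) t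
    rw [h0]
    push_cast at this
    refine HasDerivAt.congr_of_eventuallyEq (f := fun s : ℝ => s ^ (n + 2)) this ?_
    filter_upwards [lt_mem_nhds h] with s hs
    simp [max_eq_left hs.le]

/-- By induction: differentiation lowers the exponent by one and costs one order of smoothness, and
exponent one is continuous. -/
theorem contDiff_max_zero_pow (n : ℕ) : ContDiff ℝ n fun s : ℝ => max s 0 ^ (n + 1) := by
  induction n with
  | zero => exact contDiff_zero.2 (by fun_prop)
  | succ n ih =>
    have hd : deriv (fun s : ℝ => max s 0 ^ (n + 1 + 1)) = fun t : ℝ => ((n : ℝ) + 2) * max t 0 ^ (n + 1) :=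
      funext fun t => (hasDerivAt_max_zero_pow n t).deriv
    push_cast
    refine contDiff_succ_iff_deriv.2
      ⟨fun t => (hasDerivAt_max_zero_pow n t).differentiableAt, by simp, ?_⟩
    rw [hd]
    exact contDiff_const.mul ih

/-- The functions of class `C³`. -/
def contDiffSubring : Subring (Plane → ℝ) where
  carrier := {f | ContDiff ℝ 3 f}
  mul_mem' hf hg := by
    rw [Set.mem_ofPred_eq] at *
    exact hf.mul hg
  one_mem' := by
    rw [Set.mem_ofPred_eq]
    exact contDiff_const
  add_mem' hf hg := by
    rw [Set.mem_ofPred_eq] at *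
    exact hf.add hg
  zero_mem' := by
    rw [Set.mem_ofPred_eq]
    exact contDiff_const
  neg_mem' hf := by
    rw [Set.mem_ofPred_eq] at *
    exact hf.neg

theorem mem_monomials {R : Type*} [CommRing R] {x y o g : R} (h : g ∈ monomials x y o) :
    ∃ i j : ℕ, i + j ≤ 5 ∧ g = x ^ i * (y ^ j * o ^ (5 - i - j)) := by
  simp only [monomials, List.mem_flatMap, List.mem_map, List.mem_range, Ops.mul_eq,
    powOps_eq] at h
  obtain ⟨i, hi, j, hj, rfl⟩ := h
  exact ⟨i, j, by lia, rfl⟩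

theorem linComb_generators_mem {R : Type*} [CommRing R] (A : Subring R) {t : List R} {x y o : R}
    (ht : ∀ s ∈ t, s ∈ A) (hx : x ∈ A) (hy : y ∈ A) (ho : o ∈ A) (c : List ℤ) :
    linComb c (generators t x y o) ∈ A := by
  have hg : ∀ g ∈ generators t x y o, g ∈ A := by
    intro g hg
    rw [generators, List.mem_append] at hg
    rcases hg with hg | hg
    · obtain ⟨i, j, -, rfl⟩ := mem_monomials hg
      exact A.mul_mem (A.pow_mem hx _) (A.mul_mem (A.pow_mem hy _) (A.pow_mem ho _))
    · simp only [List.mem_flatMap, List.mem_cons, List.not_mem_nil, or_false, Ops.mul_eq] at hg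
      obtain ⟨s, hs, rfl | rfl | rfl⟩ := hg
      · exact A.mul_mem (ht s hs) ho
      · exact A.mul_mem (ht s hs) hx
      · exact A.mul_mem (ht s hs) hy
  generalize generators t x y o = l at hg
  induction c generalizing l with
  | nil => rw [linComb_nil]; exact A.zero_mem
  | cons a c ih =>
    cases l with
    | nil => rw [linComb_nil_right]; exact A.zero_mem
    | cons g l =>
      rw [linComb_cons]
      exact A.add_mem (A.mul_mem (intCast_mem A a) (hg g (by simp)))
        (ih l fun g' h' => hg g' (by simp [h']))

theorem contDiff_baryX (v : Fin 3 → Plane) : ContDiff ℝ 3 (baryX v) := by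
  unfold baryX orient
  fun_prop

theorem contDiff_baryY (v : Fin 3 → Plane) : ContDiff ℝ 3 (baryY v) := by
  unfold baryY orient
  fun_prop

/-- The spline is formed by ring operations from functions of class `C³`, which make up a subring.
-/
theorem contDiff_splineVal (v : Fin 3 → Plane) (c : List ℤ) :
    ContDiff ℝ 3 fun x => splineVal c (baryX v x) (baryY v x) := by
  let t : List (Plane → ℝ) := lines.map fun l => fun x => max (linForm l (baryX v x) (baryY v x) 1) 0 ^ 4
  have hmem : linComb c (generators t (baryX v) (baryY v) 1) ∈ contDiffSubring := by
    refine linComb_generators_mem _ ?_ (contDiff_baryX v) (contDiff_baryY v) (Subring.one_mem _) c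
    intro s hs
    obtain ⟨l, -, rfl⟩ := List.mem_map.1 hs
    have h3 : ContDiff ℝ 3 fun s : ℝ => max s 0 ^ 4 := contDiff_max_zero_pow 3
    refine h3.comp ?_
    simp only [linForm_eq]
    exact ((contDiff_const.mul (contDiff_baryX v)).add
      (contDiff_const.mul (contDiff_baryY v))).add contDiff_const
  have heq : (fun x => splineVal c (baryX v x) (baryY v x)) =
      linComb c (generators t (baryX v) (baryY v) 1) := by
    funext x
    -- Evaluation at a point is a ring homomorphism, so it carries the combination of functions to
    -- the pointwise combination.
    have hom := OpsHom.ringHom (Pi.evalRingHom (fun _ : Plane => ℝ) x)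
    have h := hom.linComb c (generators t (baryX v) (baryY v) 1)
    rw [hom.generators] at h
    simp only [Pi.evalRingHom_apply, t, List.map_map] at h
    rw [h, splineVal, posPowers]
    rfl
  rw [heq]
  exact hmem

/-! ### Polynomial pieces -/

theorem totalDegree_linComb_le {σ : Type*} {n : ℕ} {l : List (MvPolynomial σ ℝ)}
    (h : ∀ g ∈ l, g.totalDegree ≤ n) (c : List ℤ) : (linComb c l).totalDegree ≤ n := by
  induction c generalizing l with
  | nil => rw [linComb_nil]; simp
  | cons a c ih =>
    cases l with
    | nil => rw [linComb_nil_right]; simp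
    | cons g l =>
      rw [linComb_cons]
      refine (MvPolynomial.totalDegree_add _ _).trans (max_le ?_ (ih fun g' h' => h g' (by simp [h'])))
      refine (MvPolynomial.totalDegree_mul _ _).trans ?_
      have : ((a : MvPolynomial σ ℝ)).totalDegree = 0 := by
        rw [← map_intCast (MvPolynomial.C : ℝ →+* MvPolynomial σ ℝ), MvPolynomial.totalDegree_C]
      rw [this, zero_add]
      exact h g (by simp)

theorem totalDegree_pow_le {σ : Type*} {p : MvPolynomial σ ℝ} (hp : p.totalDegree ≤ 1) (n : ℕ) :
    (p ^ n).totalDegree ≤ n :=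
  (MvPolynomial.totalDegree_pow p n).trans (by nlinarith)

theorem totalDegree_linForm_le {σ : Type*} {x y o : MvPolynomial σ ℝ} (hx : x.totalDegree ≤ 1)
    (hy : y.totalDegree ≤ 1) (ho : o.totalDegree ≤ 1) (l : ℤ × ℤ × ℤ) :
    (linForm l x y o).totalDegree ≤ 1 := by
  have h : linForm l x y o = linComb [l.1, l.2.1, l.2.2] [x, y, o] := by
    simp only [linForm_eq, linComb_cons, linComb_nil]; ring
  rw [h]
  refine totalDegree_linComb_le ?_ _
  simp [hx, hy, ho]

theorem totalDegree_generators_le {σ : Type*} {x y o : MvPolynomial σ ℝ} (hx : x.totalDegree ≤ 1)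
    (hy : y.totalDegree ≤ 1) (ho : o.totalDegree ≤ 1) (F : List ℕ) :
    ∀ g ∈ generators (facePowers F x y o) x y o, g.totalDegree ≤ 5 := by
  intro g hg
  rw [generators, List.mem_append] at hg
  rcases hg with hg | hg
  · obtain ⟨i, j, hij, rfl⟩ := mem_monomials hg
    have h1 := totalDegree_pow_le hx i
    have h2 := totalDegree_pow_le hy j
    have h3 := totalDegree_pow_le ho (5 - i - j)
    have h4 := MvPolynomial.totalDegree_mul (x ^ i) (y ^ j * o ^ (5 - i - j))
    have h5 := MvPolynomial.totalDegree_mul (y ^ j) (o ^ (5 - i - j))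
    lia
  · have ht : ∀ s ∈ facePowers F x y o, s.totalDegree ≤ 4 := by
      intro s hs
      obtain ⟨l, -, rfl⟩ := List.mem_map.1 hs
      cases lineSide l F
      · simp [Ops.ofInt_eq]
      · rw [cond_true, powOps_eq]
        exact totalDegree_pow_le (totalDegree_linForm_le hx hy ho l) 4
    simp only [List.mem_flatMap, List.mem_cons, List.not_mem_nil, or_false, Ops.mul_eq] at hg
    obtain ⟨s, hs, rfl | rfl | rfl⟩ := hg
    · exact (MvPolynomial.totalDegree_mul _ _).trans (add_le_add (ht s hs) ho)
    · exact (MvPolynomial.totalDegree_mul _ _).trans (add_le_add (ht s hs) hx)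
    · exact (MvPolynomial.totalDegree_mul _ _).trans (add_le_add (ht s hs) hy)

/-- An affine function as a polynomial. -/
theorem exists_affine_polynomial {f : Plane → ℝ} (a b c : ℝ) (hf : ∀ x, f x = a * x 0 + b * x 1 + c) :
    ∃ p : MvPolynomial (Fin 2) ℝ, p.totalDegree ≤ 1 ∧
      ∀ x : Plane, f x = MvPolynomial.eval (fun i => x i) p := by
  refine ⟨MvPolynomial.C a * MvPolynomial.X 0 + MvPolynomial.C b * MvPolynomial.X 1 +
    MvPolynomial.C c, ?_, fun x => by simp [hf]⟩
  refine (MvPolynomial.totalDegree_add _ _).trans (max_le ((MvPolynomial.totalDegree_add _ _).trans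
    (max_le ?_ ?_)) ?_)
  · exact (MvPolynomial.totalDegree_mul _ _).trans (by simp)
  · exact (MvPolynomial.totalDegree_mul _ _).trans (by simp)
  · simp

/-- On a face the positive parts are gone. The same combination, formed in the polynomial ring from
affine polynomials for `x` and `y`, evaluates to the piece and has degree at most 5. -/
theorem exists_polynomial_facePiece (v : Fin 3 → Plane) (F : List ℕ) (c : List ℤ) :
    ∃ p : MvPolynomial (Fin 2) ℝ, p.totalDegree ≤ 5 ∧
      ∀ x : Plane, facePiece F c (baryX v x) (baryY v x) = MvPolynomial.eval (fun i => x i) p := by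
  obtain ⟨X, hX, hX'⟩ := exists_affine_polynomial (f := baryX v)
    ((v 1 1 - v 2 1) / orient (v 0) (v 1) (v 2)) ((v 2 0 - v 1 0) / orient (v 0) (v 1) (v 2))
    ((v 1 0 * v 2 1 - v 1 1 * v 2 0) / orient (v 0) (v 1) (v 2))
    (fun x => by simp only [baryX]; rw [orient]; ring)
  obtain ⟨Y, hY, hY'⟩ := exists_affine_polynomial (f := baryY v)
    ((v 2 1 - v 0 1) / orient (v 0) (v 1) (v 2)) ((v 0 0 - v 2 0) / orient (v 0) (v 1) (v 2))
    ((v 2 0 * v 0 1 - v 2 1 * v 0 0) / orient (v 0) (v 1) (v 2))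
    (fun x => by simp only [baryY]; rw [orient]; ring)
  refine ⟨linComb c (generators (facePowers F X Y 1) X Y 1),
    totalDegree_linComb_le (totalDegree_generators_le hX hY (by simp) F) c, fun x => ?_⟩
  have hom := OpsHom.ringHom (MvPolynomial.eval fun i => x i)
  rw [hom.linComb, hom.generators, hom.facePowers, ← hX', ← hY', map_one, facePiece]

/-! ### Positivity -/

/-- Where the third face coordinate vanishes, `facePiece_nonneg_of_pos` does not apply. Moving the
point towards the third vertex of the face makes this coordinate positive, and continuity yields the
limit. -/
theorem splineVal_nonneg {v : Fin 3 → Plane} (hv : AffineIndependent ℝ v) {r : Member}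
    (hr : r ∈ allMembers) {x : Plane} (hx : x ∈ triangle v) :
    0 ≤ splineVal r.coeffs (baryX v x) (baryY v x) := by
  obtain ⟨h0, h1, h2⟩ := (mem_triangle hv).1 hx
  obtain ⟨k, hk⟩ := exists_inFace h0 h1 h2
  set F := faceLists.getD k [] with hF
  have hFm : F ∈ faceLists := faceLists_getD_mem k
  obtain ⟨a, b, c, ha, hb, hc, hx1, hy1, hs⟩ := hk
  set q := vertexCoords.getD (F.getD 2 0) (0, 0) with hq
  -- The path starts at `x` for `e = 0` and reaches the third vertex at `e = 1`; in between its
  -- third coordinate is `(1 - e) * c + e > 0`.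
  let X : ℝ → ℝ := fun e => (1 - e) * baryX v x + e * (q.1 / 12)
  let Y : ℝ → ℝ := fun e => (1 - e) * baryY v x + e * (q.2 / 12)
  have hpos : ∀ e : ℝ, 0 < e → e < 1 → 0 ≤ splineVal r.coeffs (X e) (Y e) := by
    intro e he he1
    have hcoords : HasFaceCoords F (X e) (Y e) ((1 - e) * a) ((1 - e) * b) ((1 - e) * c + e) := by
      refine ⟨?_, ?_, ?_⟩
      · simp only [X]; rw [← hq]; linear_combination (1 - e) * hx1
      · simp only [Y]; rw [← hq]; linear_combination (1 - e) * hy1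
      · linear_combination (1 - e) * hs
    have he2 : 0 < 1 - e := by linarith
    have hc' : 0 < (1 - e) * c + e := by positivity
    rw [splineVal_eq_facePiece hFm ⟨_, _, _, by positivity, by positivity, hc'.le, hcoords⟩]
    exact facePiece_nonneg_of_pos hr hFm (by positivity) (by positivity) hc' hcoords
  have hcont : Continuous fun e => splineVal r.coeffs (X e) (Y e) := by
    have hp : Continuous fun e => baryPoint v (X e) (Y e) := by
      simp only [baryPoint, X, Y]; fun_prop
    have := (contDiff_splineVal v r.coeffs).continuous.comp hp
    simpa only [Function.comp_def, baryX_baryPoint hv, baryY_baryPoint hv] using this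
  have hlim : Filter.Tendsto (fun e => splineVal r.coeffs (X e) (Y e)) (nhdsWithin 0 (Set.Ioi 0))
      (nhds (splineVal r.coeffs (baryX v x) (baryY v x))) := by
    have := (hcont.tendsto 0).mono_left (nhdsWithin_le_nhds (s := Set.Ioi 0))
    simpa [X, Y] using this
  refine ge_of_tendsto hlim ?_
  filter_upwards [Ioo_mem_nhdsGT (zero_lt_one (α := ℝ))] with e he
  exact hpos e he.1 he.2

/-! ### The bases -/

theorem members_subset (b : BasisName) {r : Member} (h : r ∈ members b) : r ∈ allMembers := by
  cases b <;> simp only [members, allMembers, List.mem_append] at h ⊢ <;> tauto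

/-- A list of 39 entries whose underlying set has 39 elements has no repetitions. Hence an entry
determines its tabulated data. -/
theorem nodup_map_entry (b : BasisName) : ((members b).map Member.entry).Nodup := by
  rw [← Multiset.coe_nodup, ← Multiset.toFinset_card_eq_card_iff_nodup, Multiset.coe_card,
    List.length_map, length_members, ← card_entries b, entries_eq_members]
  rfl

theorem exists_member (b : BasisName) (s : Index b) : ∃ r ∈ members b, r.entry = s.1 := by
  have h : s.1 ∈ ((members b).map Member.entry).toFinset := entries_eq_members b ▸ s.2
  rwa [List.mem_toFinset, List.mem_map] at h

/-- The tabulated data of a basis function. -/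
noncomputable def memberOf (b : BasisName) (s : Index b) : Member := (exists_member b s).choose

theorem memberOf_mem (b : BasisName) (s : Index b) : memberOf b s ∈ members b :=
  (exists_member b s).choose_spec.1

theorem entry_memberOf (b : BasisName) (s : Index b) : (memberOf b s).entry = s.1 :=
  (exists_member b s).choose_spec.2

theorem memberOf_eq (b : BasisName) {s : Index b} {r : Member} (hr : r ∈ members b)
    (h : r.entry = s.1) : memberOf b s = r :=
  List.inj_on_of_nodup_map (nodup_map_entry b) (memberOf_mem b s) hr
    ((entry_memberOf b s).trans h.symm)

theorem entry_mem (b : BasisName) {r : Member} (hr : r ∈ members b) : r.entry ∈ entries b := by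
  rw [entries_eq_members, List.mem_toFinset]
  exact List.mem_map_of_mem hr

theorem sum_memberOf (b : BasisName) (g : Member → ℝ) :
    ∑ s : Index b, g (memberOf b s) = ((members b).map g).sum := by
  classical
  have hinj := List.inj_on_of_nodup_map (nodup_map_entry b)
  have hnd : (members b).Nodup := List.Nodup.of_map _ (nodup_map_entry b)
  have h1 : ((members b).map g).sum = ∑ r : {r // r ∈ (members b).toFinset}, g r := by
    rw [← List.sum_toFinset g hnd, ← Finset.sum_coe_sort]
  rw [h1]
  refine Finset.sum_bij (fun s _ => ⟨memberOf b s, by simpa using memberOf_mem b s⟩)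
    (fun _ _ => Finset.mem_univ _) ?_ ?_ (fun _ _ => rfl)
  · intro s _ t _ h
    have h' : memberOf b s = memberOf b t := congrArg Subtype.val h
    exact Subtype.ext (by rw [← entry_memberOf b s, ← entry_memberOf b t, h'])
  · rintro ⟨r, hr⟩ _
    have hr' : r ∈ members b := by simpa using hr
    exact ⟨⟨r.entry, entry_mem b hr'⟩, Finset.mem_univ _, Subtype.ext (memberOf_eq b hr' rfl)⟩

/-- A basis function as a function on the whole plane. -/
noncomputable def smoothBasis (b : BasisName) (v : Fin 3 → Plane) (s : Index b) (x : Plane) : ℝ :=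
  (memberOf b s).weight / 4 * splineVal (memberOf b s).coeffs (baryX v x) (baryY v x)

theorem basisSpline_eq {v : Fin 3 → Plane} (hv : AffineIndependent ℝ v) (b : BasisName)
    (s : Index b) {x : Plane} (hx : x ∈ triangle v) : basisSpline b v s x = smoothBasis b v s x := by
  have h := simplexSpline_eq_splineVal hv (members_subset b (memberOf_mem b s)) hx
  have h1 : s.1.1 = knotsFun (memberOf b s).knots := by rw [← entry_memberOf b s]; rfl
  have h2 : (s.1.2.1 : ℝ) = (memberOf b s).weight / 4 := by
    rw [← entry_memberOf b s]
    simp [Member.entry]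
  rw [basisSpline, h1, h, h2, smoothBasis]

theorem smoothBasis_nonneg {v : Fin 3 → Plane} (hv : AffineIndependent ℝ v) (b : BasisName)
    (s : Index b) {x : Plane} (hx : x ∈ triangle v) : 0 ≤ smoothBasis b v s x := by
  have hr := members_subset b (memberOf_mem b s)
  have hw := List.all_eq_true.1 weight_members _ hr
  rw [decide_eq_true_eq] at hw
  have hw' : (0 : ℝ) ≤ (memberOf b s).weight := by exact_mod_cast hw
  exact mul_nonneg (by positivity) (splineVal_nonneg hv hr hx)

/-- The reproduction of functions that are affine in the barycentric coordinates. -/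
theorem sum_affine_mul_smoothBasis (b : BasisName) (v : Fin 3 → Plane) (p q r : ℝ) (x : Plane) :
    ∑ s, (p + q * ((memberOf b s).point.1 / 60) + r * ((memberOf b s).point.2 / 60)) *
      smoothBasis b v s x = p + q * baryX v x + r * baryY v x := by
  have e : ∀ s, (p + q * ((memberOf b s).point.1 / 60) + r * ((memberOf b s).point.2 / 60)) *
      smoothBasis b v s x =
      p / 4 * ((memberOf b s).weight * splineVal (memberOf b s).coeffs (baryX v x) (baryY v x)) +
      q / 240 * ((memberOf b s).weight * (memberOf b s).point.1 *
        splineVal (memberOf b s).coeffs (baryX v x) (baryY v x)) +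
      r / 240 * ((memberOf b s).weight * (memberOf b s).point.2 *
        splineVal (memberOf b s).coeffs (baryX v x) (baryY v x)) := by
    intro s
    rw [smoothBasis]
    ring
  simp only [e, Finset.sum_add_distrib, ← Finset.mul_sum]
  rw [sum_memberOf b fun r => r.weight * splineVal r.coeffs (baryX v x) (baryY v x),
    sum_memberOf b fun r => r.weight * r.point.1 * splineVal r.coeffs (baryX v x) (baryY v x),
    sum_memberOf b fun r => r.weight * r.point.2 * splineVal r.coeffs (baryX v x) (baryY v x),
    splineVal_one, splineVal_fst, splineVal_snd]
  ring

theorem sum_smoothBasis (b : BasisName) (v : Fin 3 → Plane) (x : Plane) :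
    ∑ s, smoothBasis b v s x = 1 := by
  simpa using sum_affine_mul_smoothBasis b v 1 0 0 x

/-! ### The domain points -/

theorem sum_dual_smul_vertex (v : Fin 3 → Plane) (r : Member) (h : r.dual.length = 10)
    (hs : r.dual.sum = 5) :
    (1 / 5 : ℝ) • ∑ j : Fin 10, ((r.dual.getD j 0 : ℕ) : ℝ) • vertex v j =
      baryPoint v (r.point.1 / 60) (r.point.2 / 60) := by
  obtain ⟨l, w, d, c⟩ := r
  simp only [Member.point] at *
  match d, h with
  | [d0, d1, d2, d3, d4, d5, d6, d7, d8, d9], _ =>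
    have hs' : (d0 + d1 + d2 + d3 + d4 + d5 + d6 + d7 + d8 + d9 : ℝ) = 5 := by
      simp only [List.sum_cons, List.sum_nil] at hs
      norm_cast
      lia
    -- There are five dual points. Eliminating the last multiplicity is needed for the weight of `v
    -- 2`, which is one minus the other two.
    obtain hd : (d9 : ℝ) = 5 - (d0 + d1 + d2 + d3 + d4 + d5 + d6 + d7 + d8) := by linarith
    simp only [Fin.sum_univ_succ, Fin.sum_univ_zero, vertexCoords, List.zip_cons_cons,
      List.zip_nil_right, List.foldr_cons, List.foldr_nil, vertex_eq_baryPoint, coordsAt]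
    simp [hd, baryPoint]
    module

theorem domainPoint_eq (b : BasisName) (v : Fin 3 → Plane) (s : Index b) :
    domainPoint b v s =
      baryPoint v ((memberOf b s).point.1 / 60) ((memberOf b s).point.2 / 60) := by
  have hr := members_subset b (memberOf_mem b s)
  have h1 := List.all_eq_true.1 length_dual_members _ hr
  have h2 := List.all_eq_true.1 sum_dual_members _ hr
  rw [Nat.beq_eq] at h1 h2
  rw [← sum_dual_smul_vertex v _ h1 h2, domainPoint, ← entry_memberOf b s]
  rfl

theorem point_bounds : (allMembers.all fun r =>
    decide (0 ≤ r.point.1 ∧ 0 ≤ r.point.2 ∧ r.point.1 + r.point.2 ≤ 60)) = true := by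
  decide +kernel

theorem domainPoint_mem {v : Fin 3 → Plane} (hv : AffineIndependent ℝ v) (b : BasisName)
    (s : Index b) : domainPoint b v s ∈ triangle v := by
  have h := List.all_eq_true.1 point_bounds _ (members_subset b (memberOf_mem b s))
  rw [decide_eq_true_eq] at h
  obtain ⟨h1, h2, h3⟩ := h
  have h1' : (0 : ℝ) ≤ (memberOf b s).point.1 := by exact_mod_cast h1
  have h2' : (0 : ℝ) ≤ (memberOf b s).point.2 := by exact_mod_cast h2
  have h3' : ((memberOf b s).point.1 + (memberOf b s).point.2 : ℝ) ≤ 60 := by exact_mod_cast h3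
  rw [mem_triangle hv, domainPoint_eq, baryX_baryPoint hv, baryY_baryPoint hv]
  exact ⟨by positivity, by positivity, by linarith⟩

/-! ### The collocation matrix -/

/-- The collocation matrix, which does not depend on the triangle. -/
noncomputable def collocationMatrix (b : BasisName) : Matrix (Index b) (Index b) ℝ :=
  Matrix.of fun i j => (memberOf b j).weight / 4 *
    splineVal (memberOf b j).coeffs ((memberOf b i).point.1 / 60) ((memberOf b i).point.2 / 60)

/-- The domain points lie in the macrotriangle and have fixed barycentric coordinates. This is why
the norm of the inverse is the same for all triangles. -/
theorem collocation_eq {v : Fin 3 → Plane} (hv : AffineIndependent ℝ v) (b : BasisName) :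
    collocation b v = collocationMatrix b := by
  ext i j
  rw [collocation, Matrix.of_apply, basisSpline_eq hv b j (domainPoint_mem hv b i), smoothBasis,
    domainPoint_eq, baryX_baryPoint hv, baryY_baryPoint hv]
  rfl

theorem dotNat_eq (l m : List ℕ) :
    dotNat l m = ∑ k ∈ Finset.range l.length, l.getD k 0 * m.getD k 0 := by
  induction l generalizing m with
  | nil => simp [dotNat]
  | cons a l ih =>
    cases m with
    | nil => simp [dotNat]
    | cons c m =>
      rw [dotNat, ih, List.length_cons, Finset.sum_range_succ']
      simp only [List.getD_cons_succ, List.getD_cons_zero]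
      exact Nat.add_comm _ _

theorem getD_of_checkRow {a : List ℕ} {i : ℕ} {cs : List (List ℕ)} {j₀ : ℕ}
    (h : checkRow a i cs j₀ = true) {j : ℕ} (hj : j < cs.length) :
    dotNat a (cs.getD j []) % 17 = if i = j₀ + j then 1 else 0 := by
  induction cs generalizing j₀ j with
  | nil => simp at hj
  | cons c cs ih =>
    rw [checkRow, Bool.and_eq_true, Nat.beq_eq] at h
    cases j with
    | zero =>
      rw [List.getD_cons_zero, add_zero]
      refine h.1.trans ?_
      rw [natBeq_eq_decide]
      by_cases hij : i = j₀ <;> simp [hij]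
    | succ j =>
      rw [List.getD_cons_succ, ih h.2 (by simpa using hj)]
      have : j₀ + 1 + j = j₀ + (j + 1) := by lia
      rw [this]

theorem getD_of_checkRows {cs as : List (List ℕ)} {i₀ : ℕ} (h : checkRows cs as i₀ = true)
    {i j : ℕ} (hi : i < as.length) (hj : j < cs.length) :
    dotNat (as.getD i []) (cs.getD j []) % 17 = if i₀ + i = j then 1 else 0 := by
  induction as generalizing i₀ i with
  | nil => simp at hi
  | cons a as ih =>
    rw [checkRows, Bool.and_eq_true] at h
    cases i with
    | zero =>
      rw [List.getD_cons_zero, getD_of_checkRow h.1 hj]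
      simp
    | succ i =>
      rw [List.getD_cons_succ, ih h.2 (by simpa using hi)]
      have : i₀ + 1 + i = i₀ + (i + 1) := by lia
      rw [this]

/-- The entries of the collocation matrix, times `4 * 60 ^ 5`. -/
def collocationEntry (r s : Member) : ℤ :=
  s.weight * linComb s.coeffs
    (generators (intPowers r.point.1 r.point.2 60) r.point.1 r.point.2 60)

theorem collocationColumns_getD {rs : List Member} {i j : ℕ} (hi : i < rs.length)
    (hj : j < rs.length) :
    ((collocationColumns rs).getD j []).getD i 0 = (collocationEntry rs[i] rs[j] % 17).toNat := by
  rw [collocationColumns, List.getD_eq_getElem (n := j) _ _ (by simpa using hj), List.getElem_map,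
    List.getD_eq_getElem (n := i) _ _ (by simpa using hi), List.getElem_map, List.getElem_map]
  rfl

theorem cast_intPowers (x y o : ℤ) :
    (intPowers x y o).map (Int.cast : ℤ → ℝ) = posPowers x y o := by
  rw [intPowers, posPowers, List.map_map]
  refine List.map_congr_left fun l _ => ?_
  rw [Function.comp_apply, Int.cast_pow, Int.cast_max, (OpsHom.intCast (R := ℝ)).linForm,
    Int.cast_zero]

theorem posPowers_homogeneous {k : ℝ} (hk : 0 ≤ k) (x y o : ℝ) :
    posPowers (k * x) (k * y) (k * o) = (posPowers x y o).map (k ^ 4 * ·) := by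
  rw [posPowers, posPowers, List.map_map]
  refine List.map_congr_left fun l _ => ?_
  have h : linForm l (k * x) (k * y) (k * o) = k * linForm l x y o := by
    simp only [linForm_eq]; ring
  rw [h, Function.comp_apply, ← mul_pow, mul_max_of_nonneg _ _ hk, mul_zero]

theorem cast_collocationEntry (r s : Member) :
    (collocationEntry r s : ℝ) =
      4 * 60 ^ 5 * (s.weight / 4 * splineVal s.coeffs (r.point.1 / 60) (r.point.2 / 60)) := by
  have hom := OpsHom.intCast (R := ℝ)
  rw [collocationEntry, Int.cast_mul, hom.linComb, hom.generators, cast_intPowers]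
  have h1 : (r.point.1 : ℝ) = 60 * (r.point.1 / 60) := by ring
  have h2 : (r.point.2 : ℝ) = 60 * (r.point.2 / 60) := by ring
  have h3 : ((60 : ℤ) : ℝ) = 60 * 1 := by norm_num
  rw [h3]
  conv_lhs => rw [h1, h2]
  rw [posPowers_homogeneous (by norm_num), generators_homogeneous, linComb_map_mul, splineVal]
  ring

theorem mul_eq_one_of_checkRows {rs : List Member} {as : List (List ℕ)} {n : ℕ}
    (hrs : rs.length = n) (has : as.length = n) (has' : ∀ a ∈ as, a.length = n)
    (hc : checkRows (collocationColumns rs) as 0 = true) :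
    (Matrix.of fun i k : Fin n => (((as.getD i []).getD k 0 : ℕ) : ZMod 17)) *
      (Matrix.of fun i j : Fin n => collocationEntry (rs.get (i.cast hrs.symm))
        (rs.get (j.cast hrs.symm))).map (Int.cast : ℤ → ZMod 17) = 1 := by
  ext i j
  have hi : (i : ℕ) < as.length := by rw [has]; exact i.2
  have hj : (j : ℕ) < rs.length := by rw [hrs]; exact j.2
  have hrow : (as.getD i []).length = n := by
    rw [List.getD_eq_getElem _ _ hi]
    exact has' _ (List.getElem_mem _)
  have h := getD_of_checkRows hc hi (j := j) (by simpa [collocationColumns] using hj)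
  rw [dotNat_eq, hrow, ← Fin.sum_univ_eq_sum_range
    (fun k => (as.getD i []).getD k 0 * ((collocationColumns rs).getD j []).getD k 0)] at h
  have h' := congrArg (Nat.cast : ℕ → ZMod 17) h
  rw [ZMod.natCast_mod, Nat.cast_sum] at h'
  rw [Matrix.mul_apply, Matrix.one_apply]
  refine Eq.trans (Finset.sum_congr rfl fun k _ => ?_) (h'.trans ?_)
  swap
  · rw [zero_add, Nat.cast_ite, Nat.cast_one, Nat.cast_zero]
    simp only [Fin.ext_iff]
  have hk : (k : ℕ) < rs.length := by rw [hrs]; exact k.2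
  rw [Nat.cast_mul, collocationColumns_getD hk hj, Matrix.of_apply, Matrix.map_apply,
    Matrix.of_apply]
  congr 1
  -- The columns hold residues as natural numbers; the Euclidean remainder is nonnegative, so
  -- nothing is lost under `toNat`.
  have hz := Int.toNat_of_nonneg (Int.emod_nonneg
    (collocationEntry rs[(k : ℕ)] rs[(j : ℕ)]) (b := 17) (by norm_num))
  rw [← Int.cast_natCast, hz]
  exact (ZMod.intCast_mod _ 17).symm

/-- Reduction modulo `p` commutes with determinants, and a matrix with a left inverse modulo `p` has
nonzero determinant there. -/
theorem det_ne_zero_of_mul_eq_one {n p : ℕ} [Fact p.Prime] {N : Matrix (Fin n) (Fin n) ℤ}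
    {A : Matrix (Fin n) (Fin n) (ZMod p)} (h : A * N.map (Int.cast : ℤ → ZMod p) = 1) :
    N.det ≠ 0 := by
  intro h0
  have hdet := congrArg Matrix.det h
  have : (N.map (Int.cast : ℤ → ZMod p)).det = 0 := by
    have := (Int.castRingHom (ZMod p)).map_det N
    rw [h0, map_zero] at this
    exact this.symm
  rw [Matrix.det_mul, this, mul_zero, Matrix.det_one] at hdet
  exact zero_ne_one hdet

theorem det_collocationEntry_ne_zero (b : BasisName) :
    (Matrix.of fun i j : Fin 39 => collocationEntry
      ((members b).get (i.cast (length_members b).symm))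
      ((members b).get (j.cast (length_members b).symm))).det ≠ 0 :=
  haveI : Fact (Nat.Prime 17) := ⟨by norm_num⟩
  det_ne_zero_of_mul_eq_one (mul_eq_one_of_checkRows (length_members b) (length_inverseRows b).1
    (length_inverseRows b).2 (checkRows_members b))

/-- The numbering of the basis functions. -/
noncomputable def indexEquiv (b : BasisName) : Fin 39 ≃ Index b :=
  Equiv.ofBijective
    (fun i => ⟨((members b).get (i.cast (length_members b).symm)).entry,
      entry_mem b (List.get_mem _ _)⟩) (by
    rw [Fintype.bijective_iff_injective_and_card]
    constructor
    · intro i j hij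
      have h := congrArg Subtype.val hij
      have h1 := List.inj_on_of_nodup_map (nodup_map_entry b) (List.get_mem _ _)
        (List.get_mem _ _) h
      have h2 := (List.Nodup.of_map _ (nodup_map_entry b)).injective_get h1
      simpa using h2
    · rw [Fintype.card_fin, Fintype.card_coe, card_entries])

theorem memberOf_indexEquiv (b : BasisName) (i : Fin 39) :
    memberOf b (indexEquiv b i) = (members b).get (i.cast (length_members b).symm) :=
  memberOf_eq b (List.get_mem _ _) rfl

theorem isUnit_det_collocationMatrix (b : BasisName) : IsUnit (collocationMatrix b).det := by
  rw [isUnit_iff_ne_zero, ← Matrix.det_submatrix_equiv_self (indexEquiv b)]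
  intro h
  -- Domain points have coordinates in sixtieths, the splines have degree 5 and the weights are
  -- quarters, so `4 * 60 ^ 5` makes all entries integral.
  have h1 : (Matrix.of fun i j : Fin 39 => collocationEntry
      ((members b).get (i.cast (length_members b).symm))
      ((members b).get (j.cast (length_members b).symm))).map (Int.cast : ℤ → ℝ) =
      (4 * 60 ^ 5 : ℝ) • (collocationMatrix b).submatrix (indexEquiv b) (indexEquiv b) := by
    ext i j
    rw [Matrix.map_apply, Matrix.of_apply, cast_collocationEntry, Matrix.smul_apply,
      Matrix.submatrix_apply, collocationMatrix, Matrix.of_apply, memberOf_indexEquiv,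
      memberOf_indexEquiv, smul_eq_mul]
  have h2 := congrArg Matrix.det h1
  rw [Matrix.det_smul, h, mul_zero] at h2
  have h3 := (Int.castRingHom ℝ).map_det (Matrix.of fun i j : Fin 39 => collocationEntry
      ((members b).get (i.cast (length_members b).symm))
      ((members b).get (j.cast (length_members b).symm)))
  exact det_collocationEntry_ne_zero b (Int.cast_injective ((h3.trans h2).trans Int.cast_zero.symm))

/-! ### The macrotriangle -/

theorem isCompact_triangle (v : Fin 3 → Plane) : IsCompact (triangle v) :=
  (Set.finite_range v).isCompact_convexHull ℝ

theorem convex_triangle (v : Fin 3 → Plane) : Convex ℝ (triangle v) := convex_convexHull ℝ _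

theorem interior_triangle_nonempty {v : Fin 3 → Plane} (hv : AffineIndependent ℝ v) :
    (interior (triangle v)).Nonempty := by
  rw [triangle, interior_convexHull_nonempty_iff_affineSpan_eq_top,
    hv.affineSpan_eq_top_iff_card_eq_finrank_add_one]
  simp

/-- Distances between points of a convex hull are dominated by distances between generating points.
-/
theorem dist_le_longestEdge {v : Fin 3 → Plane} {x y : Plane} (hx : x ∈ triangle v)
    (hy : y ∈ triangle v) : dist x y ≤ longestEdge v := by
  obtain ⟨_, ⟨i, rfl⟩, _, ⟨j, rfl⟩, h⟩ := convexHull_exists_dist_ge2 hx hy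
  refine h.trans ?_
  have h01 : dist (v 0) (v 1) ≤ longestEdge v := (le_max_left _ _).trans (le_max_left _ _)
  have h12 : dist (v 1) (v 2) ≤ longestEdge v := (le_max_right _ _).trans (le_max_left _ _)
  have h02 : dist (v 0) (v 2) ≤ longestEdge v := le_max_right _ _
  have h0 : 0 ≤ longestEdge v := dist_nonneg.trans h01
  fin_cases i <;> fin_cases j <;> simp only [Fin.zero_eta, Fin.mk_one, Fin.reduceFinMk, dist_self,
    h0, h01, h12, h02, dist_comm (v 1) (v 0), dist_comm (v 2) (v 1), dist_comm (v 2) (v 0)]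

/-- A continuous function is bounded on the macrotriangle by its essential supremum. -/
theorem ofReal_abs_le_eLpNorm {v : Fin 3 → Plane} (hv : AffineIndependent ℝ v) {f F : Plane → ℝ}
    (hF : Continuous F) (hfF : ∀ x ∈ triangle v, f x = F x) {x : Plane} (hx : x ∈ triangle v) :
    ENNReal.ofReal |f x| ≤ eLpNorm f ⊤ (volume.restrict (triangle v)) := by
  by_contra! hlt
  rw [hfF x hx, ← Real.norm_eq_abs, ofReal_norm] at hlt
  set C := eLpNorm f ⊤ (volume.restrict (triangle v)) with hC
  have hopen : IsOpen {y | C < ‖F y‖ₑ} := isOpen_lt continuous_const hF.enorm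
  -- The interior is dense in the triangle, so an open set around `x` on which the bound fails would
  -- meet it in a set of positive measure.
  have hcl : x ∈ closure (interior (triangle v)) := by
    rw [(convex_triangle v).closure_interior_eq_closure_of_nonempty_interior
      (interior_triangle_nonempty hv)]
    exact subset_closure hx
  have hne : ({y | C < ‖F y‖ₑ} ∩ interior (triangle v)).Nonempty :=
    mem_closure_iff.1 hcl _ hopen hlt
  have hpos := (hopen.inter isOpen_interior).measure_pos volume hne
  have hae : ∀ᵐ y ∂volume.restrict (triangle v), ‖f y‖ₑ ≤ C := by
    rw [hC, eLpNorm_exponent_top]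
    exact ae_le_eLpNormEssSup
  have hzero := (ae_restrict_iff' (isCompact_triangle v).measurableSet).1 hae
  refine hpos.ne' (measure_mono_null ?_ (ae_iff.1 hzero))
  rintro y ⟨hy1, hy2⟩ h
  have hyT := interior_subset hy2
  have := h hyT
  rw [hfF y hyT] at this
  exact absurd hy1 (not_lt.2 this)

theorem eLpNorm_le_ofReal {v : Fin 3 → Plane} {f : Plane → ℝ} {C : ℝ}
    (h : ∀ x ∈ triangle v, |f x| ≤ C) :
    eLpNorm f ⊤ (volume.restrict (triangle v)) ≤ ENNReal.ofReal C := by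
  rw [eLpNorm_exponent_top]
  exact eLpNormEssSup_le_of_ae_bound
    (ae_restrict_of_forall_mem (isCompact_triangle v).measurableSet h)

/-! ### Splines -/

noncomputable def smoothSpline (b : BasisName) (v : Fin 3 → Plane) (c : Index b → ℝ) (x : Plane) : ℝ :=
  ∑ s, c s * smoothBasis b v s x

theorem contDiff_smoothSpline (b : BasisName) (v : Fin 3 → Plane) (c : Index b → ℝ) :
    ContDiff ℝ 3 (smoothSpline b v c) := by
  unfold smoothSpline smoothBasis
  exact ContDiff.sum fun s _ => contDiff_const.mul (contDiff_const.mul (contDiff_splineVal v _))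

section

variable {v : Fin 3 → Plane} (hv : AffineIndependent ℝ v) (b : BasisName) (c : Index b → ℝ)

include hv

theorem spline_eq {x : Plane} (hx : x ∈ triangle v) : spline b v c x = smoothSpline b v c x :=
  Finset.sum_congr rfl fun s _ => by rw [basisSpline_eq hv b s hx]

/-- The value is a convex combination of the coefficients. -/
theorem abs_spline_le {x : Plane} (hx : x ∈ triangle v) : |spline b v c x| ≤ ‖c‖ := by
  rw [spline_eq hv b c hx, smoothSpline]
  refine (Finset.abs_sum_le_sum_abs _ _).trans ?_
  calc ∑ s, |c s * smoothBasis b v s x| ≤ ∑ s, ‖c‖ * smoothBasis b v s x := by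
        refine Finset.sum_le_sum fun s _ => ?_
        have hs := smoothBasis_nonneg hv b s hx
        rw [abs_mul, abs_of_nonneg hs]
        exact mul_le_mul_of_nonneg_right (norm_le_pi_norm c s) hs
    _ = ‖c‖ := by rw [← Finset.mul_sum, sum_smoothBasis, mul_one]

theorem face_subset_triangle (k : Fin 12) : face v k ⊆ triangle v := by
  refine convexHull_min ?_ (convex_triangle v)
  rintro _ ⟨j, -, rfl⟩
  rw [mem_triangle hv, baryX_vertex hv, baryY_vertex hv]
  fin_cases j <;> simp [coordsAt, vertexCoords] <;> norm_num

theorem spline_mem_splineSpace : spline b v c ∈ splineSpace v := by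
  refine ⟨(contDiff_smoothSpline b v c).contDiffOn.congr fun x hx => spline_eq hv b c hx, ?_⟩
  intro k
  choose p hp hp' using fun s => exists_polynomial_facePiece v (faceLists.getD k [])
    (memberOf b s).coeffs
  refine ⟨∑ s, MvPolynomial.C (c s * ((memberOf b s).weight / 4)) * p s, ?_, ?_⟩
  · refine MvPolynomial.totalDegree_finsetSum_le fun s _ => ?_
    refine (MvPolynomial.totalDegree_mul _ _).trans ?_
    rw [MvPolynomial.totalDegree_C, zero_add]
    exact hp s
  · intro x hx
    rw [spline_eq hv b c (face_subset_triangle hv k hx), smoothSpline, map_sum]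
    refine Finset.sum_congr rfl fun s _ => ?_
    rw [map_mul, MvPolynomial.eval_C, ← hp', smoothBasis,
      splineVal_eq_facePiece (faceLists_getD_mem k) ((mem_face hv).1 hx)]
    ring

theorem collocationMatrix_mulVec (i : Index b) :
    (collocationMatrix b).mulVec c i = spline b v c (domainPoint b v i) := by
  rw [← collocation_eq hv b, Matrix.mulVec, dotProduct, spline]
  exact Finset.sum_congr rfl fun s _ => mul_comm _ _

/-- Reproduction of affine functions. -/
theorem smoothSpline_affine {φ : Plane → ℝ} {p q r : ℝ}
    (hφ : ∀ y, φ y = p + q * baryX v y + r * baryY v y) (x : Plane) :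
    smoothSpline b v (fun s => φ (domainPoint b v s)) x = φ x := by
  rw [hφ, ← sum_affine_mul_smoothBasis b v p q r x, smoothSpline]
  refine Finset.sum_congr rfl fun s _ => ?_
  rw [hφ, domainPoint_eq, baryX_baryPoint hv, baryY_baryPoint hv]

end

theorem nonempty_index (b : BasisName) : Nonempty (Index b) := ⟨indexEquiv b 0⟩

/-- The coefficients are `M⁻¹` applied to the values at the domain points. These values are bounded
by the essential supremum because the spline is continuous on the triangle. -/
theorem isStabilityConstant_norm_inv (b : BasisName) :
    IsStabilityConstant b ‖(collocationMatrix b)⁻¹‖ := by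
  have hunit := isUnit_det_collocationMatrix b
  have := nonempty_index b
  -- The inverse cannot be zero, since the index set is nonempty and `0 ≠ 1` for matrices over it.
  have hpos : 0 < ‖(collocationMatrix b)⁻¹‖ := by
    rw [norm_pos_iff]
    intro h
    have h1 := Matrix.mul_nonsing_inv _ hunit
    rw [h, mul_zero] at h1
    exact zero_ne_one h1
  refine ⟨hpos, fun v hv c => ?_⟩
  have hupper := eLpNorm_le_ofReal fun x hx => abs_spline_le hv b c hx
  refine ⟨?_, hupper⟩
  have hfin : eLpNorm (spline b v c) ⊤ (volume.restrict (triangle v)) ≠ ⊤ :=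
    ne_top_of_le_ne_top ENNReal.ofReal_ne_top hupper
  set L := eLpNorm (spline b v c) ⊤ (volume.restrict (triangle v)) with hL
  have hM : ‖(collocationMatrix b).mulVec c‖ ≤ L.toReal := by
    rw [pi_norm_le_iff_of_nonneg ENNReal.toReal_nonneg]
    intro i
    rw [collocationMatrix_mulVec hv b c i, Real.norm_eq_abs]
    exact (ENNReal.ofReal_le_iff_le_toReal hfin).1
      (ofReal_abs_le_eLpNorm hv (contDiff_smoothSpline b v c).continuous
        (fun x hx => spline_eq hv b c hx) (domainPoint_mem hv b i))
  have hc : c = (collocationMatrix b)⁻¹.mulVec ((collocationMatrix b).mulVec c) := by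
    rw [Matrix.mulVec_mulVec, Matrix.nonsing_inv_mul _ hunit, Matrix.one_mulVec]
  have hle : ‖c‖ ≤ ‖(collocationMatrix b)⁻¹‖ * L.toReal := by
    conv_lhs => rw [hc]
    exact (Matrix.linfty_opNorm_mulVec _ _).trans (mul_le_mul_of_nonneg_left hM hpos.le)
  rw [ENNReal.ofReal_le_iff_le_toReal hfin, inv_mul_le_iff₀ hpos]
  exact hle

/-! ### The Hessian -/

theorem norm_matrix_two (A : Matrix (Fin 2) (Fin 2) ℝ) :
    ‖A‖ = max (|A 0 0| + |A 0 1|) (|A 1 0| + |A 1 1|) := by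
  have hu : (Finset.univ : Finset (Fin 2)) = {0, 1} := rfl
  rw [Matrix.linfty_opNorm_def, hu]
  simp only [Finset.sup_insert, Finset.sup_singleton]
  simp

section

variable {v : Fin 3 → Plane} (hv : AffineIndependent ℝ v) {f F : Plane → ℝ} (hF : ContDiff ℝ 3 F)
  (hfF : ∀ x ∈ triangle v, f x = F x)

include hv hF hfF

/-- The triangle is convex with nonempty interior, so derivatives within it are unique and agree, up
to the boundary, with those of the smooth extension `F`. -/
theorem hessian_apply {x : Plane} (hx : x ∈ triangle v) (i j : Fin 2) :
    hessian v f x i j = fderiv ℝ (fderiv ℝ F) x (EuclideanSpace.single i 1)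
      (EuclideanSpace.single j 1) := by
  have hu : UniqueDiffOn ℝ (triangle v) :=
    uniqueDiffOn_convex (convex_triangle v) (interior_triangle_nonempty hv)
  have hF2 : ContDiff ℝ 2 F := hF.of_le (by norm_num)
  rw [hessian, Matrix.of_apply, iteratedFDerivWithin_congr hfF hx,
    iteratedFDerivWithin_eq_iteratedFDeriv hu hF2.contDiffAt hx, iteratedFDeriv_two_apply]
  simp

theorem exists_isGreatest_hessian :
    ∃ H, IsGreatest ((fun x => ‖hessian v f x‖) '' triangle v) H := by
  have h2 : ContDiff ℝ 2 (fderiv ℝ F) := hF.fderiv_right (by norm_num)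
  have h1 : ContDiff ℝ 1 (fderiv ℝ (fderiv ℝ F)) := h2.fderiv_right (by norm_num)
  have hc : ∀ i j : Fin 2, Continuous fun x => fderiv ℝ (fderiv ℝ F) x
      (EuclideanSpace.single i 1) (EuclideanSpace.single j 1) := fun i j =>
    (h1.continuous.clm_apply continuous_const).clm_apply continuous_const
  have hcont : ContinuousOn (fun x => ‖hessian v f x‖) (triangle v) := by
    have hg : Continuous fun x => max
        (|fderiv ℝ (fderiv ℝ F) x (EuclideanSpace.single 0 1) (EuclideanSpace.single 0 1)| +
          |fderiv ℝ (fderiv ℝ F) x (EuclideanSpace.single 0 1) (EuclideanSpace.single 1 1)|)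
        (|fderiv ℝ (fderiv ℝ F) x (EuclideanSpace.single 1 1) (EuclideanSpace.single 0 1)| +
          |fderiv ℝ (fderiv ℝ F) x (EuclideanSpace.single 1 1) (EuclideanSpace.single 1 1)|) :=
      ((hc 0 0).abs.add (hc 0 1).abs).max ((hc 1 0).abs.add (hc 1 1).abs)
    refine hg.continuousOn.congr fun x hx => ?_
    simp only [norm_matrix_two, hessian_apply hv hF hfF hx]
  have hne : (triangle v).Nonempty := (interior_triangle_nonempty hv).mono interior_subset
  exact ((isCompact_triangle v).image_of_continuousOn hcont).exists_isGreatest (hne.image _)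

/-- The bilinear form is a sum over two rows. Each row contributes at most `H ‖u‖ ‖w‖`, as
coordinates are bounded by the Euclidean norm. The factor 2 of the final estimate arises here. -/
theorem norm_fderiv_fderiv_le {H : ℝ} (hH : ∀ x ∈ triangle v, ‖hessian v f x‖ ≤ H) {x : Plane}
    (hx : x ∈ triangle v) : ‖fderiv ℝ (fderiv ℝ F) x‖ ≤ 2 * H := by
  have hH0 : 0 ≤ H := (norm_nonneg _).trans (hH x hx)
  have hA := hH x hx
  rw [norm_matrix_two, max_le_iff, hessian_apply hv hF hfF hx, hessian_apply hv hF hfF hx,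
    hessian_apply hv hF hfF hx, hessian_apply hv hF hfF hx] at hA
  set B := fderiv ℝ (fderiv ℝ F) x
  have hdec : ∀ u : Plane, u = u 0 • EuclideanSpace.single 0 1 + u 1 • EuclideanSpace.single 1 1 := by
    intro u
    ext l; fin_cases l <;> simp
  have hcoord : ∀ (u : Plane) (i : Fin 2), |u i| ≤ ‖u‖ := fun u i => by
    rw [← Real.norm_eq_abs]; exact PiLp.norm_apply_le u i
  refine ContinuousLinearMap.opNorm_le_bound _ (by positivity) fun u => ?_
  refine ContinuousLinearMap.opNorm_le_bound _ (by positivity) fun w => ?_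
  have hrow : ∀ i : Fin 2, |B (EuclideanSpace.single i 1) (EuclideanSpace.single 0 1)| +
      |B (EuclideanSpace.single i 1) (EuclideanSpace.single 1 1)| ≤ H →
      |B (EuclideanSpace.single i 1) w| ≤ H * ‖w‖ := by
    intro i hi
    conv_lhs => rw [hdec w]
    rw [map_add, map_smul, map_smul, smul_eq_mul, smul_eq_mul]
    refine (abs_add_le _ _).trans ?_
    rw [abs_mul, abs_mul]
    calc _ ≤ ‖w‖ * |B (EuclideanSpace.single i 1) (EuclideanSpace.single 0 1)| +
          ‖w‖ * |B (EuclideanSpace.single i 1) (EuclideanSpace.single 1 1)| := by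
          gcongr <;> exact hcoord w _
      _ = (|B (EuclideanSpace.single i 1) (EuclideanSpace.single 0 1)| +
          |B (EuclideanSpace.single i 1) (EuclideanSpace.single 1 1)|) * ‖w‖ := by ring
      _ ≤ H * ‖w‖ := by gcongr
  have h0 := hrow 0 hA.1
  have h1 := hrow 1 hA.2
  rw [Real.norm_eq_abs]
  conv_lhs => rw [hdec u]
  rw [map_add, map_smul, map_smul, add_apply, smul_apply,
    smul_apply, smul_eq_mul, smul_eq_mul]
  refine (abs_add_le _ _).trans ?_
  rw [abs_mul, abs_mul]
  calc _ ≤ ‖u‖ * (H * ‖w‖) + ‖u‖ * (H * ‖w‖) := by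
        gcongr <;> exact hcoord u _
    _ = 2 * H * ‖u‖ * ‖w‖ := by ring

/-- The deviation from the tangent plane. -/
theorem abs_sub_tangent_le {H : ℝ} (hH : ∀ x ∈ triangle v, ‖hessian v f x‖ ≤ H) {x ξ : Plane}
    (hx : x ∈ triangle v) (hξ : ξ ∈ triangle v) :
    |F x - F ξ - fderiv ℝ F ξ (x - ξ)| ≤ 2 * H * longestEdge v ^ 2 := by
  have hH0 : 0 ≤ H := (norm_nonneg _).trans (hH x hx)
  have hd1 : Differentiable ℝ F := hF.differentiable (by norm_num)
  have hd2 : Differentiable ℝ (fderiv ℝ F) :=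
    (hF.fderiv_right (m := 2) (by norm_num)).differentiable (by norm_num)
  have hlen : ∀ y ∈ triangle v, ‖y - ξ‖ ≤ longestEdge v := fun y hy => by
    rw [← dist_eq_norm]; exact dist_le_longestEdge hy hξ
  have hh : 0 ≤ longestEdge v := (norm_nonneg _).trans (hlen x hx)
  -- The mean value inequality is applied to the derivative, then to `F` minus its linear part; the
  -- factor 1/2 of Taylor's formula is not needed.
  have h1 : ∀ y ∈ triangle v, ‖fderiv ℝ F y - fderiv ℝ F ξ‖ ≤ 2 * H * longestEdge v := by
    intro y hy
    refine ((convex_triangle v).norm_image_sub_le_of_norm_fderiv_le (fun z _ => hd2 z)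
      (fun z hz => norm_fderiv_fderiv_le hv hF hfF hH hz) hξ hy).trans ?_
    exact mul_le_mul_of_nonneg_left (hlen y hy) (by positivity)
  have h2 := (convex_triangle v).norm_image_sub_le_of_norm_fderiv_le' (fun z _ => hd1 z) h1 hξ hx
  rw [Real.norm_eq_abs] at h2
  refine h2.trans ?_
  calc _ ≤ 2 * H * longestEdge v * longestEdge v :=
        mul_le_mul_of_nonneg_left (hlen x hx) (by positivity)
    _ = _ := by ring

end

/-! ### Distance between coefficients and values at the domain points -/

theorem tangent_eq_affine {v : Fin 3 → Plane} (hv : AffineIndependent ℝ v) (a : ℝ)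
    (L : Plane →L[ℝ] ℝ) (ξ y : Plane) :
    a + L (y - ξ) = (a + L (v 2) - L ξ) + (L (v 0) - L (v 2)) * baryX v y +
      (L (v 1) - L (v 2)) * baryY v y := by
  conv_lhs => rw [← baryPoint_bary hv y]
  simp only [baryPoint, map_sub, map_add, map_smul, smul_eq_mul]
  ring

/-- Lower stability is applied, for each index separately, to the spline minus its tangent plane at
that domain point. Affine reproduction identifies the coefficients of this difference. -/
theorem norm_coeff_sub_le {b : BasisName} {K : ℝ} (hK : IsStabilityConstant b K)
    {v : Fin 3 → Plane} (hv : AffineIndependent ℝ v) (c : Index b → ℝ) {H : ℝ}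
    (hH : ∀ x ∈ triangle v, ‖hessian v (spline b v c) x‖ ≤ H) :
    ‖c - fun s => spline b v c (domainPoint b v s)‖ ≤ 2 * K * longestEdge v ^ 2 * H := by
  have hK0 := hK.1
  obtain ⟨x₀, hx₀⟩ := (interior_triangle_nonempty hv).mono interior_subset
  have hH0 : 0 ≤ H := (norm_nonneg _).trans (hH x₀ hx₀)
  have hF := contDiff_smoothSpline b v c
  have hfF : ∀ x ∈ triangle v, spline b v c x = smoothSpline b v c x :=
    fun x hx => spline_eq hv b c hx
  rw [pi_norm_le_iff_of_nonneg (by positivity)]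
  intro i
  set ξ := domainPoint b v i with hξ
  have hξT : ξ ∈ triangle v := domainPoint_mem hv b i
  set F := smoothSpline b v c with hFdef
  let φ : Plane → ℝ := fun y => F ξ + fderiv ℝ F ξ (y - ξ)
  have hφ := fun y => tangent_eq_affine hv (F ξ) (fderiv ℝ F ξ) ξ y
  let d : Index b → ℝ := fun s => c s - φ (domainPoint b v s)
  have hd : ∀ x ∈ triangle v, spline b v d x = F x - F ξ - fderiv ℝ F ξ (x - ξ) := by
    intro x hx
    have h1 := smoothSpline_affine hv b (φ := φ) hφ x
    have h2 : spline b v d x = F x - smoothSpline b v (fun s => φ (domainPoint b v s)) x := by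
      rw [spline_eq hv b d hx, hFdef]
      simp only [smoothSpline, d, sub_mul, Finset.sum_sub_distrib]
    rw [h2, h1]
    simp only [φ]
    ring
  have hbound : eLpNorm (spline b v d) ⊤ (volume.restrict (triangle v)) ≤
      ENNReal.ofReal (2 * H * longestEdge v ^ 2) :=
    eLpNorm_le_ofReal fun x hx => by
      rw [hd x hx]
      exact abs_sub_tangent_le hv hF hfF hH hx hξT
  have hlow := (ENNReal.ofReal_le_ofReal_iff (by positivity)).1
    (((hK.2 v hv d).1).trans hbound)
  rw [inv_mul_le_iff₀ hK0] at hlow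
  -- The tangent plane touches at `ξ`, so the coefficient of the difference at index `i` is exactly
  -- `cᵢ - f(ξᵢ)`.
  have hdi : (c - fun s => spline b v c (domainPoint b v s)) i = d i := by
    have h0 : φ ξ = F ξ := by simp [φ]
    rw [Pi.sub_apply, hfF _ (domainPoint_mem hv b i), ← hξ]
    simp only [d]
    rw [← hξ, h0]
  rw [hdi]
  refine (norm_le_pi_norm d i).trans (hlow.trans (le_of_eq ?_))
  ring

end PS12

theorem mainTheorem5 (b : PS12.BasisName) :
    (∃ K : ℝ, PS12.IsStabilityConstant b K ∧
      ∀ v : Fin 3 → PS12.Plane, AffineIndependent ℝ v →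
        IsUnit (PS12.collocation b v).det ∧ ‖(PS12.collocation b v)⁻¹‖ = K) ∧
    ∀ K : ℝ, PS12.IsStabilityConstant b K →
      ∀ v : Fin 3 → PS12.Plane, AffineIndependent ℝ v → ∀ c : PS12.Index b → ℝ,
        PS12.spline b v c ∈ PS12.splineSpace v ∧
        ∃ H : ℝ,
          IsGreatest ((fun x => ‖PS12.hessian v (PS12.spline b v c) x‖) '' PS12.triangle v) H ∧
          ‖c - fun s => PS12.spline b v c (PS12.domainPoint b v s)‖ ≤
            2 * K * PS12.longestEdge v ^ 2 * H := by
  refine ⟨⟨‖(PS12.collocationMatrix b)⁻¹‖, PS12.isStabilityConstant_norm_inv b, fun v hv => ?_⟩,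
    fun K hK v hv c => ⟨PS12.spline_mem_splineSpace hv b c, ?_⟩⟩
  · rw [PS12.collocation_eq hv b]
    exact ⟨PS12.isUnit_det_collocationMatrix b, rfl⟩
  · obtain ⟨H, hH⟩ := PS12.exists_isGreatest_hessian hv (PS12.contDiff_smoothSpline b v c)
      fun x hx => PS12.spline_eq hv b c hx
    exact ⟨H, hH, PS12.norm_coeff_sub_le hK hv c fun x hx => hH.2 ⟨x, hx, rfl⟩⟩
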